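/- **Maintenance scheduling problem.** An instance consists of a corridor $[0,L]$, a headway $\Delta$, a travel time $\delta$ (positive rationals), a number $m$ of train paths in each direction, and $n$ jobs. For $i=1,\dots,m$ the up-path $\ell_i^u$ is the segment from $(i\Delta,0)$ to $(i\Delta+\delta,L)$ and the down-path $\ell_i^d$ is the segment from $(i\Delta,L)$ to $(i\Delta+\delta,0)$ in the (time, location) plane. Job $j$ has rational data $r_j,p_j\ge 0$, $d_j$ with $r_j\le d_j-p_j$, and $0\le l^s_j\le l^e_j\le L$. If it starts at time $s_j\in[r_j,d_j-p_j]$, all paths that meet the rectangle $[s_j,s_j+p_j]\times[l_j^s,l_j^e]$ are cancelled. The task is to find start times $s_j\in[r_j,d_j-p_j]$ for all jobs such that the total number of cancelled paths is minimum. A possession of job $j$ is an inclusion-minimal set among the sets of paths which $j$ cancels for its various admissible start times. **Theorem.** Consider the instances of the (bidirectional) maintenance scheduling problem in which every possession consists of exactly one path and every path intersects at most $K$ other paths (for every constant $\kappa$, the latter holds with $K=2\kappa+1$ whenever $\delta/\Delta\le\kappa$). These instances can be solved in time $O(n^2)$, where the implied constant depends only on $K$; in particular the time does not depend on $m$. Here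 the running time refers to one program, the same for all $K$, on a random access machine with unit-cost integer arithmetic (addition, subtraction, multiplication, integer division, comparison) and indirect addressing, whose words hold integers of $O_K(\log(M+2))$ bits, where $M$ bounds the absolute values of $n$, $m$ and of the numerators and denominators of all input data. The program receives the numbers $n,m,L,\Delta,\delta$ and the data of the jobs, and outputs an optimal vector of start times, as fractions. For $n=0$, the bound $O(n^2)$ is read as $O(1)$. -/

import Mathlib

namespace Maintenance

/-! ### The maintenance scheduling problem -/

/-- A maintenance job: earliest start time `r`, latest finish time `d`, processing time `p`,
start location `ls` and end location `le`. -/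
structure Job where
  r : ℚ
  d : ℚ
  p : ℚ
  ls : ℚ
  le : ℚ

/-- An instance: `n` jobs, `m` train paths in each direction, a corridor `[0, L]`, the headway `Δ`
between consecutive paths of one direction, and the total travel time `δ` of a train. -/
structure Inst where
  n : ℕ
  m : ℕ
  L : ℚ
  Δ : ℚ
  δ : ℚ
  job : Fin n → Job

/-- The standing assumptions on the data. The last clause says that each job has at least one
admissible start time. -/
structure Inst.IsValid (I : Inst) : Prop where
  L_pos : 0 < I.L
  headway_pos : 0 < I.Δ
  travel_pos : 0 < I.δ
  r_nonneg : ∀ j, 0 ≤ (I.job j).r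
  p_nonneg : ∀ j, 0 ≤ (I.job j).p
  ls_nonneg : ∀ j, 0 ≤ (I.job j).ls
  ls_le : ∀ j, (I.job j).ls ≤ (I.job j).le
  le_L : ∀ j, (I.job j).le ≤ I.L
  window : ∀ j, (I.job j).r ≤ (I.job j).d - (I.job j).p

/-- The train paths: `Sum.inl i` is the up-path and `Sum.inr i` the down-path with number `i + 1`
(paths are numbered `1, …, m`, while `Fin m` starts at `0`). -/
abbrev TrainPath (m : ℕ) : Type := Fin m ⊕ Fin m

/-- A train path as a line segment in the (time, location) plane: the path with number `k` leaves
its end of the corridor at time `k * Δ` and reaches the other end at time `k * Δ + δ`. -/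
def Inst.seg (I : Inst) : TrainPath I.m → Set (ℝ × ℝ)
  | Sum.inl i =>
      segment ℝ ((((i : ℕ) + 1) * I.Δ : ℝ), (0 : ℝ)) ((((i : ℕ) + 1) * I.Δ + I.δ : ℝ), (I.L : ℝ))
  | Sum.inr i =>
      segment ℝ ((((i : ℕ) + 1) * I.Δ : ℝ), (I.L : ℝ)) ((((i : ℕ) + 1) * I.Δ + I.δ : ℝ), (0 : ℝ))

/-- The region of the (time, location) plane that job `j` occupies if it starts at time `s`. -/
def Inst.box (I : Inst) (j : Fin I.n) (s : ℝ) : Set (ℝ × ℝ) :=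
  Set.Icc s (s + (I.job j).p) ×ˢ Set.Icc ((I.job j).ls : ℝ) ((I.job j).le : ℝ)

/-- The set of train paths that have to be cancelled if job `j` starts at time `s`. -/
def Inst.cancelled (I : Inst) (j : Fin I.n) (s : ℝ) : Set (TrainPath I.m) :=
  {l | (I.seg l ∩ I.box j s).Nonempty}

/-- The admissible start times of job `j`. -/
def Inst.startTimes (I : Inst) (j : Fin I.n) : Set ℝ :=
  Set.Icc ((I.job j).r : ℝ) ((I.job j).d - (I.job j).p : ℝ)

/-- The path sets that job `j` cancels for its various admissible start times. -/
def Inst.allPossessions (I : Inst) (j : Fin I.n) : Set (Set (TrainPath I.m)) :=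
  I.cancelled j '' I.startTimes j

/-- The possessions of job `j` after removal of the dominated ones, that is, of those that properly
contain another possession of `j`. -/
def Inst.possessions (I : Inst) (j : Fin I.n) : Set (Set (TrainPath I.m)) :=
  {R | Minimal (· ∈ I.allPossessions j) R}

/-- Each (undominated) possession contains exactly one path. -/
def Inst.SingletonPossessions (I : Inst) : Prop :=
  ∀ j, ∀ R ∈ I.possessions j, R.ncard = 1

/-- Each path intersects at most `K` other paths. -/
def Inst.IntersectionsBounded (I : Inst) (K : ℕ) : Prop :=
  ∀ l, {l' | l' ≠ l ∧ (I.seg l ∩ I.seg l').Nonempty}.ncard ≤ K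

/-- A vector of start times is feasible if each job runs between its release time and deadline. -/
def Inst.IsFeasible (I : Inst) (s : Fin I.n → ℝ) : Prop :=
  ∀ j, s j ∈ I.startTimes j

/-- The objective: the number of paths that have to be cancelled. -/
noncomputable def Inst.cost (I : Inst) (s : Fin I.n → ℝ) : ℕ :=
  (⋃ j, I.cancelled j (s j)).ncard

/-- An optimal vector of start times. -/
def Inst.IsOptimal (I : Inst) (s : Fin I.n → ℝ) : Prop :=
  I.IsFeasible s ∧ ∀ s', I.IsFeasible s' → I.cost s ≤ I.cost s'

/-! ### The machine model

Programs for a random access machine with integer variables and finitely many zero-initialised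
integer arrays. Each arithmetic operation, comparison, memory access, assignment and branch costs
one step. Words are bounded: a computation in which a value of absolute value larger than the word
bound `W` occurs gets stuck. -/

/-- Expressions: constants, variables, array entries `get a e` (entry with index `e` of the array
with name `a`), the four arithmetic operations, and comparisons with value `0` or `1`. -/
inductive Expr where
  | const (z : ℤ)
  | var (x : ℕ)
  | get (a : ℕ) (e : Expr)
  | add (e f : Expr)
  | sub (e f : Expr)
  | mul (e f : Expr)
  | div (e f : Expr)
  | lt (e f : Expr)
  | eq (e f : Expr)

/-- Programs. A condition is true if its value is nonzero. -/
inductive Cmd where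
  | skip
  | assign (x : ℕ) (e : Expr)
  | store (a : ℕ) (i e : Expr)
  | seq (c d : Cmd)
  | cond (b : Expr) (c d : Cmd)
  | loop (b : Expr) (c : Cmd)

/-- The contents of the variables and of the arrays. -/
structure State where
  vars : ℕ → ℤ
  arr : ℕ → ℤ → ℤ

/-- Assignment to a variable. -/
def State.setVar (σ : State) (x : ℕ) (v : ℤ) : State :=
  { σ with vars := Function.update σ.vars x v }

/-- Assignment to an array entry. -/
def State.setArr (σ : State) (a : ℕ) (i v : ℤ) : State :=
  { σ with arr := Function.update σ.arr a (Function.update (σ.arr a) i v) }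

/-- The value of an expression. Division is the integer division of `ℤ` (rounded down for a
positive divisor, and `0` for the divisor `0`). -/
def Expr.val (σ : State) : Expr → ℤ
  | .const z => z
  | .var x => σ.vars x
  | .get a e => σ.arr a (e.val σ)
  | .add e f => e.val σ + f.val σ
  | .sub e f => e.val σ - f.val σ
  | .mul e f => e.val σ * f.val σ
  | .div e f => e.val σ / f.val σ
  | .lt e f => if e.val σ < f.val σ then 1 else 0
  | .eq e f => if e.val σ = f.val σ then 1 else 0

/-- The number of steps for the evaluation of an expression. -/
def Expr.cost : Expr → ℕ
  | .const _ => 1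
  | .var _ => 1
  | .get _ e => e.cost + 1
  | .add e f => e.cost + f.cost + 1
  | .sub e f => e.cost + f.cost + 1
  | .mul e f => e.cost + f.cost + 1
  | .div e f => e.cost + f.cost + 1
  | .lt e f => e.cost + f.cost + 1
  | .eq e f => e.cost + f.cost + 1

/-- All values that occur in the evaluation of the expression have absolute value at most `W`. -/
def Expr.Fits (W : ℕ) (σ : State) : Expr → Prop
  | .const z => |z| ≤ W
  | .var x => |σ.vars x| ≤ W
  | .get a e => e.Fits W σ ∧ |σ.arr a (e.val σ)| ≤ W
  | .add e f => e.Fits W σ ∧ f.Fits W σ ∧ |e.val σ + f.val σ| ≤ W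
  | .sub e f => e.Fits W σ ∧ f.Fits W σ ∧ |e.val σ - f.val σ| ≤ W
  | .mul e f => e.Fits W σ ∧ f.Fits W σ ∧ |e.val σ * f.val σ| ≤ W
  | .div e f => e.Fits W σ ∧ f.Fits W σ ∧ |e.val σ / f.val σ| ≤ W
  | .lt e f => e.Fits W σ ∧ f.Fits W σ ∧ (1 : ℤ) ≤ W
  | .eq e f => e.Fits W σ ∧ f.Fits W σ ∧ (1 : ℤ) ≤ W

/-- `Exec W c σ t σ'`: with word bound `W`, the program `c` started in state `σ` halts after
exactly `t` steps in state `σ'`. -/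
inductive Exec (W : ℕ) : Cmd → State → ℕ → State → Prop where
  | skip (σ : State) : Exec W .skip σ 1 σ
  | assign (x : ℕ) (e : Expr) (σ : State) (he : e.Fits W σ) :
      Exec W (.assign x e) σ (e.cost + 1) (σ.setVar x (e.val σ))
  | store (a : ℕ) (i e : Expr) (σ : State) (hi : i.Fits W σ) (he : e.Fits W σ) :
      Exec W (.store a i e) σ (i.cost + e.cost + 1) (σ.setArr a (i.val σ) (e.val σ))
  | seq (c d : Cmd) (σ₁ σ₂ σ₃ : State) (t u : ℕ) (hc : Exec W c σ₁ t σ₂)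
      (hd : Exec W d σ₂ u σ₃) : Exec W (.seq c d) σ₁ (t + u) σ₃
  | condTrue (b : Expr) (c d : Cmd) (σ σ' : State) (t : ℕ) (hb : b.Fits W σ) (h : b.val σ ≠ 0)
      (hc : Exec W c σ t σ') : Exec W (.cond b c d) σ (b.cost + 1 + t) σ'
  | condFalse (b : Expr) (c d : Cmd) (σ σ' : State) (t : ℕ) (hb : b.Fits W σ) (h : b.val σ = 0)
      (hd : Exec W d σ t σ') : Exec W (.cond b c d) σ (b.cost + 1 + t) σ'
  | loopTrue (b : Expr) (c : Cmd) (σ₁ σ₂ σ₃ : State) (t u : ℕ) (hb : b.Fits W σ₁)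
      (h : b.val σ₁ ≠ 0) (hc : Exec W c σ₁ t σ₂) (hl : Exec W (.loop b c) σ₂ u σ₃) :
      Exec W (.loop b c) σ₁ (b.cost + 1 + t + u) σ₃
  | loopFalse (b : Expr) (c : Cmd) (σ : State) (hb : b.Fits W σ) (h : b.val σ = 0) :
      Exec W (.loop b c) σ (b.cost + 1) σ

/-! ### Input and output -/

/-- The ten integers that describe a job: numerators and denominators of its data. -/
def Job.data (J : Job) : ℕ → ℤ
  | 0 => J.r.num
  | 1 => J.r.den
  | 2 => J.d.num
  | 3 => J.d.den
  | 4 => J.p.num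
  | 5 => J.p.den
  | 6 => J.ls.num
  | 7 => J.ls.den
  | 8 => J.le.num
  | 9 => J.le.den
  | _ => 0

/-- The global data of an instance: `n`, `m`, and numerators and denominators of `L`, `Δ`, `δ`. -/
def Inst.globalData (I : Inst) : ℕ → ℤ
  | 0 => I.n
  | 1 => I.m
  | 2 => I.L.num
  | 3 => I.L.den
  | 4 => I.Δ.num
  | 5 => I.Δ.den
  | 6 => I.δ.num
  | 7 => I.δ.den
  | _ => 0

/-- The initial state: the variables `0, …, 7` hold the global data, the arrays `0, …, 9` hold the
data of the jobs (jobs are indexed by `0, …, n - 1`), and everything else is `0`. -/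
def Inst.input (I : Inst) : State where
  vars := I.globalData
  arr := fun a i => if h : 0 ≤ i ∧ i.toNat < I.n then (I.job ⟨i.toNat, h.2⟩).data a else 0

/-- All input numbers have absolute value at most `M`. -/
def Inst.InputBounded (I : Inst) (M : ℕ) : Prop :=
  (∀ x, |I.input.vars x| ≤ M) ∧ ∀ a i, |I.input.arr a i| ≤ M

/-- The final state `σ` contains an optimal vector of start times: for each job, arrays `10` and
`11` hold the numerator and the (positive) denominator of its start time. -/
def Inst.Solves (I : Inst) (σ : State) : Prop :=
  (∀ j : Fin I.n, 0 < σ.arr 11 (j : ℕ)) ∧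
    I.IsOptimal fun j => (σ.arr 10 (j : ℕ) : ℝ) / (σ.arr 11 (j : ℕ) : ℝ)

end Maintenance

namespace Maintenance

/-! ### Reasoning about programs -/

/-! Since every undominated possession is a single path, the task is a minimum hitting set problem.
Let `A_j` be the set of paths that job `j` can cancel alone. Only finitely many path sets occur, so
every set that `j` cancels contains a minimal one, which is a singleton. Hence each schedule cancels
a set that meets all `A_j`. Conversely, a set `H` that meets all `A_j` gives a schedule of cost at
most `|H|` (`Inst.isOptimal_of_hitting`).

The problem is tractable because of the shape of `A_j`. For a fixed job, the path with number `k` in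
one direction is cancelled exactly for start times in `kΔ + [a, a + w]`. The other direction has the
same `Δ` and `w` and an offset `b` with `|b - a| ≤ δ`. A path lies in `A_j` if some admissible time
is covered by its interval and by no other, and by hypothesis every admissible time is covered. Let
`κ = ⌊δ/Δ⌋`. If `w ≥ Δ`, consecutive intervals of one family leave no gap, and only the first and
last `κ + 1` numbers can occur in `A_j` (`Solo.near_ends`). If `w < Δ`, then `A_j` lies in a range
of consecutive numbers and contains, in both directions, all of this range except `O(κ)` numbers at
each end (`Covers.index_mem`, `exists_solo`). After multiplication by a common denominator, start
times may be taken to be integers, and membership in `A_j` has a constant-time test (`hit_iff`).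

The dependence on `m` disappears by compression. Only numbers within distance `h = min (κ + 2) m` of
`0`, of `m + 1` and of the window ends of the jobs are kept. Replacing any other number by the next
kept one preserves membership in all `A_j` at once (`Grid.hit_next`). As the first up-path meets the
first `min (κ + 1) m` down-paths, `h ≤ K + 1` (`Inst.IsValid.exists_radius`). This leaves `N =
O_K(n)` positions, two per kept number.

A dynamic program scans the positions and decides for each whether it is chosen. Once the last
position of `A_j` is passed, its state has to tell whether `A_j` has been hit. With `W = 4h + 4`, it
is enough to remember the choices among the first `W` and the last `W` positions, the last chosen
position `p` older than those, and the choices among the `W` positions before `p`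
(`Rep.exists_remembers`, `Grid.local`). So there are `S = 8 ^ W * N = O_K(n)` states on each of `N`
levels. Transitions cost `O(N S)`. Each job is checked on one level only, against all states, at a
total cost of `O_K(n S)`. Together this is `O_K(n ^ 2)`.

The remainder is program verification with `Tr`, a total correctness statement with a time bound.
Between control points all values stay below a fixed power `B` of `M + 2`, and inside a
straight-line block they stay below a fixed power of `B`. -/

@[simp] theorem State.setVar_vars (σ : State) (x y : ℕ) (v : ℤ) :
    (σ.setVar x v).vars y = if y = x then v else σ.vars y := by
  simp [State.setVar, Function.update_apply]

@[simp] theorem State.setVar_arr (σ : State) (x : ℕ) (v : ℤ) :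
    (σ.setVar x v).arr = σ.arr := rfl

@[simp] theorem State.setArr_vars (σ : State) (a : ℕ) (i v : ℤ) :
    (σ.setArr a i v).vars = σ.vars := rfl

@[simp] theorem State.setArr_arr (σ : State) (a b : ℕ) (i k v : ℤ) :
    (σ.setArr a i v).arr b k = if b = a ∧ k = i then v else σ.arr b k := by
  by_cases h : b = a
  · subst h
    simp [State.setArr, Function.update_apply]
  · simp [State.setArr, h]

/-- All values stored in the state are bounded by `B`. -/
def State.Bdd (B : ℕ) (σ : State) : Prop :=
  (∀ x, |σ.vars x| ≤ B) ∧ ∀ a i, |σ.arr a i| ≤ B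

theorem State.Bdd.mono {B B' : ℕ} {σ : State} (h : σ.Bdd B) (hB : B ≤ B') : σ.Bdd B' :=
  ⟨fun x => (h.1 x).trans (by exact_mod_cast hB), fun a i => (h.2 a i).trans (by exact_mod_cast hB)⟩

theorem State.Bdd.setVar {B : ℕ} {σ : State} (h : σ.Bdd B) {x : ℕ} {v : ℤ} (hv : |v| ≤ B) :
    (σ.setVar x v).Bdd B := by
  refine ⟨fun y => ?_, h.2⟩
  rw [State.setVar_vars]
  split_ifs
  · exact hv
  · exact h.1 y

theorem State.Bdd.setArr {B : ℕ} {σ : State} (h : σ.Bdd B) {a : ℕ} {i v : ℤ} (hv : |v| ≤ B) :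
    (σ.setArr a i v).Bdd B := by
  refine ⟨h.1, fun b k => ?_⟩
  rw [State.setArr_arr]
  split_ifs
  · exact hv
  · exact h.2 b k

/-! ### Growth of values and the word bound. -/

/-- An exponent that bounds the growth of values in the evaluation of an expression. -/
def Expr.wt : Expr → ℕ
  | .const z => z.natAbs + 1
  | .var _ => 1
  | .get _ e => e.wt + 1
  | .add e f => e.wt + f.wt + 1
  | .sub e f => e.wt + f.wt + 1
  | .mul e f => e.wt + f.wt + 1
  | .div e f => e.wt + f.wt + 1
  | .lt e f => e.wt + f.wt + 1
  | .eq e f => e.wt + f.wt + 1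

theorem Expr.wt_pos (e : Expr) : 1 ≤ e.wt := by cases e <;> simp [Expr.wt]

theorem pow_add_pow_le {B a b : ℕ} (hB : 2 ≤ B) : B ^ a + B ^ b ≤ B ^ (a + b + 1) := by
  have h1 : B ^ a ≤ B ^ (a + b) := Nat.pow_le_pow_right (by omega) (by omega)
  have h2 : B ^ b ≤ B ^ (a + b) := Nat.pow_le_pow_right (by omega) (by omega)
  rw [pow_succ]
  have := Nat.mul_le_mul_left (B ^ (a + b)) hB
  omega

/-- For `B ≥ 2` both `B ^ a + B ^ b` and `B ^ a * B ^ b` are at most `B ^ (a + b + 1)`, so weights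
add up with one extra unit per operation. An array entry is at most `B` whatever its index. -/
theorem Expr.abs_val_le {B : ℕ} {σ : State} (hB : 2 ≤ B) (h : σ.Bdd B) (e : Expr) :
    |e.val σ| ≤ (B ^ e.wt : ℕ) := by
  have one (k : ℕ) : 1 ≤ B ^ k := Nat.one_le_pow _ _ (by omega)
  have key (e f : Expr) (he : |e.val σ| ≤ (B ^ e.wt : ℕ)) (hf : |f.val σ| ≤ (B ^ f.wt : ℕ)) :
      |e.val σ| + |f.val σ| ≤ (B ^ (e.wt + f.wt + 1) : ℕ) := by
    have := pow_add_pow_le (a := e.wt) (b := f.wt) hB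
    zify at this hf he ⊢
    linarith
  induction e with
  | const z =>
    have h1 : z.natAbs < 2 ^ z.natAbs := Nat.lt_two_pow_self
    have h2 : 2 ^ z.natAbs ≤ B ^ z.natAbs := Nat.pow_le_pow_left hB _
    have h3 : B ^ z.natAbs ≤ B ^ (z.natAbs + 1) := Nat.pow_le_pow_right (by omega) (by omega)
    have h4 : z.natAbs ≤ B ^ (z.natAbs + 1) := by omega
    simp only [Expr.val, Expr.wt]
    rw [Int.abs_eq_natAbs]
    exact_mod_cast h4
  | var x => simpa [Expr.val, Expr.wt] using h.1 x
  | get a e _ =>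
    refine (h.2 _ _).trans ?_
    simp only [Expr.wt]
    exact_mod_cast Nat.le_self_pow (by omega) B
  | add e f he hf => exact (abs_add_le _ _).trans (key e f he hf)
  | sub e f he hf => exact (abs_sub _ _).trans (key e f he hf)
  | mul e f he hf =>
    simp only [Expr.val, Expr.wt, abs_mul]
    have h1 : |e.val σ| * |f.val σ| ≤ (B ^ e.wt : ℕ) * (B ^ f.wt : ℕ) :=
      mul_le_mul he hf (abs_nonneg _) (by positivity)
    refine h1.trans ?_
    rw [pow_succ, pow_add]
    push_cast
    have : (0:ℤ) ≤ (B:ℤ) ^ e.wt * (B:ℤ) ^ f.wt := by positivity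
    have : (2:ℤ) ≤ B := by exact_mod_cast hB
    nlinarith
  | div e f he hf =>
    have h1 : |e.val σ / f.val σ| ≤ |e.val σ| := Int.abs_ediv_le_abs _ _
    have h2 := key e f he hf
    have h3 := abs_nonneg (f.val σ)
    simp only [Expr.val, Expr.wt]
    linarith
  | lt e f _ _ =>
    simp only [Expr.val, Expr.wt]
    have := one (e.wt + f.wt + 1)
    split_ifs
    · simpa using by exact_mod_cast this
    · simp
  | eq e f _ _ =>
    simp only [Expr.val, Expr.wt]
    have := one (e.wt + f.wt + 1)
    split_ifs
    · simpa using by exact_mod_cast this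
    · simp

/-- All intermediate results are values of subexpressions, whose weights are smaller, so a bound for
the whole weight suffices. -/
theorem Expr.fits {B Wd : ℕ} {σ : State} (hB : 2 ≤ B) (h : σ.Bdd B) (e : Expr)
    (hW : B ^ e.wt ≤ Wd) : e.Fits Wd σ := by
  have sub {k l : ℕ} (hkl : k ≤ l) (hl : B ^ l ≤ Wd) : B ^ k ≤ Wd :=
    (Nat.pow_le_pow_right (by omega) hkl).trans hl
  have v := (Expr.abs_val_le hB h e).trans (Int.ofNat_le.2 hW)
  have one : (1 : ℤ) ≤ Wd := by
    have : 1 ≤ B ^ e.wt := Nat.one_le_pow _ _ (by omega)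
    exact_mod_cast this.trans hW
  induction e with
  | const z => exact v
  | var x => exact v
  | get a e ih =>
    have he : B ^ e.wt ≤ Wd := sub (by simp [Expr.wt]) hW
    exact ⟨ih he ((Expr.abs_val_le hB h e).trans (Int.ofNat_le.2 he)), v⟩
  | add e f ihe ihf | sub e f ihe ihf | mul e f ihe ihf | div e f ihe ihf =>
    have he : B ^ e.wt ≤ Wd := sub (by simp [Expr.wt]; omega) hW
    have hf : B ^ f.wt ≤ Wd := sub (by simp [Expr.wt]; omega) hW
    exact ⟨ihe he ((Expr.abs_val_le hB h e).trans (Int.ofNat_le.2 he)),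
      ihf hf ((Expr.abs_val_le hB h f).trans (Int.ofNat_le.2 hf)), v⟩
  | lt e f ihe ihf | eq e f ihe ihf =>
    have he : B ^ e.wt ≤ Wd := sub (by simp [Expr.wt]; omega) hW
    have hf : B ^ f.wt ≤ Wd := sub (by simp [Expr.wt]; omega) hW
    exact ⟨ihe he ((Expr.abs_val_le hB h e).trans (Int.ofNat_le.2 he)),
      ihf hf ((Expr.abs_val_le hB h f).trans (Int.ofNat_le.2 hf)), one⟩

/-! ### Frame property: what a program leaves unchanged. -/

/-- Variables that a program may write. -/
def Cmd.wv : Cmd → List ℕ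
  | .skip => []
  | .assign x _ => [x]
  | .store _ _ _ => []
  | .seq c d => c.wv ++ d.wv
  | .cond _ c d => c.wv ++ d.wv
  | .loop _ c => c.wv

/-- Arrays that a program may write. -/
def Cmd.wa : Cmd → List ℕ
  | .skip => []
  | .assign _ _ => []
  | .store a _ _ => [a]
  | .seq c d => c.wa ++ d.wa
  | .cond _ c d => c.wa ++ d.wa
  | .loop _ c => c.wa

/-- The states agree outside the variables and arrays that the program may write. -/
def Same (c : Cmd) (σ σ' : State) : Prop :=
  (∀ x, x ∉ c.wv → σ'.vars x = σ.vars x) ∧ ∀ a, a ∉ c.wa → σ'.arr a = σ.arr a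

theorem Same.refl (c : Cmd) (σ : State) : Same c σ σ := ⟨fun _ _ => rfl, fun _ _ => rfl⟩

theorem Same.trans {c : Cmd} {σ₁ σ₂ σ₃ : State} (h : Same c σ₁ σ₂) (h' : Same c σ₂ σ₃) :
    Same c σ₁ σ₃ :=
  ⟨fun x hx => (h'.1 x hx).trans (h.1 x hx), fun a ha => (h'.2 a ha).trans (h.2 a ha)⟩

theorem Same.mono {c d : Cmd} {σ σ' : State} (h : Same c σ σ') (hv : ∀ x ∈ c.wv, x ∈ d.wv)
    (ha : ∀ x ∈ c.wa, x ∈ d.wa) : Same d σ σ' :=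
  ⟨fun x hx => h.1 x fun hx' => hx (hv x hx'), fun a hx => h.2 a fun hx' => hx (ha a hx')⟩

/-- The frame rule. The lists of written variables and arrays are syntactic, so its side conditions
are later settled by `decide`. -/
theorem Exec.same {W : ℕ} {c : Cmd} {σ σ' : State} {t : ℕ} (h : Exec W c σ t σ') :
    Same c σ σ' := by
  induction h with
  | skip σ => exact Same.refl _ _
  | assign x e σ he =>
    refine ⟨fun y hy => ?_, fun _ _ => rfl⟩
    simp only [Cmd.wv, List.mem_singleton] at hy
    simp [hy]
  | store a i e σ hi he =>
    refine ⟨fun y hy => rfl, fun b hb => ?_⟩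
    simp only [Cmd.wa, List.mem_singleton] at hb
    funext k
    simp [hb]
  | seq c d σ₁ σ₂ σ₃ t u _ _ h1 h2 =>
    exact (h1.mono (by simp +contextual [Cmd.wv]) (by simp +contextual [Cmd.wa])).trans
      (h2.mono (by simp +contextual [Cmd.wv]) (by simp +contextual [Cmd.wa]))
  | condTrue b c d σ σ' t _ _ _ h1 =>
    exact h1.mono (by simp +contextual [Cmd.wv]) (by simp +contextual [Cmd.wa])
  | condFalse b c d σ σ' t _ _ _ h1 =>
    exact h1.mono (by simp +contextual [Cmd.wv]) (by simp +contextual [Cmd.wa])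
  | loopTrue b c σ₁ σ₂ σ₃ t u _ _ _ _ h1 h2 => exact Same.trans h1 h2
  | loopFalse b c σ _ _ => exact Same.refl _ _

/-! ### Total correctness with time bounds. -/

/-- The program halts within `T` steps in a state with property `Q`. -/
def Tr (W : ℕ) (c : Cmd) (σ : State) (T : ℕ) (Q : State → Prop) : Prop :=
  ∃ t σ', Exec W c σ t σ' ∧ t ≤ T ∧ Q σ'

theorem Tr.mono {W : ℕ} {c : Cmd} {σ : State} {T T' : ℕ} {Q Q' : State → Prop}
    (h : Tr W c σ T Q) (hT : T ≤ T') (hQ : ∀ σ', Same c σ σ' → Q σ' → Q' σ') : Tr W c σ T' Q' := by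
  obtain ⟨t, σ', he, ht, hq⟩ := h
  exact ⟨t, σ', he, ht.trans hT, hQ _ he.same hq⟩

theorem Tr.seq {W : ℕ} {c d : Cmd} {σ : State} {T U : ℕ} {Q R : State → Prop}
    (h : Tr W c σ T Q) (h' : ∀ σ', Same c σ σ' → Q σ' → Tr W d σ' U R) :
    Tr W (.seq c d) σ (T + U) R := by
  obtain ⟨t, σ', he, ht, hq⟩ := h
  obtain ⟨u, σ'', he', hu, hr⟩ := h' σ' he.same hq
  exact ⟨t + u, σ'', .seq _ _ _ _ _ _ _ he he', by omega, hr⟩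

/-- Programs without loops and branches. -/
def Cmd.straight : Cmd → Bool
  | .skip => true
  | .assign _ _ => true
  | .store _ _ _ => true
  | .seq c d => c.straight && d.straight
  | .cond _ _ _ => false
  | .loop _ _ => false

/-- The final state of a straight-line program. -/
def Cmd.run : Cmd → State → State
  | .assign x e, σ => σ.setVar x (e.val σ)
  | .store a i e, σ => σ.setArr a (i.val σ) (e.val σ)
  | .seq c d, σ => d.run (c.run σ)
  | _, σ => σ

/-- The running time of a straight-line program. -/
def Cmd.time : Cmd → ℕ
  | .assign _ e => e.cost + 1
  | .store _ i e => i.cost + e.cost + 1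
  | .seq c d => c.time + d.time
  | _ => 1

/-- An exponent that bounds the growth of values in a straight-line program. -/
def Cmd.growth : Cmd → ℕ
  | .assign _ e => e.wt
  | .store _ i e => i.wt + e.wt
  | .seq c d => c.growth * d.growth
  | _ => 1

theorem Cmd.growth_pos (c : Cmd) : 1 ≤ c.growth := by
  induction c with
  | assign x e => exact e.wt_pos
  | store a i e => simp only [Cmd.growth]; have := e.wt_pos; omega
  | seq c d hc hd => exact Nat.mul_pos hc hd
  | _ => simp [Cmd.growth]

/-- The bound `B ^ c.growth` after the first command is the base for the second one, so growth
multiplies under sequencing. The specifications below restore the bound `B` after each block, hence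
exponents do not accumulate over the rounds of a loop. -/
theorem Cmd.exec_run {W : ℕ} (c : Cmd) (hc : c.straight = true) :
    ∀ {B : ℕ} {σ : State}, 2 ≤ B → σ.Bdd B → B ^ c.growth ≤ W →
      Exec W c σ c.time (c.run σ) ∧ (c.run σ).Bdd (B ^ c.growth) := by
  induction c with
  | skip =>
    intro B σ hB h hW
    exact ⟨.skip σ, by simpa [Cmd.growth, Cmd.run] using h⟩
  | assign x e =>
    intro B σ hB h hW
    refine ⟨.assign x e σ (e.fits hB h hW), ?_⟩
    exact (h.mono (Nat.le_self_pow (by have := e.wt_pos; simp [Cmd.growth]; omega) B)).setVar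
      (e.abs_val_le hB h)
  | store a i e =>
    intro B σ hB h hW
    have h1 : B ^ e.wt ≤ B ^ (i.wt + e.wt) := Nat.pow_le_pow_right (by omega) (by omega)
    have h2 : B ^ i.wt ≤ B ^ (i.wt + e.wt) := Nat.pow_le_pow_right (by omega) (by omega)
    refine ⟨.store a i e σ (i.fits hB h (h2.trans hW)) (e.fits hB h (h1.trans hW)), ?_⟩
    exact (h.mono (Nat.le_self_pow (by have := e.wt_pos; simp [Cmd.growth]; omega) B)).setArr
      ((e.abs_val_le hB h).trans (Int.ofNat_le.2 h1))
  | seq c d ihc ihd =>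
    intro B σ hB h hW
    simp only [Cmd.straight, Bool.and_eq_true] at hc
    have gd := d.growth_pos
    have gc := c.growth_pos
    have e1 : B ^ c.growth ≤ B ^ (c.growth * d.growth) :=
      Nat.pow_le_pow_right (by omega) (Nat.le_mul_of_pos_right _ gd)
    obtain ⟨x1, b1⟩ := ihc hc.1 hB h (e1.trans hW)
    have hB' : 2 ≤ B ^ c.growth := hB.trans (Nat.le_self_pow (by omega) B)
    obtain ⟨x2, b2⟩ := ihd hc.2 hB' b1 (by rw [← pow_mul]; exact hW)
    exact ⟨.seq _ _ _ _ _ _ _ x1 x2, by rw [← pow_mul] at b2; exact b2⟩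
  | cond b c d => simp [Cmd.straight] at hc
  | loop b c => simp [Cmd.straight] at hc

theorem Tr.block {W B : ℕ} {c : Cmd} {σ : State} {Q : State → Prop} (hc : c.straight = true)
    (hB : 2 ≤ B) (h : σ.Bdd B) (hW : B ^ c.growth ≤ W) (hQ : Q (c.run σ)) :
    Tr W c σ c.time Q :=
  ⟨_, _, (c.exec_run hc hB h hW).1, le_rfl, hQ⟩

theorem Tr.cond {W B : ℕ} {b : Expr} {c d : Cmd} {σ : State} {T : ℕ} {Q : State → Prop}
    (hB : 2 ≤ B) (h : σ.Bdd B) (hW : B ^ b.wt ≤ W)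
    (hc : b.val σ ≠ 0 → Tr W c σ T Q) (hd : b.val σ = 0 → Tr W d σ T Q) :
    Tr W (.cond b c d) σ (b.cost + 1 + T) Q := by
  by_cases hb : b.val σ = 0
  · obtain ⟨t, σ', he, ht, hq⟩ := hd hb
    exact ⟨_, σ', .condFalse _ _ _ _ _ _ (b.fits hB h hW) hb he, by omega, hq⟩
  · obtain ⟨t, σ', he, ht, hq⟩ := hc hb
    exact ⟨_, σ', .condTrue _ _ _ _ _ _ (b.fits hB h hW) hb he, by omega, hq⟩

/-- A loop in which the variable `i` runs from `0` to `e - 1`. -/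
def Cmd.forTo (i : ℕ) (e : Expr) (c : Cmd) : Cmd :=
  .seq (.assign i (.const 0))
    (.loop (.lt (.var i) e) (.seq c (.assign i (.add (.var i) (.const 1)))))

/-- The time of a round may depend on its number; the amortised cost of `dpCmd` requires this. After
a round the invariant is demanded for the state in which the counter has already been incremented.
-/
theorem Tr.forTo_sum {Wd B n : ℕ} {T : ℕ → ℕ} {i : ℕ} {e : Expr} {c : Cmd} {σ₀ : State}
    (Inv : ℕ → State → Prop) (hB : 2 ≤ B) (hW : B ^ (e.wt + 4) ≤ Wd) (hnB : n ≤ B)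
    (hi : i ∉ c.wv) (hn : ∀ σ, Same (.forTo i e c) σ₀ σ → e.val σ = n)
    (h0B : σ₀.Bdd B) (h0 : Inv 0 (σ₀.setVar i 0))
    (hstep : ∀ k < n, ∀ σ, Same (.forTo i e c) σ₀ σ → σ.vars i = k → σ.Bdd B → Inv k σ →
      Tr Wd c σ (T k) (fun σ' => σ'.Bdd B ∧ Inv (k + 1) (σ'.setVar i ((k : ℤ) + 1)))) :
    Tr Wd (.forTo i e c) σ₀ (∑ k ∈ Finset.range n, (T k + e.cost + 10) + e.cost + 10)
      (fun σ' => σ'.Bdd B ∧ Inv n σ') := by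
  have pw (k : ℕ) (hk : k ≤ e.wt + 4) : B ^ k ≤ Wd :=
    (Nat.pow_le_pow_right (by omega) hk).trans hW
  have fitc (σ : State) (hσ : σ.Bdd B) : (Expr.lt (.var i) e).Fits Wd σ :=
    Expr.fits hB hσ _ (pw _ (by simp [Expr.wt]; omega))
  have same0 (σ : State) (v : ℤ) : Same (.forTo i e c) σ (σ.setVar i v) := by
    refine ⟨fun x hx => ?_, fun _ _ => rfl⟩
    simp only [Cmd.forTo, Cmd.wv, List.mem_append, List.mem_singleton, not_or] at hx
    simp [hx.1]
  -- Induction on the number `d` of remaining rounds, since `Exec.loopTrue` splits off the first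
  -- round.
  have main : ∀ d k : ℕ, k + d = n → ∀ σ, Same (.forTo i e c) σ₀ σ → σ.vars i = k → σ.Bdd B →
      Inv k σ → Tr Wd (.loop (.lt (.var i) e) (.seq c (.assign i (.add (.var i) (.const 1))))) σ
        (∑ l ∈ Finset.Ico k n, (T l + e.cost + 10) + e.cost + 3) (fun σ' => σ'.Bdd B ∧ Inv n σ') := by
    intro d
    induction d with
    | zero =>
      intro k hk σ hs hik hb hinv
      have hk' : k = n := by omega
      subst hk'
      refine ⟨_, σ, .loopFalse _ _ _ (fitc σ hb) ?_, ?_, hb, hinv⟩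
      · simp [Expr.val, hik, hn σ hs]
      · simp [Expr.cost]; omega
    | succ d ih =>
      intro k hk σ hs hik hb hinv
      obtain ⟨t, σ', hx, ht, hb', hinv'⟩ := hstep k (by omega) σ hs hik hb hinv
      have hik' : σ'.vars i = k := by rw [hx.same.1 i hi, hik]
      have hs' : Same (.forTo i e c) σ σ' := hx.same.mono
        (by simp +contextual [Cmd.forTo, Cmd.wv]) (by simp +contextual [Cmd.forTo, Cmd.wa])
      have hv : (Expr.add (.var i) (.const 1)).val σ' = (k : ℤ) + 1 := by simp [Expr.val, hik']
      have hkB : |((k : ℤ) + 1)| ≤ B := by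
        rw [abs_of_nonneg (by positivity)]
        exact_mod_cast (show k + 1 ≤ B by omega)
      have x2 : Exec Wd (.assign i (.add (.var i) (.const 1))) σ' 4 (σ'.setVar i ((k : ℤ) + 1)) := by
        have := Exec.assign (W := Wd) i (.add (.var i) (.const 1)) σ'
          (Expr.fits hB hb' _ (pw _ (by simp [Expr.wt])))
        rwa [hv] at this
      obtain ⟨u, σ'', hy, hu, hq⟩ := ih (k + 1) (by omega) (σ'.setVar i ((k : ℤ) + 1))
        ((hs.trans hs').trans (same0 _ _)) (by simp) (hb'.setVar hkB) hinv'
      refine ⟨_, σ'', .loopTrue _ _ _ _ _ _ _ (fitc σ hb) ?_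
        (.seq _ _ _ _ _ _ _ hx x2) hy, ?_, hq⟩
      · have : (k : ℤ) < n := by exact_mod_cast (show k < n by omega)
        simp [Expr.val, hik, hn σ hs, this]
      · simp only [Expr.cost]
        rw [Finset.sum_eq_sum_Ico_succ_bot (show k < n by omega)]
        omega
  obtain ⟨t, σ', hx, ht, hq⟩ := main n 0 (by omega) (σ₀.setVar i 0) (same0 _ _) (by simp)
    (h0B.setVar (by simp)) h0
  have x1 : Exec Wd (.assign i (.const 0)) σ₀ 2 (σ₀.setVar i 0) :=
    Exec.assign i (.const 0) σ₀ (Expr.fits hB h0B _ (pw _ (by simp [Expr.wt])))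
  rw [← Finset.range_eq_Ico] at ht
  exact ⟨_, σ', .seq _ _ _ _ _ _ _ x1 hx, by omega, hq⟩

theorem Tr.forTo {Wd B n T : ℕ} {i : ℕ} {e : Expr} {c : Cmd} {σ₀ : State}
    (Inv : ℕ → State → Prop) (hB : 2 ≤ B) (hW : B ^ (e.wt + 4) ≤ Wd) (hnB : n ≤ B)
    (hi : i ∉ c.wv) (hn : ∀ σ, Same (.forTo i e c) σ₀ σ → e.val σ = n)
    (h0B : σ₀.Bdd B) (h0 : Inv 0 (σ₀.setVar i 0))
    (hstep : ∀ k < n, ∀ σ, Same (.forTo i e c) σ₀ σ → σ.vars i = k → σ.Bdd B → Inv k σ →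
      Tr Wd c σ T (fun σ' => σ'.Bdd B ∧ Inv (k + 1) (σ'.setVar i ((k : ℤ) + 1)))) :
    Tr Wd (.forTo i e c) σ₀ (n * (T + e.cost + 10) + e.cost + 10)
      (fun σ' => σ'.Bdd B ∧ Inv n σ') :=
  (Tr.forTo_sum (T := fun _ => T) Inv hB hW hnB hi hn h0B h0 hstep).mono (by simp) fun _ _ h => h

/-! ### Tests and conditional expressions. -/

/-- Boolean combinations of comparisons. -/
inductive Test where
  | lt (e f : Expr)
  | eq (e f : Expr)
  | and (s t : Test)
  | not (s : Test)

/-- The truth value of a test. -/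
def Test.holds (σ : State) : Test → Prop
  | .lt e f => e.val σ < f.val σ
  | .eq e f => e.val σ = f.val σ
  | .and s t => s.holds σ ∧ t.holds σ
  | .not s => ¬ s.holds σ

/-- A test as an expression with value `0` or `1`. -/
def Test.expr : Test → Expr
  | .lt e f => .lt e f
  | .eq e f => .eq e f
  | .and s t => .mul s.expr t.expr
  | .not s => .sub (.const 1) s.expr

open Classical in
theorem Test.val_expr (σ : State) (s : Test) : s.expr.val σ = if s.holds σ then 1 else 0 := by
  induction s with
  | lt e f => simp only [Test.expr, Test.holds, Expr.val]; congr
  | eq e f => simp only [Test.expr, Test.holds, Expr.val]; congr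
  | and s t hs ht =>
    simp only [Test.expr, Test.holds, Expr.val, hs, ht]
    split_ifs <;> simp_all
  | not s hs =>
    simp only [Test.expr, Test.holds, Expr.val, hs]
    split_ifs <;> simp_all

/-- Conditional expressions. -/
def Expr.ite (s : Test) (e f : Expr) : Expr :=
  .add (.mul s.expr e) (.mul (.sub (.const 1) s.expr) f)

open Classical in
theorem Expr.val_ite (σ : State) (s : Test) (e f : Expr) :
    (Expr.ite s e f).val σ = if s.holds σ then e.val σ else f.val σ := by
  simp only [Expr.ite, Expr.val, Test.val_expr]
  split_ifs <;> simp

/-- The remainder of the division. -/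
def Expr.mod (e f : Expr) : Expr := .sub e (.mul f (.div e f))

theorem Expr.val_mod (σ : State) (e f : Expr) : (Expr.mod e f).val σ = e.val σ % f.val σ := by
  simp [Expr.mod, Expr.val, Int.emod_def]

/-! ### Periodic intervals on the integer line -/

/-- Point `s` is covered by the `k`-th of the `m` intervals of length `w` whose start points
`k * D + a` are `D` apart. -/
def Covers (m D w a k s : ℤ) : Prop := 1 ≤ k ∧ k ≤ m ∧ k * D + a ≤ s ∧ s ≤ k * D + a + w

/-- Point `s` is covered by the `i`-th interval of the family with offset `a` and by no other
interval of the families with offsets `a` and `b`. -/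
def Solo (m D w a b i s : ℤ) : Prop :=
  Covers m D w a i s ∧ (∀ k, Covers m D w a k s → k = i) ∧ ∀ k, ¬ Covers m D w b k s

/-- The first point of the `i`-th interval, not before `r`, that is to the right of the preceding
interval of the same family. -/
def entry (D w a r i : ℤ) : ℤ :=
  max (max r (i * D + a)) (if 1 < i then (i - 1) * D + a + w + 1 else r)

/-- The last interval of a family that starts at or before `s`. -/
def lastStart (m D b s : ℤ) : ℤ := min m ((s - b) / D)

/-- The first point at or after `s` that the family with offset `b` does not cover. -/
def escape (m D w b s : ℤ) : ℤ :=
  if 1 ≤ lastStart m D b s ∧ s ≤ lastStart m D b s * D + b + w then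
    (if w < D then lastStart m D b s else m) * D + b + w + 1
  else s

/-- The candidate for a point at which the `i`-th interval is alone. -/
def wit (m D w a b r i : ℤ) : ℤ := escape m D w b (entry D w a r i)

/-- The test whether there is such a point up to `e`. -/
def Hit (m D w a b r e i : ℤ) : Prop :=
  1 ≤ i ∧ i ≤ m ∧ wit m D w a b r i ≤ e ∧ wit m D w a b r i ≤ i * D + a + w ∧
    (i = m ∨ wit m D w a b r i < (i + 1) * D + a)

theorem mul_mono {k l D : ℤ} (hD : 0 < D) (h : k ≤ l) : k * D ≤ l * D :=
  mul_le_mul_of_nonneg_right h hD.le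

section
variable {m D w a b r e i s : ℤ}

theorem le_escape (hD : 0 < D) : s ≤ escape m D w b s := by
  unfold escape
  split_ifs with h1 h2
  · omega
  · have := mul_mono hD (show lastStart m D b s ≤ m from min_le_left _ _)
    omega
  · exact le_rfl

theorem lastStart_mul_le (hD : 0 < D) : lastStart m D b s * D + b ≤ s := by
  have h1 := mul_mono hD (show lastStart m D b s ≤ (s - b) / D from min_le_right _ _)
  have h2 := Int.ediv_mul_le (s - b) hD.ne'
  omega

theorem le_lastStart (hD : 0 < D) {k : ℤ} (hk : k ≤ m) (h : k * D + b ≤ s) :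
    k ≤ lastStart m D b s :=
  le_min hk ((Int.le_ediv_iff_mul_le hD).2 (by omega))

/-- Ends increase with the number, so if `s` is covered at all, the interval that started last
covers it. For `w < D`, the point after its end precedes the next start because of `hgap`. For `D ≤
w`, the point behind interval `m` is behind all intervals. -/
theorem not_covers_escape (hD : 0 < D) (hgap : w < D → w + 2 ≤ D) (k : ℤ) :
    ¬ Covers m D w b k (escape m D w b s) := by
  rintro ⟨h1, hm, h2, h3⟩
  unfold escape at h2 h3
  split_ifs at h2 h3 with c1 c2
  · rcases le_or_gt k (lastStart m D b s) with hk | hk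
    · have := mul_mono hD hk
      omega
    · have := mul_mono hD hk
      rw [add_mul] at this
      have := hgap c2
      omega
  · have := mul_mono hD hm
    omega
  · have hk := le_lastStart (s := s) hD hm h2
    have := mul_mono hD hk
    exact c1 ⟨h1.trans hk, by omega⟩

theorem escape_le (hD : 0 < D) {t : ℤ} (hst : s ≤ t) (ht : ∀ k, ¬ Covers m D w b k t) :
    escape m D w b s ≤ t := by
  unfold escape
  split_ifs with c1 c2
  · by_contra! hlt
    refine ht (lastStart m D b s) ⟨c1.1, min_le_left _ _, ?_, by omega⟩
    have := lastStart_mul_le (m := m) (b := b) (s := s) hD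
    omega
  · have hm : lastStart m D b s ≤ m := min_le_left _ _
    -- As `D ≤ w`, each interval starts before its predecessor ends or at that end. So an uncovered
    -- `t` has to pass them one by one, up to number `m`.
    have : ∀ d : ℕ, lastStart m D b s + d ≤ m → (lastStart m D b s + d) * D + b + w < t := by
      intro d
      induction d with
      | zero =>
        intro _
        by_contra! hlt
        refine ht (lastStart m D b s) ⟨c1.1, hm, ?_, by simpa using hlt⟩
        have := lastStart_mul_le (m := m) (b := b) (s := s) hD
        omega
      | succ d ih =>
        intro hd
        push_cast at hd ⊢
        have h1 := ih (by omega)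
        by_contra! hlt
        refine ht (lastStart m D b s + (d + 1)) ⟨by omega, hd, ?_, hlt⟩
        have : (lastStart m D b s + (d + 1)) * D = (lastStart m D b s + d) * D + D := by ring
        omega
    have := this (m - lastStart m D b s).toNat (by omega)
    rw [Int.toNat_of_nonneg (by omega), add_sub_cancel] at this
    omega
  · exact hst

theorem Hit.solo (hD : 0 < D) (hgap : w < D → w + 2 ≤ D) (h : Hit m D w a b r e i) :
    r ≤ wit m D w a b r i ∧ wit m D w a b r i ≤ e ∧ Solo m D w a b i (wit m D w a b r i) := by
  obtain ⟨h1, hm, he, hw, hn⟩ := h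
  have hle : entry D w a r i ≤ wit m D w a b r i := le_escape hD
  have e1 : r ≤ entry D w a r i := (le_max_left _ _).trans (le_max_left _ _)
  have e2 : i * D + a ≤ entry D w a r i := (le_max_right _ _).trans (le_max_left _ _)
  refine ⟨e1.trans hle, he, ⟨h1, hm, e2.trans hle, hw⟩, fun k hk => ?_,
    fun k => not_covers_escape hD hgap k⟩
  obtain ⟨k1, k2, k3, k4⟩ := hk
  rcases lt_trichotomy k i with hki | hki | hki
  · have e3 : (i - 1) * D + a + w + 1 ≤ entry D w a r i := by
      unfold entry
      rw [if_pos (by omega)]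
      exact le_max_right _ _
    have := mul_mono hD (show k ≤ i - 1 by omega)
    omega
  · exact hki
  · have := mul_mono hD (show i + 1 ≤ k by omega)
    omega

/-- The witness is the earliest candidate: it must be past the preceding interval of its own family
and then outside the other family. So it is at most `s`, and the bounds on the witness in `Hit` pass
from `s` down to it. -/
theorem Solo.hit (hD : 0 < D) (hs : Solo m D w a b i s) (hr : r ≤ s) (he : s ≤ e) :
    Hit m D w a b r e i := by
  obtain ⟨⟨h1, hm, h2, h3⟩, hu, hd⟩ := hs
  have hent : entry D w a r i ≤ s := by
    unfold entry
    refine max_le (max_le hr h2) ?_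
    split_ifs with c
    · by_contra! hlt
      have := hu (i - 1) ⟨by omega, by omega, by rw [sub_mul]; omega, by omega⟩
      omega
    · exact hr
  have hw : wit m D w a b r i ≤ s := escape_le hD hent hd
  refine ⟨h1, hm, hw.trans he, hw.trans h3, ?_⟩
  by_contra! hn
  have := hu (i + 1) ⟨by omega, by omega, by omega, by rw [add_mul]; omega⟩
  omega

/-- This replaces a search over all start times by the constant-size test that `hitT` evaluates. -/
theorem hit_iff (hD : 0 < D) (hgap : w < D → w + 2 ≤ D) :
    Hit m D w a b r e i ↔ ∃ s, r ≤ s ∧ s ≤ e ∧ Solo m D w a b i s :=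
  ⟨fun h => ⟨_, h.solo hD hgap⟩, fun ⟨_, h1, h2, h3⟩ => h3.hit hD h1 h2⟩

/-- If the intervals are long, then only intervals near the ends are alone somewhere. -/
theorem Solo.near_ends {κ : ℤ} (hD : 0 < D) (hw : D ≤ w) (hab : |a - b| < (κ + 1) * D)
    (hs : Solo m D w a b i s) : i ≤ κ + 1 ∨ m - κ ≤ i := by
  obtain ⟨⟨h1, hm, h2, h3⟩, -, hd⟩ := hs
  rw [abs_lt] at hab
  by_contra! hc
  have l1 := mul_mono hD (show κ + 2 ≤ i by omega)
  have l2 := mul_mono hD (show i ≤ m - κ - 1 by omega)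
  simp only [add_mul, sub_mul, one_mul] at l1 l2 hab
  -- The interval of the other family that started last still covers `s`. If its number is `m`, this
  -- follows from `i ≤ m - κ - 1`; otherwise the next one starts after `s` and at most `w` after it.
  have k1 : 1 ≤ lastStart m D b s := le_lastStart hD (by omega) (by omega)
  refine hd (lastStart m D b s) ⟨k1, min_le_left _ _, lastStart_mul_le hD, ?_⟩
  rcases min_choice m ((s - b) / D) with hmin | hmin
  · rw [lastStart, hmin]; omega
  · rw [lastStart, hmin]
    have := Int.lt_ediv_add_one_mul_self (s - b) hD
    rw [add_mul] at this
    omega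

/-- Short intervals that meet the window have numbers near the range given by the window. -/
theorem Covers.index_mem {κ c : ℤ} (hD : 0 < D) (hw : w < D) (hac : |a - c| < (κ + 1) * D)
    (hs : Covers m D w a i s) (hr : r ≤ s) (he : s ≤ e) :
    (r - c) / D - (κ + 2) ≤ i ∧ i ≤ (e - c) / D + (κ + 2) := by
  obtain ⟨h1, hm, h2, h3⟩ := hs
  rw [abs_lt] at hac
  have q1 := Int.ediv_mul_le (r - c) hD.ne'
  have q2 := Int.lt_ediv_add_one_mul_self (e - c) hD
  constructor
  · by_contra! hc
    have := mul_mono hD (show i + (κ + 3) ≤ (r - c) / D by omega)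
    simp only [add_mul, one_mul] at *
    omega
  · by_contra! hc
    have := mul_mono hD (show (e - c) / D + (κ + 3) ≤ i by omega)
    simp only [add_mul, one_mul] at *
    omega

/-- If the intervals are short and every point of the window is covered, then all intervals in the
middle of the window are alone somewhere. -/
theorem exists_solo {κ c : ℤ} (hD : 0 < D) (hw0 : 0 ≤ w) (hw : w + 2 ≤ D)
    (hac : |a - c| < (κ + 1) * D)
    (hcov : ∀ s, r ≤ s → s ≤ e → ∃ k, Covers m D w a k s ∨ Covers m D w b k s)
    (h1 : 1 ≤ i) (hm : i ≤ m) (hr : (r - c) / D + (κ + 2) ≤ i) (he : i ≤ (e - c) / D - (κ + 2)) :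
    ∃ s, r ≤ s ∧ s ≤ e ∧ Solo m D w a b i s := by
  rw [abs_lt] at hac
  have q1 := Int.ediv_mul_le (e - c) hD.ne'
  have q2 := Int.lt_ediv_add_one_mul_self (r - c) hD
  have q3 := mul_mono hD hr
  have q4 := mul_mono hD (show i + (κ + 2) ≤ (e - c) / D by omega)
  simp only [add_mul, one_mul] at hac q1 q2 q3 q4
  -- The point just behind interval `i` is included; the last case below needs it.
  have huniq : ∀ s, i * D + a ≤ s → s ≤ i * D + a + w + 1 → ∀ k, Covers m D w a k s → k = i := by
    rintro s hs1 hs2 k ⟨k1, k2, k3, k4⟩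
    rcases lt_trichotomy k i with hki | hki | hki
    · have := mul_mono hD (show k + 1 ≤ i by omega)
      rw [add_mul] at this
      omega
    · exact hki
    · have := mul_mono hD (show i + 1 ≤ k by omega)
      rw [add_mul] at this
      omega
  -- If interval `i` is nowhere alone, the other family covers all of it. Let `k` cover its left
  -- end. The point after interval `k` is free of the other family, so it is not in interval `i`. As
  -- the lengths agree, it is then the point just behind interval `i`, which neither family covers,
  -- against `hcov`.
  by_contra hno
  have hall : ∀ s, i * D + a ≤ s → s ≤ i * D + a + w → ∃ k, Covers m D w b k s := by
    intro s hs1 hs2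
    by_contra! hc
    exact hno ⟨s, by omega, by omega, ⟨h1, hm, hs1, hs2⟩, huniq s hs1 (by omega), hc⟩
  obtain ⟨k, k1, k2, k3, k4⟩ := hall (i * D + a) le_rfl (by omega)
  have hnb : ∀ l, ¬ Covers m D w b l (k * D + b + w + 1) := by
    rintro l ⟨l1, l2, l3, l4⟩
    rcases le_or_gt l k with hlk | hlk
    · have := mul_mono hD hlk
      omega
    · have := mul_mono hD (show k + 1 ≤ l by omega)
      rw [add_mul] at this
      omega
  rcases le_or_gt (k * D + b + w + 1) (i * D + a + w) with hle | hgt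
  · obtain ⟨l, hl⟩ := hall _ (by omega) hle
    exact hnb l hl
  · obtain ⟨l, hl | hl⟩ := hcov (k * D + b + w + 1) (by omega) (by omega)
    · have := huniq _ (by omega) (by omega) l hl
      subst this
      have := hl.2.2.2
      omega
    · exact hnb l hl

end

/-! ### Signatures of partial solutions -/

/-- A summary of a set of positions: bit masks `m0` of the first `W` positions, `m1` of the last `W`
positions (last one first) and `m2` of the `W` positions before `p`, where `p` is the last
element that is older than the last `W` positions (`0` if there is none). -/
@[ext] structure Sig where
  m0 : ℕ
  m1 : ℕ
  m2 : ℕ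
  p : ℕ

/-- The signature after position `t` has been added (`β = 1`) or skipped (`β = 0`). -/
def Sig.next (W t : ℕ) (s : Sig) (β : ℕ) : Sig where
  m0 := if t < W then s.m0 + β * 2 ^ t else s.m0
  m1 := (2 * s.m1 + β) % 2 ^ W
  m2 := if 2 ^ W ≤ 2 * s.m1 then
      (if s.p < t - W ∧ t - W - 1 - s.p < W then
        (2 * s.m2 + 1) * 2 ^ (t - W - 1 - s.p) % 2 ^ W else 0)
    else s.m2
  p := if 2 ^ W ≤ 2 * s.m1 then t - W else s.p

/-- The signature of the elements of `H` below `t`. -/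
def sigOf (W : ℕ) (H : Finset ℕ) : ℕ → Sig
  | 0 => ⟨0, 0, 0, 0⟩
  | t + 1 => (sigOf W H t).next W t (if t ∈ H then 1 else 0)

/-- The signature `s` describes the elements of `H` below `t`. -/
structure Rep (W t : ℕ) (H : Finset ℕ) (s : Sig) : Prop where
  lt0 : s.m0 < 2 ^ W
  lt0' : s.m0 < 2 ^ t
  lt1 : s.m1 < 2 ^ W
  lt2 : s.m2 < 2 ^ W
  le_p : s.p ≤ t - W
  mem_p : s.p = 0 ∨ s.p ∈ H ∧ s.p + W < t
  bit0 : ∀ k < W, s.m0.testBit k = true ↔ k < t ∧ k ∈ H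
  bit1 : ∀ k < W, s.m1.testBit k = true ↔ k < t ∧ t - 1 - k ∈ H
  far : ∀ x ∈ H, x + W < t → x ≤ s.p
  bit2 : ∀ k, s.m2.testBit k = true → k < s.p ∧ (s.p - 1 - k ∈ H ∨ s.p - 1 - k = 0)
  near : ∀ x ∈ H, x < s.p → s.p - 1 - x < W → s.m2.testBit (s.p - 1 - x) = true

theorem testBit_two_mul_add_one (m β k : ℕ) (hβ : β < 2) :
    (2 * m + β).testBit (k + 1) = m.testBit k := by
  rw [Nat.testBit_add_one]
  congr 1
  omega

theorem Rep.zero (W : ℕ) (H : Finset ℕ) : Rep W 0 H ⟨0, 0, 0, 0⟩ := by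
  constructor <;> simp

/-- Appending a position pushes the top bit of `m1`, position `t - W`, out of the recent window. If
that position was chosen, it becomes the new `p`. Then the old `p` is written in front of the old
`m2` as a low bit `1`, and the result is shifted by the distance to the new `p`. -/
theorem Rep.next {W t : ℕ} (hW : 1 ≤ W) {H : Finset ℕ} {s : Sig} (h : Rep W t H s) :
    Rep W (t + 1) H (s.next W t (if t ∈ H then 1 else 0)) := by
  set β := if t ∈ H then 1 else 0 with hβ
  have hβ2 : β < 2 := by rw [hβ]; split_ifs <;> omega
  have hβ1 : β = 1 ↔ t ∈ H := by rw [hβ]; split_ifs with hc <;> simp [hc]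
  have pos : 0 < 2 ^ W := by positivity
  obtain ⟨V, rfl⟩ : ∃ V, W = V + 1 := ⟨W - 1, by omega⟩
  -- The inequality tests the top bit of `m1`.
  have top : 2 ^ (V + 1) ≤ 2 * s.m1 ↔ V < t ∧ t - 1 - V ∈ H := by
    rw [← h.bit1 V (by omega)]
    have := h.lt1
    constructor
    · intro hc
      exact Nat.testBit_of_two_pow_le_and_two_pow_add_one_gt (by rw [pow_succ] at hc; omega) this
    · intro hb
      by_contra! hc
      rw [Nat.testBit_lt_two_pow (by rw [pow_succ] at hc; omega)] at hb
      simp at hb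
  have lt0 : ∀ U, t < U → s.m0 + β * 2 ^ t < 2 ^ U := by
    intro U hU
    have h1 : 2 ^ (t + 1) ≤ 2 ^ U := Nat.pow_le_pow_right (by omega) hU
    have h2 : β * 2 ^ t ≤ 1 * 2 ^ t := Nat.mul_le_mul_right _ (by omega)
    have := h.lt0'
    rw [pow_succ] at h1
    omega
  refine ⟨?_, ?_, Nat.mod_lt _ pos, ?_, ?_, ?_, ?_, ?_, ?_, ?_, ?_⟩
  · simp only [Sig.next]
    split_ifs with hc
    · exact lt0 _ hc
    · exact h.lt0
  · simp only [Sig.next]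
    split_ifs with hc
    · exact lt0 _ (by omega)
    · exact h.lt0'.trans_le (Nat.pow_le_pow_right (by omega) (by omega))
  · simp only [Sig.next]
    split_ifs
    · exact Nat.mod_lt _ pos
    · exact pos
    · exact h.lt2
  · simp only [Sig.next]
    have := h.le_p
    split_ifs <;> omega
  · simp only [Sig.next]
    split_ifs with hc
    · obtain ⟨c1, c2⟩ := top.1 hc
      right
      exact ⟨by rwa [show t - (V + 1) = t - 1 - V by omega], by omega⟩
    · rcases h.mem_p with hp | hp
      · exact Or.inl hp
      · exact Or.inr ⟨hp.1, by omega⟩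
  · intro k hk
    simp only [Sig.next]
    split_ifs with hc
    · have e : s.m0 + β * 2 ^ t = 2 ^ t * β + s.m0 := by ring
      rw [e, Nat.testBit_two_pow_mul_add _ h.lt0']
      split_ifs with hkt
      · rw [h.bit0 k hk]
        constructor
        · exact fun hh => ⟨by omega, hh.2⟩
        · exact fun hh => ⟨hkt, hh.2⟩
      · rcases Nat.lt_or_ge t k with h1 | h1
        · rw [Nat.testBit_lt_two_pow (x := β)]
          · simp; omega
          · exact hβ2.trans_le (Nat.le_self_pow (by omega) 2)
        · have : k = t := by omega
          subst this
          rw [Nat.sub_self, Nat.testBit_zero, ← hβ1]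
          simp; omega
    · rw [h.bit0 k hk]
      constructor
      · exact fun hh => ⟨by omega, hh.2⟩
      · exact fun hh => ⟨by omega, hh.2⟩
  · intro k hk
    simp only [Sig.next]
    rw [Nat.testBit_mod_two_pow]
    simp only [hk, decide_true, Bool.true_and]
    cases k with
    | zero =>
      rw [Nat.testBit_zero]
      simp [← hβ1]; omega
    | succ k =>
      rw [testBit_two_mul_add_one _ _ _ hβ2, h.bit1 k (by omega)]
      rw [show t + 1 - 1 - (k + 1) = t - 1 - k by omega]
      constructor <;> exact fun hh => ⟨by omega, hh.2⟩
  · intro x hx hxt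
    simp only [Sig.next]
    split_ifs with hc
    · omega
    · refine h.far x hx ?_
      by_contra! hlt
      refine hc (top.2 ⟨by omega, ?_⟩)
      rwa [show t - 1 - V = x by omega]
  · intro k
    simp only [Sig.next]
    split_ifs with hc hg
    · rw [Nat.testBit_mod_two_pow, Nat.testBit_mul_two_pow]
      simp only [Bool.and_eq_true, decide_eq_true_eq]
      rintro ⟨hkW, hgk, hb⟩
      obtain ⟨j, hj⟩ : ∃ j, k = t - (V + 1) - 1 - s.p + j := ⟨k - (t - (V + 1) - 1 - s.p), by omega⟩
      rw [hj, Nat.add_sub_cancel_left] at hb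
      cases j with
      | zero =>
        refine ⟨by omega, ?_⟩
        rw [show t - (V + 1) - 1 - k = s.p by omega]
        rcases h.mem_p with hp | hp
        · exact Or.inr hp
        · exact Or.inl hp.1
      | succ j =>
        rw [testBit_two_mul_add_one _ _ _ (by omega)] at hb
        have := h.bit2 j hb
        refine ⟨by omega, ?_⟩
        rw [show t - (V + 1) - 1 - k = s.p - 1 - j by omega]
        exact this.2
    · simp
    · exact h.bit2 k
  · intro x hx
    simp only [Sig.next]
    split_ifs with hc hg
    · intro hxp hxW
      obtain ⟨c1, c2⟩ := top.1 hc
      have hxs := h.far x hx (by omega)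
      rw [Nat.testBit_mod_two_pow, Nat.testBit_mul_two_pow]
      simp only [Bool.and_eq_true, decide_eq_true_eq]
      refine ⟨hxW, by omega, ?_⟩
      rcases Nat.lt_or_ge x s.p with hlt | hge
      · have e : t - (V + 1) - 1 - x - (t - (V + 1) - 1 - s.p) = (s.p - 1 - x) + 1 := by omega
        rw [e, testBit_two_mul_add_one _ _ _ (by omega)]
        exact h.near x hx hlt (by omega)
      · have e : t - (V + 1) - 1 - x - (t - (V + 1) - 1 - s.p) = 0 := by omega
        rw [e, Nat.testBit_zero]
        simp
    · intro hxp hxW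
      have hxs := h.far x hx (by omega)
      have hp := h.le_p
      rcases h.mem_p with hm | hm <;> omega
    · exact h.near x hx

theorem rep_sigOf {W : ℕ} (hW : 1 ≤ W) (H : Finset ℕ) (t : ℕ) : Rep W t H (sigOf W H t) := by
  induction t with
  | zero => exact Rep.zero W H
  | succ t ih => exact ih.next hW

theorem sigOf_congr {W : ℕ} {H H' : Finset ℕ} {t : ℕ} (h : ∀ x < t, x ∈ H ↔ x ∈ H') :
    sigOf W H t = sigOf W H' t := by
  induction t with
  | zero => rfl
  | succ t ih =>
    simp only [sigOf]
    rw [ih fun x hx => h x (by omega)]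
    simp only [h t (by omega)]

/-- The positions that can be read off from a signature. -/
def Sig.Remembers (W t : ℕ) (s : Sig) (x : ℕ) : Prop :=
  x = s.p ∨ ∃ k < W, s.m0.testBit k = true ∧ x = k ∨
    s.m1.testBit k = true ∧ k < t ∧ x = t - 1 - k ∨ s.m2.testBit k = true ∧ k < s.p ∧ x = s.p - 1 - k

/-- The only false memory is position `0`: it is the default value of `p`, and `m2` may record it as
chosen when `p` moves on. This is harmless, since no job can use position `0` (`Rows.zero`). -/
theorem Rep.mem_of_remembers {W t : ℕ} {H : Finset ℕ} {s : Sig} (h : Rep W t H s) {x : ℕ}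
    (hx : s.Remembers W t x) : x = 0 ∨ x ∈ H ∧ x < t := by
  rcases hx with rfl | ⟨k, hk, hx | hx | hx⟩
  · rcases h.mem_p with hp | hp
    · exact Or.inl hp
    · exact Or.inr ⟨hp.1, by omega⟩
  · obtain ⟨hb, rfl⟩ := hx
    have := (h.bit0 x hk).1 hb
    exact Or.inr ⟨this.2, this.1⟩
  · obtain ⟨hb, hkt, rfl⟩ := hx
    exact Or.inr ⟨((h.bit1 k hk).1 hb).2, by omega⟩
  · obtain ⟨hb, hkp, rfl⟩ := hx
    have hp := h.le_p
    rcases (h.bit2 k hb).2 with hh | hh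
    · exact Or.inr ⟨hh, by omega⟩
    · exact Or.inl hh

/-- A set of positions below `τ` that is, with respect to the window length `W`, simple enough for
signatures to decide whether it meets a given set. -/
def Local (W τ : ℕ) (A : ℕ → Prop) : Prop :=
  (∀ x, A x → x < W ∨ τ ≤ x + W) ∨
    ∃ q, (∀ x, A x → q ≤ x + W) ∧ ∀ x, q ≤ x → x + W < τ → A x

/-- Why signatures suffice. Suppose `x` is older than the last `W` positions, so `x ≤ p`, and `A`
contains `[q, t - W)` and lies above `q - W`. If `p ≥ q`, then `p` itself is in `A`, unless `p` is
the default `0`, where `x = p`. If `p < q`, then `x` is so close to `p` that it is `p` or recorded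
in `m2`. The element found may differ from `x`. -/
theorem Rep.exists_remembers {W t : ℕ} {H : Finset ℕ} {s : Sig} (h : Rep W t H s)
    {A : ℕ → Prop} (hA : Local W t A) {x : ℕ} (hx : x ∈ H) (hxt : x < t) (hAx : A x) :
    ∃ y, s.Remembers W t y ∧ A y := by
  rcases Nat.lt_or_ge (x + W) t with hfar | hnear
  · rcases hA with hA | ⟨q, hq1, hq2⟩
    · rcases hA x hAx with hxW | hxW
      · exact ⟨x, Or.inr ⟨x, hxW, Or.inl ⟨(h.bit0 x hxW).2 ⟨hxt, hx⟩, rfl⟩⟩, hAx⟩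
      · omega
    · have hxp := h.far x hx hfar
      rcases Nat.lt_or_ge s.p q with hpq | hpq
      · have := hq1 x hAx
        rcases hxp.eq_or_lt with rfl | hlt
        · exact ⟨s.p, Or.inl rfl, hAx⟩
        · exact ⟨x, Or.inr ⟨s.p - 1 - x, by omega, Or.inr (Or.inr
            ⟨h.near x hx hlt (by omega), by omega, by omega⟩)⟩, hAx⟩
      · refine ⟨s.p, Or.inl rfl, ?_⟩
        rcases h.mem_p with hp | hp
        · have : x = s.p := by omega
          exact this ▸ hAx
        · exact hq2 _ hpq hp.2
  · refine ⟨x, Or.inr ⟨t - 1 - x, by omega, Or.inr (Or.inl ⟨(h.bit1 _ (by omega)).2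
      ⟨by omega, ?_⟩, by omega, by omega⟩)⟩, hAx⟩
    rwa [show t - 1 - (t - 1 - x) = x by omega]

/-- The code number of a signature. -/
def Sig.code (B N : ℕ) (s : Sig) : ℕ := ((s.m0 * B + s.m1) * B + s.m2) * N + s.p

/-- The signature with a given code number. -/
def decode (B N c : ℕ) : Sig := ⟨c / N / B / B, c / N / B % B, c / N % B, c % N⟩

theorem decode_code {B N : ℕ} {s : Sig} (h1 : s.m1 < B) (h2 : s.m2 < B) (hp : s.p < N) :
    decode B N (s.code B N) = s := by
  have d {x y M : ℕ} (hy : y < M) : (x * M + y) / M = x ∧ (x * M + y) % M = y := by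
    constructor
    · rw [mul_comm, Nat.mul_add_div (by omega), Nat.div_eq_of_lt hy, add_zero]
    · rw [mul_comm, Nat.mul_add_mod, Nat.mod_eq_of_lt hy]
  ext
  · simp only [decode, Sig.code, (d hp).1, (d h2).1, (d h1).1]
  · simp only [decode, Sig.code, (d hp).1, (d h2).1, (d h1).2]
  · simp only [decode, Sig.code, (d hp).1, (d h2).2]
  · simp only [decode, Sig.code, (d hp).2]

theorem code_lt {B N : ℕ} {s : Sig} (h0 : s.m0 < B) (h1 : s.m1 < B) (h2 : s.m2 < B) (hp : s.p < N) :
    s.code B N < B * B * B * N := by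
  have d {x y X Y : ℕ} (hx : x < X) (hy : y < Y) : x * Y + y < X * Y := by
    have := Nat.mul_le_mul_right Y (show x + 1 ≤ X by omega)
    rw [add_mul] at this
    omega
  exact d (d (d h0 h1) h2) hp

/-! ### The program -/

instance : Add Expr := ⟨.add⟩
instance : Sub Expr := ⟨.sub⟩
instance : Mul Expr := ⟨.mul⟩
instance : Div Expr := ⟨.div⟩
instance (k : ℕ) : OfNat Expr k := ⟨.const k⟩

section
variable (σ : State) (e f : Expr)

@[simp] theorem Expr.val_add : (e + f).val σ = e.val σ + f.val σ := rfl
@[simp] theorem Expr.val_sub : (e - f).val σ = e.val σ - f.val σ := rfl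
@[simp] theorem Expr.val_mul : (e * f).val σ = e.val σ * f.val σ := rfl
@[simp] theorem Expr.val_div : (e / f).val σ = e.val σ / f.val σ := rfl
@[simp] theorem Expr.val_zero : (0 : Expr).val σ = 0 := rfl
@[simp] theorem Expr.val_one : (1 : Expr).val σ = 1 := rfl
@[simp] theorem Expr.val_two : (2 : Expr).val σ = 2 := rfl
@[simp] theorem Expr.val_four : (4 : Expr).val σ = 4 := rfl
@[simp] theorem Expr.val_var (x : ℕ) : (Expr.var x).val σ = σ.vars x := rfl
@[simp] theorem Expr.val_get (a : ℕ) : (Expr.get a e).val σ = σ.arr a (e.val σ) := rfl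
@[simp] theorem Test.holds_lt : (Test.lt e f).holds σ ↔ e.val σ < f.val σ := Iff.rfl
@[simp] theorem Test.holds_eq : (Test.eq e f).holds σ ↔ e.val σ = f.val σ := Iff.rfl
@[simp] theorem Test.holds_and (s t : Test) : (s.and t).holds σ ↔ s.holds σ ∧ t.holds σ := Iff.rfl
@[simp] theorem Test.holds_not (s : Test) : s.not.holds σ ↔ ¬ s.holds σ := Iff.rfl
@[simp] theorem Cmd.run_assign (x : ℕ) : (Cmd.assign x e).run σ = σ.setVar x (e.val σ) := rfl
@[simp] theorem Cmd.run_store (a : ℕ) :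
    (Cmd.store a e f).run σ = σ.setArr a (e.val σ) (f.val σ) := rfl
@[simp] theorem Cmd.run_seq (c d : Cmd) : (Cmd.seq c d).run σ = d.run (c.run σ) := rfl

end

/-- Maximum of two expressions. -/
def Expr.max (e f : Expr) : Expr := .ite (.lt e f) f e

/-- Minimum of two expressions. -/
def Expr.min (e f : Expr) : Expr := .ite (.lt f e) f e

@[simp] theorem Expr.val_max (σ : State) (e f : Expr) :
    (Expr.max e f).val σ = Max.max (e.val σ) (f.val σ) := by
  simp only [Expr.max, Expr.val_ite, Test.holds_lt]
  split_ifs <;> omega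

@[simp] theorem Expr.val_min (σ : State) (e f : Expr) :
    (Expr.min e f).val σ = Min.min (e.val σ) (f.val σ) := by
  simp only [Expr.min, Expr.val_ite, Test.holds_lt]
  split_ifs <;> omega

attribute [simp] Expr.val_mod Expr.val_ite

infixr:60 " ;; " => Cmd.seq

/-- Variables that an expression reads. -/
def Expr.rv : Expr → List ℕ
  | .const _ => []
  | .var x => [x]
  | .get _ e => e.rv
  | .add e f => e.rv ++ f.rv
  | .sub e f => e.rv ++ f.rv
  | .mul e f => e.rv ++ f.rv
  | .div e f => e.rv ++ f.rv
  | .lt e f => e.rv ++ f.rv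
  | .eq e f => e.rv ++ f.rv

/-- Arrays that an expression reads. -/
def Expr.ra : Expr → List ℕ
  | .const _ => []
  | .var _ => []
  | .get a e => a :: e.ra
  | .add e f => e.ra ++ f.ra
  | .sub e f => e.ra ++ f.ra
  | .mul e f => e.ra ++ f.ra
  | .div e f => e.ra ++ f.ra
  | .lt e f => e.ra ++ f.ra
  | .eq e f => e.ra ++ f.ra

theorem Expr.val_congr {σ σ' : State} (e : Expr) (hv : ∀ x ∈ e.rv, σ.vars x = σ'.vars x)
    (ha : ∀ a ∈ e.ra, σ.arr a = σ'.arr a) : e.val σ = e.val σ' := by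
  induction e with
  | const z => rfl
  | var x => exact hv x (by simp [Expr.rv])
  | get a e ih =>
    simp only [Expr.val]
    rw [ih hv fun b hb => ha b (by simp [Expr.ra, hb]), ha a (by simp [Expr.ra])]
  | add e f ihe ihf | sub e f ihe ihf | mul e f ihe ihf | div e f ihe ihf | lt e f ihe ihf
  | eq e f ihe ihf =>
    simp only [Expr.rv, Expr.ra, List.mem_append] at hv ha
    simp only [Expr.val]
    rw [ihe (fun x hx => hv x (Or.inl hx)) (fun x hx => ha x (Or.inl hx)),
      ihf (fun x hx => hv x (Or.inr hx)) (fun x hx => ha x (Or.inr hx))]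

/-- Criterion for boundedness after the execution of a command. -/
theorem State.Bdd.of_same {B : ℕ} {c : Cmd} {σ σ' : State} (h : σ.Bdd B) (hs : Same c σ σ')
    (hv : ∀ x ∈ c.wv, |σ'.vars x| ≤ B) (ha : ∀ a ∈ c.wa, ∀ i, |σ'.arr a i| ≤ B) : σ'.Bdd B := by
  refine ⟨fun x => ?_, fun a i => ?_⟩
  · by_cases hx : x ∈ c.wv
    · exact hv x hx
    · rw [hs.1 x hx]; exact h.1 x
  · by_cases hx : a ∈ c.wa
    · exact ha a hx i
    · rw [hs.2 a hx]; exact h.2 a i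

/-- Window length parameters and powers of two: variables `8`, `9`, `10` and array `12`. -/
def initCmd : Cmd :=
  .assign 8 (.min (.var 6 * .var 5 / (.var 7 * .var 4) + 2) (.var 1)) ;;
  .assign 9 (4 * .var 8 + 4) ;;
  .assign 10 1

def powBody : Cmd :=
  .store 12 (.var 20) (.var 10) ;;
  .assign 10 (2 * .var 10)

def powCmd : Cmd := initCmd ;; .forTo 20 (.var 9) powBody

/-- A quantity `e * num / den` of the job in variable `20`, with numerator in array `k`. -/
def jobExpr (e : Expr) (k : ℕ) : Expr := e * .get k (.var 20) / .get (k + 1) (.var 20)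

/-- Twice a common denominator of the data of the job in variable `20`. -/
def scaleE : Expr :=
  2 * .var 5 * .get 1 (.var 20) * .get 3 (.var 20) * .get 5 (.var 20) * .var 7 *
    .get 7 (.var 20) * .get 9 (.var 20) * .var 2

/-- The scaled time that a train needs to reach a location, with numerator in array `k`. -/
def runE (k : ℕ) : Expr :=
  scaleE * .var 6 * .get k (.var 20) * .var 3 / (.var 7 * .get (k + 1) (.var 20) * .var 2)

/-- In order, these six expressions are the `D`, `w`, `a`, `b`, `r`, `e` of `Scaled`. The processing
time is subtracted in the offsets because a job that starts up to `p` before the train reaches its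
section still blocks the train. -/
def headwayE : Expr := scaleE * .var 4 / .var 5
def lengthE : Expr := jobExpr scaleE 4 + runE 8 - runE 6
def upE : Expr := runE 6 - jobExpr scaleE 4
def downE : Expr := scaleE * .var 6 / .var 7 - runE 8 - jobExpr scaleE 4
def releaseE : Expr := jobExpr scaleE 0
def latestE : Expr := jobExpr scaleE 2 - jobExpr scaleE 4

/-- Scaled data of a job in arrays `13, …, 19`, and centres of its blocks in array `20`. -/
def jobBody : Cmd :=
  .store 13 (.var 20) scaleE ;;
  .store 14 (.var 20) headwayE ;;
  .store 15 (.var 20) lengthE ;;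
  .store 16 (.var 20) upE ;;
  .store 17 (.var 20) downE ;;
  .store 18 (.var 20) releaseE ;;
  .store 19 (.var 20) latestE ;;
  .store 20 (2 * .var 20) ((releaseE - upE) / headwayE) ;;
  .store 20 (2 * .var 20 + 1) ((latestE - upE) / headwayE)

/-- The last two centres are `0` and `m + 1`; the former needs no store, as arrays start with zeros.
Variable `12` bounds the number of list entries that the blocks can produce, and variable `13`
starts at `1` because entry `0` of the list is a ghost. -/
def jobFinish : Cmd :=
  .store 20 (2 * .var 0 + 1) (.var 1 + 1) ;;
  .assign 11 (2 * .var 0 + 2) ;;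
  .assign 12 (.var 11 * (2 * .var 8 + 1)) ;;
  .assign 13 1

def jobCmd : Cmd := .forTo 20 (.var 0) jobBody ;; jobFinish

/-- The next path number after variable `14` that lies in one of the blocks. -/
def nextE : Expr := .max (.var 14 + 1) (.get 20 (.var 21) - .var 8)

def scanBody : Cmd :=
  .assign 15 (.ite (.and (.lt nextE (.get 20 (.var 21) + .var 8 + 1)) (.lt nextE (.var 15)))
    nextE (.var 15))

def recordCmd : Cmd :=
  .store 21 (.var 13) (.ite (.lt (.var 15) (.var 1 + 1)) (.var 15) 0) ;;
  .assign 13 (.ite (.lt (.var 15) (.var 1 + 1)) (.var 13 + 1) (.var 13)) ;;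
  .assign 14 (.ite (.lt (.var 15) (.var 1 + 1)) (.var 15) (.var 14))

/-- One round of selection: `m + 1` plays the role of infinity for the minimum over all blocks.
Quadratic time is affordable, and no sorting is needed. -/
def listBody : Cmd :=
  .assign 15 (.var 1 + 1) ;; .forTo 21 (.var 11) scanBody ;; recordCmd

def listFinish : Cmd :=
  .assign 16 (2 * .var 13) ;; .assign 17 (.var 10 * .var 10 * .var 10 * .var 16)

/-- Increasing list of the relevant path numbers in array `21`. -/
def listCmd : Cmd := .forTo 20 (.var 12) listBody ;; listFinish

/-- Position `c` stands for list entry `c / 2`, upward if `c` is even and downward if it is odd. -/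
def idxE : Expr := .get 21 (.var 21 / 2)
def upT : Test := .eq (.mod (.var 21) 2) 0
def ownE : Expr := .ite upT (.get 16 (.var 20)) (.get 17 (.var 20))
def otherE : Expr := .ite upT (.get 17 (.var 20)) (.get 16 (.var 20))

def entryE : Expr :=
  .max (.max (.get 18 (.var 20)) (idxE * .get 14 (.var 20) + ownE))
    (.ite (.lt 1 idxE) ((idxE - 1) * .get 14 (.var 20) + ownE + .get 15 (.var 20) + 1)
      (.get 18 (.var 20)))

def lastStartE : Expr := .min (.var 1) ((entryE - otherE) / .get 14 (.var 20))

def witE : Expr :=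
  .ite (.and (.not (.lt lastStartE 1))
      (.not (.lt (lastStartE * .get 14 (.var 20) + otherE + .get 15 (.var 20)) entryE)))
    (.ite (.lt (.get 15 (.var 20)) (.get 14 (.var 20))) lastStartE (.var 1) * .get 14 (.var 20)
      + otherE + .get 15 (.var 20) + 1)
    entryE

def hitT : Test :=
  .and (.not (.lt idxE 1)) <| .and (.not (.lt (.var 1) idxE)) <|
  .and (.not (.lt (.get 19 (.var 20)) witE)) <|
  .and (.not (.lt (idxE * .get 14 (.var 20) + ownE + .get 15 (.var 20)) witE)) <|
  .not (.and (.not (.eq idxE (.var 1)))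
    (.not (.lt witE ((idxE + 1) * .get 14 (.var 20) + ownE))))

def cellE : Expr := .var 20 * .var 16 + .var 21

/-- Positions are visited in increasing order, so the last write to array `24` leaves the last
usable position. -/
def hitBody : Cmd :=
  .store 22 cellE (.ite hitT 1 0) ;;
  .store 23 cellE (.ite hitT witE 0) ;;
  .store 24 (.var 20) (.ite hitT (.var 21) (.get 24 (.var 20)))

/-- Which job can use which path (array `22`), at what time (array `23`), and the last path of each
job (array `24`). -/
def hitCmd : Cmd := .forTo 20 (.var 0) (.forTo 21 (.var 16) hitBody)

def d0 (e : Expr) : Expr := e / .var 16 / .var 10 / .var 10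
def d1 (e : Expr) : Expr := .mod (e / .var 16 / .var 10) (.var 10)
def d2 (e : Expr) : Expr := .mod (e / .var 16) (.var 10)
def dp (e : Expr) : Expr := .mod e (.var 16)

/-- The code of the next signature, where variable `21` is twice the code plus the choice. -/
def codeE : Expr :=
  let s : Expr := .var 21 / 2
  let β : Expr := .mod (.var 21) 2
  let o : Test := .not (.lt (2 * d1 s) (.var 10))
  (((d0 s + β * .get 12 (.var 20)) * .var 10 + .mod (2 * d1 s + β) (.var 10)) * .var 10 +
    .ite o (.mod ((2 * d2 s + 1) * .get 12 (.var 20 - .var 9 - 1 - dp s)) (.var 10)) (d2 s)) *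
      .var 16 + .ite o (.var 20 - .var 9) (dp s)

def srcE : Expr := .get 25 (.var 20 * .var 17 + .var 21 / 2)
def tgtE : Expr := (.var 20 + 1) * .var 17 + codeE
-- Entry `0` means that no set with this signature is known, which is why costs are stored plus one.
def betterT : Test :=
  .and (.not (.eq srcE 0)) (.not (.and (.not (.eq (.get 25 tgtE) 0))
    (.not (.lt (srcE + .mod (.var 21) 2) (.get 25 tgtE)))))

/-- The order of the stores matters: `betterT` reads array `25` but not array `26`, so it has the
same value in both. -/
def relaxBody : Cmd :=
  .store 26 tgtE (.ite betterT (.var 21) (.get 26 tgtE)) ;;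
  .store 25 tgtE (.ite betterT (srcE + .mod (.var 21) 2) (.get 25 tgtE))

def bitE (e : Expr) : Expr := .mod (e / .get 12 (.var 26)) 2
def rowE (e : Expr) : Expr := .get 22 (.var 21 * .var 16 + e)

/-- At level `t` the tested signature belongs to time `t + 1`, so bit `k` of `m1` is about position
`t - k`. Indices may become negative, but for signatures of actual sets the corresponding bits are
then `0`. -/
def seenBody : Cmd :=
  .assign 23 (.ite (.and (.eq (.var 23) 0) (.and (.eq (bitE (d0 (.var 22)) * rowE (.var 26)) 0)
    (.and (.eq (bitE (d1 (.var 22)) * rowE (.var 20 - .var 26)) 0)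
      (.eq (bitE (d2 (.var 22)) * rowE (dp (.var 22) - 1 - .var 26)) 0)))) 0 1)

def pruneE : Expr := (.var 20 + 1) * .var 17 + .var 22

def pruneBody : Cmd :=
  .assign 23 (rowE (dp (.var 22))) ;;
  .forTo 26 (.var 9) seenBody ;;
  .store 25 pruneE (.ite (.eq (.var 23) 0) 0 (.get 25 pruneE))

/-- A job is examined only at its last position, so the loop over all signatures runs once per job
in total. -/
def checkBody : Cmd :=
  .cond (.eq (.get 24 (.var 21)) (.var 20)) (.forTo 22 (.var 17) pruneBody) .skip

def levelBody : Cmd :=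
  .forTo 21 (2 * .var 17) relaxBody ;; .forTo 21 (.var 0) checkBody

/-- Dynamic programming over the signatures: costs plus one in array `25`, choices in array `26`. -/
def dpCmd : Cmd := .store 25 0 1 ;; .forTo 20 (.var 16) levelBody

def finalE : Expr := .get 25 (.var 16 * .var 17 + .var 20)
def bestT : Test :=
  .and (.not (.eq finalE 0)) (.not (.and (.not (.eq (.var 24) 0)) (.not (.lt finalE (.var 24)))))

def bestBody : Cmd :=
  .assign 25 (.ite bestT (.var 20) (.var 25)) ;; .assign 24 (.ite bestT finalE (.var 24))

def traceE : Expr := .get 26 ((.var 16 - .var 20) * .var 17 + .var 25)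

def traceBody : Cmd :=
  .store 27 (.var 16 - .var 20 - 1) (.mod traceE 2) ;; .assign 25 (traceE / 2)

/-- The chosen paths in array `27`. -/
def traceCmd : Cmd := .forTo 20 (.var 17) bestBody ;; .forTo 20 (.var 16) traceBody

def useT : Test := .not (.eq (.get 27 (.var 21) * .get 22 cellE) 0)

def outBody : Cmd :=
  .store 10 (.var 20) (.ite useT (.get 23 cellE) (.get 10 (.var 20))) ;;
  .store 11 (.var 20) (.ite useT (.get 13 (.var 20)) (.get 11 (.var 20)))

/-- The start times in arrays `10` and `11`. -/
def outCmd : Cmd := .forTo 20 (.var 0) (.forTo 21 (.var 16) outBody)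

def solver : Cmd := powCmd ;; jobCmd ;; listCmd ;; hitCmd ;; dpCmd ;; traceCmd ;; outCmd

/-- An exponent that bounds the growth of values between two control points of the program. -/
def solverExp : ℕ :=
  initCmd.growth + powBody.growth + jobBody.growth + jobFinish.growth +
  (Cmd.assign 15 (.var 1 + 1)).growth + scanBody.growth + recordCmd.growth + listFinish.growth +
  hitBody.growth + (Cmd.store 25 0 1).growth + relaxBody.growth +
  (Cmd.assign 23 (rowE (dp (.var 22)))).growth + seenBody.growth +
  (Cmd.store 25 pruneE (.ite (.eq (.var 23) 0) 0 (.get 25 pruneE))).growth +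
  (Expr.eq (.get 24 (.var 21)) (.var 20)).wt + Cmd.skip.growth + bestBody.growth +
  traceBody.growth + outBody.growth + (2 * .var 17 : Expr).wt + 10

/-! ### Set-up phases: powers of two and scaled job data. -/

theorem fit {B Wd k : ℕ} (hB : 2 ≤ B) (hW : B ^ solverExp ≤ Wd) (hk : k ≤ solverExp) :
    B ^ k ≤ Wd := (Nat.pow_le_pow_right (by omega) hk).trans hW

theorem wt_var_le (x : ℕ) : (Expr.var x).wt + 4 ≤ solverExp := by
  simp only [Expr.wt, solverExp]
  omega

/-- The powers of two below `2 ^ W`. -/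
def pw (W : ℕ) (z : ℤ) : ℤ := if 0 ≤ z ∧ z < W then 2 ^ z.toNat else 0

theorem powCmd_spec {Wd B h : ℕ} {σ : State} (hB : 2 ≤ B) (hW : B ^ solverExp ≤ Wd)
    (hb : σ.Bdd B)
    (hh : min (σ.vars 6 * σ.vars 5 / (σ.vars 7 * σ.vars 4) + 2) (σ.vars 1) = (h : ℤ))
    (hBh : 2 ^ (4 * h + 4) ≤ B) (h12 : ∀ z, σ.arr 12 z = 0) :
    Tr Wd powCmd σ (initCmd.time + ((4 * h + 4) * (powBody.time + (Expr.var 9).cost + 10) +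
        (Expr.var 9).cost + 10))
      (fun σ' => σ'.Bdd B ∧ σ'.vars 8 = h ∧ σ'.vars 9 = (4 * h + 4 : ℕ) ∧
        σ'.vars 10 = (2 ^ (4 * h + 4) : ℕ) ∧ ∀ z, σ'.arr 12 z = pw (4 * h + 4) z) := by
  have hWB : 4 * h + 4 < B := Nat.lt_two_pow_self.trans_le hBh
  have e8 : (initCmd.run σ).vars 8 = h := by simpa [initCmd] using hh
  have e9 : (initCmd.run σ).vars 9 = (4 * h + 4 : ℕ) := by simpa [initCmd] using hh
  have e10 : (initCmd.run σ).vars 10 = 1 := by simp [initCmd]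
  have hb1 : (initCmd.run σ).Bdd B := by
    refine hb.of_same (c := initCmd)
      (initCmd.exec_run rfl hB hb (fit hB hW (by unfold solverExp; omega))).1.same ?_ (by simp [initCmd, Cmd.wa])
    intro x hx
    simp only [initCmd, Cmd.wv, List.cons_append, List.nil_append, List.mem_cons,
      List.not_mem_nil, or_false] at hx
    rcases hx with rfl | rfl | rfl
    · rw [e8, Nat.abs_cast]; exact_mod_cast (by omega)
    · rw [e9, Nat.abs_cast]; exact_mod_cast hWB.le
    · rw [e10, abs_one]; exact_mod_cast (by omega : 1 ≤ B)
  refine Tr.seq (Q := fun σ' => σ' = initCmd.run σ) (Tr.block rfl hB hb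
    (fit hB hW (by unfold solverExp; omega)) rfl) ?_
  rintro _ - rfl
  refine (Tr.forTo (n := 4 * h + 4) (T := powBody.time)
    (fun k σ' => σ'.vars 10 = (2 ^ k : ℕ) ∧ ∀ z, σ'.arr 12 z = pw k z) hB
    (fit hB hW (wt_var_le 9)) hWB.le (by decide) ?_ hb1 ?_ ?_).mono le_rfl ?_
  · intro σ' hs
    rw [Expr.val_var, hs.1 9 (by decide)]
    exact e9
  · refine ⟨by simp [e10], fun z => ?_⟩
    simp [initCmd, h12, pw]
  · rintro k hk σ' hs h20 hb' ⟨i10, i12⟩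
    have hkB : 2 ^ (k + 1) ≤ B := (Nat.pow_le_pow_right (by omega) (by omega)).trans hBh
    have hkB' : 2 ^ k ≤ B := (Nat.pow_le_pow_right (by omega) (by omega)).trans hBh
    refine Tr.block rfl hB hb' (fit hB hW (by unfold solverExp; omega)) ⟨?_, ?_, ?_⟩
    · simp only [powBody, Cmd.run_seq, Cmd.run_store, Cmd.run_assign]
      refine (hb'.setArr ?_).setVar ?_
      · simp only [Expr.val_var, i10, Nat.abs_cast]; exact_mod_cast hkB'
      · simp only [Expr.val_mul, Expr.val_two, Expr.val_var, State.setArr_vars, i10]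
        rw [abs_of_nonneg (by positivity)]
        have := hkB
        rw [pow_succ] at this
        push_cast
        zify at this
        linarith
    · simp [powBody, i10, pow_succ, mul_comm]
    · intro z
      simp only [powBody, Cmd.run_seq, Cmd.run_store, Cmd.run_assign, State.setVar_arr,
        State.setArr_arr, Expr.val_var, h20, i10, i12, true_and, pw]
      push_cast
      split_ifs with h1 h2 h3 h4 h5
      all_goals first | omega | rfl | skip
      all_goals simp [h1]
  · rintro σ' hs ⟨hb', i10, i12⟩
    exact ⟨hb', by rw [hs.1 8 (by decide)]; exact e8, by rw [hs.1 9 (by decide)]; exact e9, i10, i12⟩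

/-- The expressions that are evaluated for each job. -/
def jobExprs : List Expr :=
  [scaleE, headwayE, lengthE, upE, downE, releaseE, latestE, (releaseE - upE) / headwayE,
    (latestE - upE) / headwayE]

/-- The arrays hold the scaled data of the first `k` jobs. -/
def JobsDone (σ₀ : State) (k : ℕ) (σ : State) : Prop :=
  ∀ q < k, σ.arr 13 q = scaleE.val (σ₀.setVar 20 q) ∧ σ.arr 14 q = headwayE.val (σ₀.setVar 20 q) ∧
    σ.arr 15 q = lengthE.val (σ₀.setVar 20 q) ∧ σ.arr 16 q = upE.val (σ₀.setVar 20 q) ∧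
    σ.arr 17 q = downE.val (σ₀.setVar 20 q) ∧ σ.arr 18 q = releaseE.val (σ₀.setVar 20 q) ∧
    σ.arr 19 q = latestE.val (σ₀.setVar 20 q) ∧
    σ.arr 20 (2 * q) = ((releaseE - upE) / headwayE).val (σ₀.setVar 20 q) ∧
    σ.arr 20 (2 * q + 1) = ((latestE - upE) / headwayE).val (σ₀.setVar 20 q)

/-- These expressions read only the input and the loop variable, so the stores of earlier rounds do
not affect them. -/
theorem jobExprs_congr {e : Expr} (he : e ∈ jobExprs) {σ σ' : State}
    (hv : ∀ x, x < 8 ∨ x = 20 → σ.vars x = σ'.vars x) (ha : ∀ a < 10, σ.arr a = σ'.arr a) :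
    e.val σ = e.val σ' := by
  have h1 : ∀ e ∈ jobExprs, ∀ x ∈ e.rv, x < 8 ∨ x = 20 := by decide
  have h2 : ∀ e ∈ jobExprs, ∀ a ∈ e.ra, a < 10 := by decide
  exact e.val_congr (fun x hx => hv x (h1 e he x hx)) fun a hx => ha a (h2 e he a hx)

theorem abs_lt_of_nat {k B : ℕ} (h : k ≤ B) : |(k : ℤ)| ≤ B := by
  rw [Nat.abs_cast]
  exact_mod_cast h

theorem abs_le_of_nonneg {x : ℤ} {B : ℕ} (h0 : 0 ≤ x) (h : x ≤ B) : |x| ≤ B := by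
  rwa [abs_of_nonneg h0]

set_option maxHeartbeats 800000 in
theorem jobBody_run {B n k : ℕ} {σ σ' : State} (hb' : σ'.Bdd B) (hk : k < n)
    (hik : σ'.vars 20 = k)
    (cg : ∀ e ∈ jobExprs, ∀ τ : State, Same jobBody σ' τ → e.val τ = e.val (σ.setVar 20 (k : ℕ)))
    (hz : ∀ e ∈ jobExprs, ∀ j < n, |e.val (σ.setVar 20 (j : ℕ))| ≤ B)
    (hd : JobsDone σ k σ') (h0 : σ'.arr 20 (2 * n) = 0) :
    (jobBody.run σ').Bdd B ∧ JobsDone σ (k + 1) ((jobBody.run σ').setVar 20 ((k : ℤ) + 1)) ∧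
      ((jobBody.run σ').setVar 20 ((k : ℤ) + 1)).arr 20 (2 * n) = 0 := by
  have ar : ∀ {a : ℕ} {i : ℤ} {v : Expr} {τ : State}, Same jobBody σ' τ → a ∈ jobBody.wa →
      Same jobBody σ' (τ.setArr a i (v.val τ)) := by
    intro a i v τ hτ ha
    refine ⟨hτ.1, fun b hb => ?_⟩
    have : b ≠ a := fun hba => hb (hba ▸ ha)
    rw [← hτ.2 b hb]
    funext z
    simp [this]
  simp only [jobBody, Cmd.run_seq, Cmd.run_store]
  have s0 := Same.refl jobBody σ'
  -- Each intermediate state is made opaque, so that the nine stores are never unfolded inside the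
  -- large expressions.
  have s1 := ar (a := 13) (i := (Expr.var 20).val σ') (v := scaleE) s0 (by decide)
  generalize hτ1 : σ'.setArr 13 ((Expr.var 20).val σ') (scaleE.val σ') = τ1 at s1
  have s2 := ar (a := 14) (i := (Expr.var 20).val τ1) (v := headwayE) s1 (by decide)
  generalize hτ2 : τ1.setArr 14 ((Expr.var 20).val τ1) (headwayE.val τ1) = τ2 at s2
  have s3 := ar (a := 15) (i := (Expr.var 20).val τ2) (v := lengthE) s2 (by decide)
  generalize hτ3 : τ2.setArr 15 ((Expr.var 20).val τ2) (lengthE.val τ2) = τ3 at s3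
  have s4 := ar (a := 16) (i := (Expr.var 20).val τ3) (v := upE) s3 (by decide)
  generalize hτ4 : τ3.setArr 16 ((Expr.var 20).val τ3) (upE.val τ3) = τ4 at s4
  have s5 := ar (a := 17) (i := (Expr.var 20).val τ4) (v := downE) s4 (by decide)
  generalize hτ5 : τ4.setArr 17 ((Expr.var 20).val τ4) (downE.val τ4) = τ5 at s5
  have s6 := ar (a := 18) (i := (Expr.var 20).val τ5) (v := releaseE) s5 (by decide)
  generalize hτ6 : τ5.setArr 18 ((Expr.var 20).val τ5) (releaseE.val τ5) = τ6 at s6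
  have s7 := ar (a := 19) (i := (Expr.var 20).val τ6) (v := latestE) s6 (by decide)
  generalize hτ7 : τ6.setArr 19 ((Expr.var 20).val τ6) (latestE.val τ6) = τ7 at s7
  have s8 := ar (a := 20) (i := (2 * Expr.var 20 : Expr).val τ7)
    (v := (releaseE - upE) / headwayE) s7 (by decide)
  generalize hτ8 : τ7.setArr 20 ((2 * Expr.var 20 : Expr).val τ7)
    (((releaseE - upE) / headwayE).val τ7) = τ8 at s8
  have i20 : ∀ τ : State, Same jobBody σ' τ → τ.vars 20 = k := fun τ hτ => by
    rw [hτ.1 20 (by decide), hik]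
  have v1 := cg scaleE (by simp [jobExprs]) _ s0
  have v2 := cg headwayE (by simp [jobExprs]) _ s1
  have v3 := cg lengthE (by simp [jobExprs]) _ s2
  have v4 := cg upE (by simp [jobExprs]) _ s3
  have v5 := cg downE (by simp [jobExprs]) _ s4
  have v6 := cg releaseE (by simp [jobExprs]) _ s5
  have v7 := cg latestE (by simp [jobExprs]) _ s6
  have v8 := cg ((releaseE - upE) / headwayE) (by simp [jobExprs]) _ s7
  have v9 := cg ((latestE - upE) / headwayE) (by simp [jobExprs]) _ s8
  have w0 := i20 _ s0
  have w1 := i20 _ s1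
  have w2 := i20 _ s2
  have w3 := i20 _ s3
  have w4 := i20 _ s4
  have w5 := i20 _ s5
  have w6 := i20 _ s6
  have w7 := i20 _ s7
  have w8 := i20 _ s8
  have z1 := hz scaleE (by simp [jobExprs]) k hk
  have z2 := hz headwayE (by simp [jobExprs]) k hk
  have z3 := hz lengthE (by simp [jobExprs]) k hk
  have z4 := hz upE (by simp [jobExprs]) k hk
  have z5 := hz downE (by simp [jobExprs]) k hk
  have z6 := hz releaseE (by simp [jobExprs]) k hk
  have z7 := hz latestE (by simp [jobExprs]) k hk
  have z8 := hz ((releaseE - upE) / headwayE) (by simp [jobExprs]) k hk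
  have z9 := hz ((latestE - upE) / headwayE) (by simp [jobExprs]) k hk
  rw [v9]
  rw [v8] at hτ8; rw [v7] at hτ7; rw [v6] at hτ6; rw [v5] at hτ5; rw [v4] at hτ4
  rw [v3] at hτ3; rw [v2] at hτ2; rw [v1] at hτ1
  refine ⟨?_, fun q hq => ?_, ?_⟩
  · have b1 := hτ1 ▸ hb'.setArr z1
    have b2 := hτ2 ▸ b1.setArr z2
    have b3 := hτ3 ▸ b2.setArr z3
    have b4 := hτ4 ▸ b3.setArr z4
    have b5 := hτ5 ▸ b4.setArr z5
    have b6 := hτ6 ▸ b5.setArr z6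
    have b7 := hτ7 ▸ b6.setArr z7
    have b8 := hτ8 ▸ b7.setArr z8
    exact b8.setArr z9
  · simp only [State.setVar_arr, State.setArr_arr, Expr.val_var, Expr.val_add, Expr.val_mul,
      Expr.val_two, Expr.val_one, w8]
    simp only [← hτ8, ← hτ7, ← hτ6, ← hτ5, ← hτ4, ← hτ3, ← hτ2, ← hτ1, State.setArr_arr,
      Expr.val_var, Expr.val_mul, Expr.val_two, w0, State.setArr_vars]
    rcases Nat.lt_succ_iff_lt_or_eq.1 hq with hqk | rfl
    · obtain ⟨d1, d2, d3, d4, d5, d6, d7, d8, d9⟩ := hd q hqk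
      have n1 : (q : ℤ) ≠ k := by exact_mod_cast hqk.ne
      have n2 : 2 * (q : ℤ) ≠ 2 * k + 1 := by omega
      have n3 : 2 * (q : ℤ) + 1 ≠ 2 * k := by omega
      simp [n1, n2, n3, d1, d2, d3, d4, d5, d6, d7, d8, d9]
    · have n2 : 2 * (q : ℤ) ≠ 2 * q + 1 := by omega
      simp [n2]
  · simp only [State.setVar_arr, State.setArr_arr, Expr.val_var, Expr.val_add, Expr.val_mul,
      Expr.val_two, Expr.val_one, w8]
    simp only [← hτ8, ← hτ7, ← hτ6, ← hτ5, ← hτ4, ← hτ3, ← hτ2, ← hτ1, State.setArr_arr,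
      Expr.val_var, Expr.val_mul, Expr.val_two, w0, State.setArr_vars]
    have n1 : (n : ℤ) ≠ k := by exact_mod_cast hk.ne'
    have n2 : 2 * (n : ℤ) ≠ 2 * k + 1 := by omega
    simp [n1, n2, h0]

theorem jobCmd_spec {Wd B n m h : ℕ} {σ : State} (hB : 2 ≤ B) (hW : B ^ solverExp ≤ Wd)
    (hb : σ.Bdd B) (hn : σ.vars 0 = n) (hm : σ.vars 1 = m) (hh : σ.vars 8 = h)
    (h20 : ∀ z, σ.arr 20 z = 0)
    (hz : ∀ e ∈ jobExprs, ∀ j < n, |e.val (σ.setVar 20 (j : ℕ))| ≤ B)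
    (hnB : (2 * n + 2) * (2 * h + 1) ≤ B) (hmB : m + 1 ≤ B) :
    Tr Wd jobCmd σ (n * (jobBody.time + (Expr.var 0).cost + 10) +
        (Expr.var 0).cost + 10 + jobFinish.time)
      (fun σ' => σ'.Bdd B ∧ JobsDone σ n σ' ∧ σ'.arr 20 (2 * n) = 0 ∧
        σ'.arr 20 (2 * n + 1) = m + 1 ∧ σ'.vars 11 = (2 * n + 2 : ℕ) ∧
        σ'.vars 12 = ((2 * n + 2) * (2 * h + 1) : ℕ) ∧ σ'.vars 13 = 1) := by
  have hnB' : 2 * n + 2 ≤ B := by nlinarith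
  have loop := Tr.forTo (Wd := Wd) (n := n) (T := jobBody.time) (i := 20) (e := .var 0)
    (c := jobBody) (σ₀ := σ)
    (fun k σ' => JobsDone σ k σ' ∧ σ'.arr 20 (2 * n) = 0) hB
    (fit hB hW (wt_var_le 0)) (by omega) (by decide)
    (by intro σ' hs; rw [Expr.val_var, hs.1 0 (by decide)]; exact hn) hb
    ⟨fun q hq => by omega, h20 _⟩ (by
      rintro k hk σ' hs hik hb' ⟨hd, h0⟩
      refine Tr.block rfl hB hb' (fit hB hW (by unfold solverExp; omega)) ?_
      have cg : ∀ e ∈ jobExprs, ∀ τ : State, Same jobBody σ' τ →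
          e.val τ = e.val (σ.setVar 20 (k : ℕ)) := by
        intro e he τ hτ
        refine jobExprs_congr he (fun x hx => ?_) fun a ha => ?_
        · have m1 : ∀ x, x < 8 ∨ x = 20 → x ∉ jobBody.wv := by intro x hx; simp [jobBody, Cmd.wv]
          rw [hτ.1 x (m1 x hx), State.setVar_vars]
          split_ifs with hx'
          · rw [hx', hik]
          · refine hs.1 x ?_
            simp [jobBody, Cmd.wv, Cmd.forTo, hx']
        · have m2 : ∀ a < 10, a ∉ jobBody.wa := by decide
          have m3 : ∀ a < 10, a ∉ (Cmd.forTo 20 (.var 0) jobBody).wa := by decide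
          rw [hτ.2 a (m2 a ha), State.setVar_arr]
          exact hs.2 a (m3 a ha)
      exact jobBody_run hb' hk hik cg hz hd h0)
  refine Tr.seq loop ?_
  rintro σ' hs ⟨hb', hd, h0⟩
  refine Tr.block rfl hB hb' (fit hB hW (by unfold solverExp; omega)) ?_
  have e0 : σ'.vars 0 = n := by rw [hs.1 0 (by decide), hn]
  have e1 : σ'.vars 1 = m := by rw [hs.1 1 (by decide), hm]
  have e8 : σ'.vars 8 = h := by rw [hs.1 8 (by decide), hh]
  simp only [jobFinish, Cmd.run_seq, Cmd.run_store, Cmd.run_assign, Expr.val_var, Expr.val_add,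
    Expr.val_mul, Expr.val_two, Expr.val_one, State.setArr_vars, State.setVar_vars, e0, e1, e8]
  refine ⟨?_, fun q hq => ?_, ?_, ?_, ?_, ?_, ?_⟩
  · refine (((hb'.setArr ?_).setVar ?_).setVar ?_).setVar ?_
    · exact_mod_cast abs_lt_of_nat hmB
    · exact_mod_cast abs_lt_of_nat hnB'
    · simp only [if_true, if_neg (show (8 : ℕ) ≠ 11 by decide)]
      exact_mod_cast abs_lt_of_nat hnB
    · simpa using by exact_mod_cast (by omega : 1 ≤ B)
  · have n1 : 2 * (q : ℤ) ≠ 2 * n + 1 := by omega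
    have n2 : (q : ℤ) ≠ n := by exact_mod_cast hq.ne
    simpa [n1, n2] using hd q hq
  · simpa using h0
  · simp
  · simp
  · simp
  · simp

/-! ### The list of relevant path numbers. -/

/-- The number `x` belongs to one of the blocks of radius `h` around the first `k` centres. -/
def InBlocks (cen : ℤ → ℤ) (h k : ℕ) (x : ℤ) : Prop := ∃ q < k, cen q - h ≤ x ∧ x ≤ cen q + h

/-- The array `tt` lists `0` and the members of `T`, up to `cur`, in increasing order. -/
structure Listing (T : ℤ → Prop) (tt : ℤ → ℤ) (cnt : ℕ) (cur : ℤ) : Prop where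
  pos : 1 ≤ cnt
  zero : tt 0 = 0
  last : tt (cnt - 1 : ℕ) = cur
  lt : ∀ i j : ℕ, i < j → j < cnt → tt i < tt j
  mem : ∀ i : ℕ, 1 ≤ i → i < cnt → T (tt i)
  all : ∀ x, T x → x ≤ cur → ∃ i : ℕ, 1 ≤ i ∧ i < cnt ∧ tt i = x
  rest : ∀ i : ℕ, cnt ≤ i → tt i = 0

theorem Listing.cons {T : ℤ → Prop} {tt : ℤ → ℤ} {cnt : ℕ} {cur x : ℤ} (h : Listing T tt cnt cur)
    (hx : T x) (hlt : cur < x) (hno : ∀ y, T y → cur < y → x ≤ y) :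
    Listing T (Function.update tt cnt x) (cnt + 1) x := by
  have hp := h.pos
  have up (i : ℕ) (hi : i ≠ cnt) : Function.update tt cnt x i = tt i := by
    rw [Function.update_of_ne]
    exact_mod_cast hi
  have le_cur : ∀ i : ℕ, i < cnt → tt i ≤ cur := by
    intro i hi
    rw [← h.last]
    rcases Nat.lt_or_ge i (cnt - 1) with hlt' | hge
    · exact (h.lt i _ hlt' (by omega)).le
    · rw [show i = cnt - 1 by omega]
  refine ⟨by omega, ?_, by simp, fun i j hij hj => ?_, fun i hi hic => ?_, fun y hy hyx => ?_,
    fun i hi => ?_⟩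
  · have := up 0 (by omega)
    simpa [h.zero] using this
  · rw [up i (by omega)]
    rcases Nat.lt_succ_iff_lt_or_eq.1 hj with hj' | rfl
    · rw [up j (by omega)]
      exact h.lt i j hij hj'
    · rw [Function.update_self]
      exact (le_cur i hij).trans_lt hlt
  · rcases Nat.lt_succ_iff_lt_or_eq.1 hic with hi' | rfl
    · rw [up i (by omega)]
      exact h.mem i hi hi'
    · rwa [Function.update_self]
  · rcases le_or_gt y cur with hyc | hyc
    · obtain ⟨i, h1, h2, h3⟩ := h.all y hy hyc
      exact ⟨i, h1, by omega, by rw [up i (by omega), h3]⟩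
    · refine ⟨cnt, hp, by omega, ?_⟩
      rw [Function.update_self]
      exact le_antisymm (hno y hy hyc) hyx
  · rw [up i (by omega)]
    exact h.rest i (by omega)

theorem card_blocks_le (cen : ℤ → ℤ) (h k : ℕ) {s : Finset ℤ} (hs : ∀ x ∈ s, InBlocks cen h k x) :
    s.card ≤ k * (2 * h + 1) := by
  have hsub : s ⊆ (Finset.range k).biUnion fun q => Finset.Icc (cen q - h) (cen q + h) := by
    intro x hx
    obtain ⟨q, hq, h1, h2⟩ := hs x hx
    simp only [Finset.mem_biUnion, Finset.mem_range, Finset.mem_Icc]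
    exact ⟨q, hq, h1, h2⟩
  refine (Finset.card_le_card hsub).trans (Finset.card_biUnion_le.trans ?_)
  refine (Finset.sum_le_card_nsmul _ _ (2 * h + 1) fun q _ => ?_).trans (by simp)
  rw [Int.card_Icc]
  omega

/-- After sufficiently many rounds, everything is listed. -/
theorem Listing.complete {T : ℤ → Prop} {tt : ℤ → ℤ} {cnt k h : ℕ} {cur : ℤ} {cen : ℤ → ℤ}
    (hl : Listing T tt cnt cur) (hT : ∀ x, T x → InBlocks cen h k x)
    (hc : cnt = k * (2 * h + 1) + 1 ∨ ∀ x, T x → x ≤ cur) (x : ℤ) (hx : T x) :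
    ∃ i : ℕ, 1 ≤ i ∧ i < cnt ∧ tt i = x := by
  by_contra hno
  rcases hc with hc | hc
  · have inj : Set.InjOn (fun i : ℕ => tt i) (Finset.Ico 1 cnt : Set ℕ) := by
      intro i hi j hj hij
      simp only [Finset.coe_Ico, Set.mem_Ico] at hi hj
      rcases lt_trichotomy i j with hlt | heq | hlt
      · exact absurd hij (hl.lt i j hlt hj.2).ne
      · exact heq
      · exact absurd hij (hl.lt j i hlt hi.2).ne'
    have hx' : x ∉ (Finset.Ico 1 cnt).image fun i : ℕ => tt i := by
      intro hmem
      obtain ⟨i, hi, rfl⟩ := Finset.mem_image.1 hmem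
      rw [Finset.mem_Ico] at hi
      exact hno ⟨i, hi.1, hi.2, rfl⟩
    -- Together with the listed numbers, `x` would exceed the total size of the blocks.
    have := card_blocks_le cen h k (s := insert x ((Finset.Ico 1 cnt).image fun i : ℕ => tt i)) (by
      intro y hy
      rcases Finset.mem_insert.1 hy with rfl | hy
      · exact hT y hx
      · obtain ⟨i, hi, rfl⟩ := Finset.mem_image.1 hy
        rw [Finset.mem_Ico] at hi
        exact hT _ (hl.mem i hi.1 hi.2))
    rw [Finset.card_insert_of_notMem hx', Finset.card_image_of_injOn inj, Nat.card_Ico] at this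
    omega
  · exact hno (hl.all x hx (hc x hx))

/-- The running time of `scanBody`, executed for `k` centres, and of the rest of `listBody`. -/
def listBodyTime (k : ℕ) : ℕ :=
  (Cmd.assign 15 (.var 1 + 1)).time +
    (k * (scanBody.time + (Expr.var 11).cost + 10) + (Expr.var 11).cost + 10 + recordCmd.time)

/-- A round appends the least relevant number beyond `cur`, if there is one. The final alternative
records that either the list has grown or nothing is left. -/
theorem listBody_spec {Wd B m h NC cnt : ℕ} {cur : ℤ} {σ : State} (hB : 2 ≤ B)
    (hW : B ^ solverExp ≤ Wd) (hb : σ.Bdd B) (hm : σ.vars 1 = m) (hh : σ.vars 8 = h)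
    (h11 : σ.vars 11 = NC) (h13 : σ.vars 13 = cnt) (h14 : σ.vars 14 = cur) (h0 : 0 ≤ cur)
    (hcur : cur ≤ m) (hNC : NC ≤ B) (hmB : m + 1 ≤ B) (hcnt : cnt + 1 ≤ B)
    (hl : Listing (fun x => 1 ≤ x ∧ x ≤ m ∧ InBlocks (σ.arr 20) h NC x) (σ.arr 21) cnt cur) :
    Tr Wd listBody σ (listBodyTime NC) (fun σ' => σ'.Bdd B ∧
      ∃ (cnt' : ℕ) (cur' : ℤ), σ'.vars 13 = cnt' ∧ σ'.vars 14 = cur' ∧ 0 ≤ cur' ∧ cur' ≤ m ∧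
        Listing (fun x => 1 ≤ x ∧ x ≤ m ∧ InBlocks (σ.arr 20) h NC x) (σ'.arr 21) cnt' cur' ∧
        (cnt' = cnt + 1 ∧ (∃ x : ℤ, (1 ≤ x ∧ x ≤ m ∧ InBlocks (σ.arr 20) h NC x) ∧ cur < x) ∨
          cnt' = cnt ∧ ∀ x : ℤ, 1 ≤ x ∧ x ≤ m ∧ InBlocks (σ.arr 20) h NC x → x ≤ cur')) := by
  have hmB' : |((m : ℤ) + 1)| ≤ B := by exact_mod_cast abs_lt_of_nat hmB
  refine Tr.seq (Q := fun σ' => σ' = σ.setVar 15 (m + 1)) (Tr.block rfl hB hb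
    (fit hB hW (by unfold solverExp; omega)) (by simp [hm])) ?_
  rintro _ - rfl
  refine Tr.seq (Q := fun σ' => σ'.Bdd B ∧ cur < σ'.vars 15 ∧ σ'.vars 15 ≤ m + 1 ∧
      (σ'.vars 15 = m + 1 ∨ InBlocks (σ.arr 20) h NC (σ'.vars 15)) ∧
      ∀ x, cur < x → InBlocks (σ.arr 20) h NC x → σ'.vars 15 ≤ x ∨ m < x) ?_ ?_
  · refine Tr.forTo (n := NC) (T := scanBody.time) (fun k σ' => cur < σ'.vars 15 ∧
      σ'.vars 15 ≤ m + 1 ∧ (σ'.vars 15 = m + 1 ∨ InBlocks (σ.arr 20) h k (σ'.vars 15)) ∧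
      ∀ x, cur < x → InBlocks (σ.arr 20) h k x → σ'.vars 15 ≤ x ∨ m < x) hB
      (fit hB hW (wt_var_le 11)) hNC (by decide) ?_ (hb.setVar hmB') ?_ ?_
    · intro σ' hs
      rw [Expr.val_var, hs.1 11 (by decide)]
      simpa using h11
    · refine ⟨by simp; omega, by simp, by simp, ?_⟩
      rintro x - ⟨q, hq, -⟩
      omega
    · rintro k hk σ' hs hik hb' ⟨i1, i2, i3, i4⟩
      refine Tr.block rfl hB hb' (fit hB hW (by unfold solverExp; omega)) ?_
      have e8 : σ'.vars 8 = h := by rw [hs.1 8 (by decide)]; simpa using hh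
      have e14 : σ'.vars 14 = cur := by rw [hs.1 14 (by decide)]; simpa using h14
      have e20 : σ'.arr 20 = σ.arr 20 := by rw [hs.2 20 (by decide)]; rfl
      simp only [scanBody, nextE, Cmd.run_assign, Expr.val_ite, Test.holds_and, Test.holds_lt,
        Expr.val_max, Expr.val_add, Expr.val_sub, Expr.val_get, Expr.val_var, Expr.val_one, hik, e8,
        e14, e20, State.setVar_vars, if_true, show (15 : ℕ) ≠ 21 by decide, if_false]
      generalize σ'.vars 15 = L at i1 i2 i3 i4
      generalize hc : σ.arr 20 k = c
      have grow : ∀ x, InBlocks (σ.arr 20) h k x → InBlocks (σ.arr 20) h (k + 1) x :=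
        fun x ⟨q, hq, hx⟩ => ⟨q, by omega, hx⟩
      have shrink : ∀ x, InBlocks (σ.arr 20) h (k + 1) x →
          InBlocks (σ.arr 20) h k x ∨ c - h ≤ x ∧ x ≤ c + h := by
        rintro x ⟨q, hq, hx⟩
        rcases Nat.lt_succ_iff_lt_or_eq.1 hq with hq' | rfl
        · exact Or.inl ⟨q, hq', hx⟩
        · exact Or.inr (hc ▸ hx)
      split_ifs with hlt
      · refine ⟨hb'.setVar (abs_le_of_nonneg (by omega) (by omega)), by omega, by omega,
          Or.inr ⟨k, by omega, by rw [hc]; omega⟩, fun x hx hxb => ?_⟩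
        rcases shrink x hxb with hxb | hxb
        · rcases i4 x hx hxb with h' | h' <;> omega
        · omega
      · refine ⟨hb'.setVar (abs_le_of_nonneg (by omega) (by omega)), i1, i2,
          i3.imp_right (grow _), fun x hx hxb => ?_⟩
        rcases shrink x hxb with hxb | hxb
        · exact i4 x hx hxb
        · omega
  · rintro σ' hs ⟨hb', i1, i2, i3, i4⟩
    refine Tr.block rfl hB hb' (fit hB hW (by unfold solverExp; omega)) ?_
    have e1 : σ'.vars 1 = m := by rw [hs.1 1 (by decide)]; simpa using hm
    have e13 : σ'.vars 13 = cnt := by rw [hs.1 13 (by decide)]; simpa using h13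
    have e14 : σ'.vars 14 = cur := by rw [hs.1 14 (by decide)]; simpa using h14
    have e21 : σ'.arr 21 = σ.arr 21 := by rw [hs.2 21 (by decide)]; rfl
    simp only [recordCmd, Cmd.run_seq, Cmd.run_assign, Cmd.run_store, Expr.val_ite, Test.holds_lt,
      Expr.val_add, Expr.val_var, Expr.val_zero, Expr.val_one, State.setVar_vars,
      State.setArr_vars, e1, e13, e14, if_true, show (14 : ℕ) ≠ 13 by decide,
      show (13 : ℕ) ≠ 14 by decide, show (1 : ℕ) ≠ 13 by decide, show (15 : ℕ) ≠ 13 by decide,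
      if_false, State.setVar_arr]
    generalize hL : σ'.vars 15 = L at i1 i2 i3 i4
    by_cases hlt : L < m + 1
    · simp only [hlt, if_true]
      refine ⟨((hb'.setArr ?_).setVar ?_).setVar ?_, cnt + 1, L, by simp, rfl, by omega, by omega,
        ?_, Or.inl ⟨rfl, L, ⟨by omega, by omega, ?_⟩, i1⟩⟩
      · exact abs_le_of_nonneg (by omega) (by omega)
      · exact_mod_cast abs_lt_of_nat hcnt
      · exact abs_le_of_nonneg (by omega) (by omega)
      · have := hl.cons (x := L) ⟨by omega, by omega, by
          rcases i3 with i3 | i3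
          · omega
          · exact i3⟩ i1 (by
          rintro y ⟨-, hym, hyb⟩ hcy
          rcases i4 y hcy hyb with h' | h'
          · exact h'
          · omega)
        simpa [State.setArr, e21] using this
      · rcases i3 with i3 | i3
        · omega
        · exact i3
    · simp only [hlt, if_false]
      refine ⟨((hb'.setArr ?_).setVar ?_).setVar ?_, cnt, cur, rfl, rfl, h0, hcur, ?_,
        Or.inr ⟨rfl, ?_⟩⟩
      · simp
      · exact abs_lt_of_nat (by omega)
      · exact abs_le_of_nonneg h0 (by omega)
      · have : Function.update (σ.arr 21) (cnt : ℤ) 0 = σ.arr 21 := by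
          rw [← hl.rest cnt le_rfl, Function.update_eq_self]
        simpa [State.setArr, e21, this] using hl
      · rintro x ⟨hx1, hxm, hxb⟩
        by_contra! hlt'
        rcases i4 x hlt' hxb with h' | h' <;> omega

/-- There are as many rounds as the blocks have members, counted with multiplicity. If every round
appends a number, the list is full by counting; otherwise some round has found nothing left.
`Listing.complete` covers both cases. -/
theorem listCmd_spec {Wd B m h NC Bm : ℕ} {σ : State} (hB : 2 ≤ B) (hW : B ^ solverExp ≤ Wd)
    (hb : σ.Bdd B) (hm : σ.vars 1 = m) (hh : σ.vars 8 = h) (h10 : σ.vars 10 = Bm)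
    (h11 : σ.vars 11 = NC) (h12 : σ.vars 12 = (NC * (2 * h + 1) : ℕ)) (h13 : σ.vars 13 = 1)
    (h14 : σ.vars 14 = 0) (h21 : ∀ z, σ.arr 21 z = 0) (hmB : m + 1 ≤ B)
    (hNC : 2 * (NC * (2 * h + 1) + 1) ≤ B)
    (hS : Bm * Bm * Bm * (2 * (NC * (2 * h + 1) + 1)) ≤ B) :
    Tr Wd listCmd σ (NC * (2 * h + 1) * (listBodyTime NC + (Expr.var 12).cost + 10) +
        (Expr.var 12).cost + 10 + listFinish.time)
      (fun σ' => σ'.Bdd B ∧ ∃ (cnt : ℕ) (cur : ℤ), cnt ≤ NC * (2 * h + 1) + 1 ∧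
        σ'.vars 16 = (2 * cnt : ℕ) ∧ σ'.vars 17 = (Bm * Bm * Bm * (2 * cnt) : ℕ) ∧
        Listing (fun x => 1 ≤ x ∧ x ≤ m ∧ InBlocks (σ.arr 20) h NC x) (σ'.arr 21) cnt cur ∧
        ∀ x : ℤ, 1 ≤ x ∧ x ≤ m ∧ InBlocks (σ.arr 20) h NC x →
          ∃ i : ℕ, 1 ≤ i ∧ i < cnt ∧ σ'.arr 21 i = x) := by
  set T : ℤ → Prop := fun x => 1 ≤ x ∧ x ≤ m ∧ InBlocks (σ.arr 20) h NC x with hT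
  have hNCB : NC ≤ B := by nlinarith
  have loop := Tr.forTo (Wd := Wd) (n := NC * (2 * h + 1)) (T := listBodyTime NC) (i := 20)
    (e := .var 12) (c := listBody) (σ₀ := σ)
    (fun k σ' => ∃ (cnt : ℕ) (cur : ℤ), σ'.vars 13 = cnt ∧ σ'.vars 14 = cur ∧ 0 ≤ cur ∧ cur ≤ m ∧
      Listing T (σ'.arr 21) cnt cur ∧ cnt ≤ k + 1 ∧ (cnt = k + 1 ∨ ∀ x, T x → x ≤ cur)) hB
    (fit hB hW (wt_var_le 12)) (by omega) (by decide)
    (by intro σ' hs; rw [Expr.val_var, hs.1 12 (by decide)]; exact h12) hb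
    ⟨1, 0, by simpa using h13, by simpa using h14, le_rfl, by omega, by
      refine ⟨le_rfl, h21 _, h21 _, fun i j hij hj => by omega, fun i h1 h2 => by omega,
        fun x hx hx0 => ?_, fun i _ => h21 _⟩
      have := hx.1
      omega, by omega, by omega⟩ (by
      rintro k hk σ' hs - hb' ⟨cnt, cur, e13, e14, c0, cm, hl, hck, hor⟩
      have e20 : σ'.arr 20 = σ.arr 20 := hs.2 20 (by decide)
      have step := listBody_spec (Wd := Wd) (B := B) (m := m) (h := h) (NC := NC) (cnt := cnt)
        (cur := cur) (σ := σ') hB hW hb' (by rw [hs.1 1 (by decide), hm])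
        (by rw [hs.1 8 (by decide), hh]) (by rw [hs.1 11 (by decide), h11]) e13 e14 c0 cm hNCB hmB
        (by omega) (by rw [e20]; exact hl)
      refine step.mono le_rfl ?_
      rintro τ - ⟨hbτ, cnt', cur', f13, f14, c0', cm', hl', hor'⟩
      rw [e20] at hl' hor'
      refine ⟨hbτ, cnt', cur', by simpa using f13, by simpa using f14, c0', cm', hl', ?_, ?_⟩
      · rcases hor' with hor' | hor' <;> omega
      · rcases hor' with ⟨rfl, x, hx, hcx⟩ | ⟨rfl, hor'⟩
        · rcases hor with rfl | hor
          · exact Or.inl rfl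
          · exact absurd (hor x hx) (by omega)
        · exact Or.inr hor')
  refine Tr.seq loop ?_
  rintro σ' hs ⟨hb', cnt, cur, e13, e14, c0, cm, hl, hck, hor⟩
  refine Tr.block rfl hB hb' (fit hB hW (by unfold solverExp; omega)) ?_
  have e10 : σ'.vars 10 = Bm := by rw [hs.1 10 (by decide), h10]
  have hS' : Bm * Bm * Bm * (2 * cnt) ≤ B :=
    (Nat.mul_le_mul_left _ (by omega)).trans hS
  simp only [listFinish, Cmd.run_seq, Cmd.run_assign, Expr.val_mul, Expr.val_var, Expr.val_two,
    State.setVar_vars, e13, e10, if_true, show (10 : ℕ) ≠ 16 by decide,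
    show (16 : ℕ) ≠ 17 by decide, if_false]
  refine ⟨(hb'.setVar ?_).setVar ?_, cnt, cur, hck, by push_cast; rfl, by push_cast; rfl, hl, ?_⟩
  · exact_mod_cast abs_lt_of_nat (show 2 * cnt ≤ B by omega)
  · exact_mod_cast abs_lt_of_nat hS'
  · exact hl.complete (fun x hx => hx.2.2) hor

/-! ### The matrix of usable positions. -/

/-- The arguments of `Hit` and `wit` for job `j` and position `c`, as stored in the arrays. -/
def StHit (σ : State) (m : ℤ) (j c : ℕ) : Prop :=
  Hit m (σ.arr 14 j) (σ.arr 15 j) (if (c : ℤ) % 2 = 0 then σ.arr 16 j else σ.arr 17 j)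
    (if (c : ℤ) % 2 = 0 then σ.arr 17 j else σ.arr 16 j) (σ.arr 18 j) (σ.arr 19 j)
    (σ.arr 21 ((c : ℤ) / 2))

def stWit (σ : State) (m : ℤ) (j c : ℕ) : ℤ :=
  wit m (σ.arr 14 j) (σ.arr 15 j) (if (c : ℤ) % 2 = 0 then σ.arr 16 j else σ.arr 17 j)
    (if (c : ℤ) % 2 = 0 then σ.arr 17 j else σ.arr 16 j) (σ.arr 18 j) (σ.arr 21 ((c : ℤ) / 2))

theorem StHit.congr {σ σ' : State} {m : ℤ} {j c : ℕ} (h : ∀ a, 14 ≤ a → a ≤ 21 → σ'.arr a = σ.arr a) :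
    (StHit σ' m j c ↔ StHit σ m j c) ∧ stWit σ' m j c = stWit σ m j c := by
  simp only [StHit, stWit, h 14 (by omega) (by omega), h 15 (by omega) (by omega),
    h 16 (by omega) (by omega), h 17 (by omega) (by omega), h 18 (by omega) (by omega),
    h 19 (by omega) (by omega), h 21 (by omega) (by omega), and_self]

section
variable {σ : State} {m : ℤ} {j c : ℕ} (h1 : σ.vars 1 = m) (h20 : σ.vars 20 = j)
  (h21 : σ.vars 21 = c)

include h20 h21

theorem val_entryE : entryE.val σ = entry (σ.arr 14 j) (σ.arr 15 j)
    (if (c : ℤ) % 2 = 0 then σ.arr 16 j else σ.arr 17 j) (σ.arr 18 j)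
    (σ.arr 21 ((c : ℤ) / 2)) := by
  simp [entryE, entry, idxE, ownE, upT, h20, h21]

include h1

theorem val_lastStartE : lastStartE.val σ = lastStart m (σ.arr 14 j)
    (if (c : ℤ) % 2 = 0 then σ.arr 17 j else σ.arr 16 j) (entryE.val σ) := by
  simp only [lastStartE, lastStart, otherE, upT, Expr.val_min, Expr.val_div, Expr.val_sub,
    Expr.val_ite, Test.holds_eq, Expr.val_mod, Expr.val_var, Expr.val_get, Expr.val_two,
    Expr.val_zero, h1, h20, h21]

theorem val_witE : witE.val σ = stWit σ m j c := by
  simp only [stWit, wit, ← val_entryE h20 h21, escape]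
  simp only [witE, Expr.val_ite, Test.holds_and, Test.holds_not, Test.holds_lt, Expr.val_add,
    Expr.val_mul, Expr.val_one, val_lastStartE h1 h20 h21, Expr.val_get, Expr.val_var, h20, h1,
    otherE, upT, Test.holds_eq, Expr.val_mod, h21, Expr.val_two, Expr.val_zero, not_lt]

theorem holds_hitT : hitT.holds σ ↔ StHit σ m j c := by
  have hw : stWit σ m j c = wit m (σ.arr 14 j) (σ.arr 15 j)
    (if (c : ℤ) % 2 = 0 then σ.arr 16 j else σ.arr 17 j)
    (if (c : ℤ) % 2 = 0 then σ.arr 17 j else σ.arr 16 j) (σ.arr 18 j) (σ.arr 21 ((c : ℤ) / 2)) := rfl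
  simp only [StHit, Hit, ← hw, ← val_witE h1 h20 h21]
  simp only [hitT, Test.holds_and, Test.holds_not, Test.holds_lt, Test.holds_eq, Expr.val_add,
    Expr.val_mul, Expr.val_one, Expr.val_get, Expr.val_var, h20, h1, idxE, ownE, upT, Expr.val_ite,
    Expr.val_mod, Expr.val_div, h21, Expr.val_two, Expr.val_zero, not_lt, not_and_or, not_not,
    not_le]

end

theorem cell_inj {N j k c d : ℕ} (hc : c < N) (hd : d < N) :
    (j : ℤ) * N + c = k * N + d ↔ j = k ∧ c = d := by
  constructor
  · intro h
    have h' : j * N + c = k * N + d := by exact_mod_cast h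
    have e1 : (j * N + c) / N = j := by
      rw [mul_comm, Nat.mul_add_div (by omega), Nat.div_eq_of_lt hc, add_zero]
    have e2 : (k * N + d) / N = k := by
      rw [mul_comm, Nat.mul_add_div (by omega), Nat.div_eq_of_lt hd, add_zero]
    have : j = k := by rw [← e1, ← e2, h']
    subst this
    omega
  · rintro ⟨rfl, rfl⟩
    rfl

open Classical in
/-- The hit matrix is filled in up to position `c` of row `k`. -/
def HitsDone (P : ℕ → ℕ → Prop) (u : ℕ → ℕ → ℤ) (N k c : ℕ) (σ : State) : Prop :=
  (∀ j x : ℕ, x < N → j < k ∨ j = k ∧ x < c →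
    σ.arr 22 ((j : ℤ) * N + x) = (if P j x then 1 else 0) ∧
    (P j x → σ.arr 23 ((j : ℤ) * N + x) = u j x) ∧
    (P j x → ∃ y : ℕ, x ≤ y ∧ (j < k ∧ y < N ∨ j = k ∧ y < c) ∧ P j y ∧ σ.arr 24 j = y))

theorem abs_le_of_between {r x e : ℤ} {B : ℕ} (hr : |r| ≤ B) (he : |e| ≤ B) (h1 : r ≤ x)
    (h2 : x ≤ e) : |x| ≤ B := by
  rw [abs_le] at *
  omega

open Classical in
theorem hitBody_run {B N n k c : ℕ} {m : ℤ} {σ₀ σ : State} (hB : 2 ≤ B) (hb : σ.Bdd B)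
    (h1 : σ.vars 1 = m) (h16 : σ.vars 16 = N) (h20 : σ.vars 20 = k) (h21 : σ.vars 21 = c)
    (hk : k < n) (hc : c < N) (hN : N ≤ B) (hD : ∀ j < n, 0 < σ₀.arr 14 (j : ℕ))
    (ha : ∀ a, 14 ≤ a → a ≤ 21 → σ.arr a = σ₀.arr a)
    (hd : HitsDone (StHit σ₀ m) (stWit σ₀ m) N k c σ) :
    (hitBody.run σ).Bdd B ∧ HitsDone (StHit σ₀ m) (stWit σ₀ m) N k (c + 1) (hitBody.run σ) := by
  have ht : ∀ τ : State, τ.vars = σ.vars → (∀ a, 14 ≤ a → a ≤ 21 → τ.arr a = σ.arr a) →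
      (hitT.holds τ ↔ StHit σ₀ m k c) ∧ witE.val τ = stWit σ₀ m k c := by
    intro τ hτ hτ'
    have cg := StHit.congr (σ := σ₀) (σ' := τ) (m := m) (j := k) (c := c)
      fun a l u => (hτ' a l u).trans (ha a l u)
    rw [holds_hitT (by rw [hτ, h1]) (by rw [hτ, h20]) (by rw [hτ, h21]),
      val_witE (by rw [hτ, h1]) (by rw [hτ, h20]) (by rw [hτ, h21])]
    exact cg
  have hcell : ∀ τ : State, τ.vars = σ.vars → cellE.val τ = (k : ℤ) * N + c := by
    intro τ hτ
    simp [cellE, hτ, h16, h20, h21]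
  -- A witness is stored only in case of a hit, when it lies between the release time and the latest
  -- start, which are stored values already.
  have hwB : StHit σ₀ m k c → |stWit σ₀ m k c| ≤ B := by
    intro hh
    have b18 := hb.2 18 k
    have b19 := hb.2 19 k
    rw [ha 18 (by omega) (by omega)] at b18
    rw [ha 19 (by omega) (by omega)] at b19
    refine abs_le_of_between b18 b19 ?_ hh.2.2.1
    have e1 : ∀ D w a i : ℤ, σ₀.arr 18 k ≤ entry D w a (σ₀.arr 18 k) i :=
      fun D w a i => (le_max_left _ _).trans (le_max_left _ _)
    exact (e1 _ _ _ _).trans (le_escape (hD k hk))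
  set τ1 := σ.setArr 22 ((k : ℤ) * N + c) (if StHit σ₀ m k c then 1 else 0) with hτ1
  set τ2 := τ1.setArr 23 ((k : ℤ) * N + c) (if StHit σ₀ m k c then stWit σ₀ m k c else 0) with hτ2
  have hrun : hitBody.run σ = τ2.setArr 24 k (if StHit σ₀ m k c then c else σ.arr 24 k) := by
    have a1 : ∀ a, 14 ≤ a → a ≤ 21 → τ1.arr a = σ.arr a := by
      intro a l u
      funext z
      simp [hτ1, show a ≠ 22 by omega]
    have a2 : ∀ a, 14 ≤ a → a ≤ 21 → τ2.arr a = σ.arr a := by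
      intro a l u
      funext z
      simp [hτ2, hτ1, show a ≠ 22 by omega, show a ≠ 23 by omega]
    simp only [hitBody, Cmd.run_seq, Cmd.run_store, Expr.val_ite, Expr.val_one, Expr.val_zero,
      hcell σ rfl, (ht σ rfl fun _ _ _ => rfl).1]
    rw [← hτ1]
    simp only [hcell τ1 rfl, (ht τ1 rfl a1).1, (ht τ1 rfl a1).2]
    rw [← hτ2]
    simp only [(ht τ2 rfl a2).1, Expr.val_var, Expr.val_get]
    have v20 : τ2.vars 20 = k := h20
    have v21 : τ2.vars 21 = c := h21
    rw [v20, v21]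
    simp [hτ2, hτ1]
  rw [hrun]
  constructor
  · refine ((hb.setArr ?_).setArr ?_).setArr ?_
    · split_ifs
      · rw [abs_one]; exact_mod_cast (by omega : 1 ≤ B)
      · simp
    · split_ifs with hh
      · exact hwB hh
      · simp
    · split_ifs
      · exact abs_lt_of_nat (by omega)
      · exact hb.2 _ _
  · intro j x hx hjx
    simp only [hτ2, hτ1, State.setArr_arr, cell_inj hx hc, show (22 : ℕ) ≠ 24 by decide,
      show (22 : ℕ) ≠ 23 by decide, show (23 : ℕ) ≠ 24 by decide, show (24 : ℕ) ≠ 23 by decide,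
      show (24 : ℕ) ≠ 22 by decide, show (23 : ℕ) ≠ 22 by decide, false_and, if_false, true_and,
      Nat.cast_inj]
    by_cases hjk : j = k
    · subst hjk
      by_cases hxc : x = c
      · subst hxc
        simp only [and_self, if_true]
        refine ⟨trivial, fun hP => by simp [hP], fun hP => ⟨x, le_rfl, Or.inr ⟨trivial, by omega⟩, hP, by simp [hP]⟩⟩
      · obtain ⟨d1, d2, d3⟩ := hd j x hx (Or.inr ⟨rfl, by omega⟩)
        simp only [hxc, and_false, if_false]
        refine ⟨d1, d2, fun hP => ?_⟩
        by_cases hh : StHit σ₀ m j c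
        · exact ⟨c, by omega, Or.inr ⟨trivial, by omega⟩, hh, by simp [hh]⟩
        · obtain ⟨y, y1, y2, y3, y4⟩ := d3 hP
          exact ⟨y, y1, Or.inr ⟨trivial, by omega⟩, y3, by simp [hh, y4]⟩
    · obtain ⟨d1, d2, d3⟩ := hd j x hx (Or.inl (by omega))
      simp only [hjk, false_and, if_false]
      refine ⟨d1, d2, fun hP => ?_⟩
      obtain ⟨y, y1, y2, y3, y4⟩ := d3 hP
      exact ⟨y, y1, by omega, y3, y4⟩

theorem hitCmd_spec {Wd B N n : ℕ} {m : ℤ} {σ : State} (hB : 2 ≤ B) (hW : B ^ solverExp ≤ Wd)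
    (hb : σ.Bdd B) (h0 : σ.vars 0 = n) (h1 : σ.vars 1 = m) (h16 : σ.vars 16 = N)
    (hn : n ≤ B) (hN : N ≤ B) (hD : ∀ j < n, 0 < σ.arr 14 (j : ℕ)) :
    Tr Wd hitCmd σ (n * (N * (hitBody.time + (Expr.var 16).cost + 10) + (Expr.var 16).cost + 10 +
        (Expr.var 0).cost + 10) + (Expr.var 0).cost + 10)
      (fun σ' => σ'.Bdd B ∧ HitsDone (StHit σ m) (stWit σ m) N n 0 σ') := by
  refine Tr.forTo (fun k σ' => HitsDone (StHit σ m) (stWit σ m) N k 0 σ') hB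
    (fit hB hW (wt_var_le 0)) hn (by decide)
    (by intro σ' hs; rw [Expr.val_var, hs.1 0 (by decide)]; exact h0) hb
    (by intro j x hx h; omega) ?_
  intro k hk σ' hs h20 hb' hd
  have inner := Tr.forTo (Wd := Wd) (n := N) (T := hitBody.time) (i := 21) (e := .var 16)
    (c := hitBody) (σ₀ := σ') (fun c τ => HitsDone (StHit σ m) (stWit σ m) N k c τ) hB
    (fit hB hW (wt_var_le 16)) hN (by decide)
    (by intro τ hτ; rw [Expr.val_var, hτ.1 16 (by decide), hs.1 16 (by decide)]; exact h16) hb' hd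
    (by
      intro c hc τ hτ h21 hbτ hdτ
      have hr := hitBody_run (σ₀ := σ) (σ := τ) (m := m) hB hbτ
        (by rw [hτ.1 1 (by decide), hs.1 1 (by decide), h1])
        (by rw [hτ.1 16 (by decide), hs.1 16 (by decide), h16])
        (by rw [hτ.1 20 (by decide), h20]) h21 hk hc hN hD
        (by
          intro a l u
          have m1 : ∀ a < 22, 14 ≤ a → a ∉ (Cmd.forTo 21 (.var 16) hitBody).wa := by decide
          have m2 : ∀ a < 22, 14 ≤ a →
            a ∉ (Cmd.forTo 20 (.var 0) (Cmd.forTo 21 (.var 16) hitBody)).wa := by decide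
          rw [hτ.2 a (m1 a (by omega) l), hs.2 a (m2 a (by omega) l)]) hdτ
      exact Tr.block rfl hB hbτ (fit hB hW (by unfold solverExp; omega)) hr)
  refine inner.mono le_rfl ?_
  rintro τ - ⟨hbτ, hdτ⟩
  refine ⟨hbτ, ?_⟩
  intro j x hx hjx
  obtain ⟨d1, d2, d3⟩ := hdτ j x hx (by omega)
  refine ⟨d1, d2, fun hP => ?_⟩
  obtain ⟨y, y1, y2, y3, y4⟩ := d3 hP
  exact ⟨y, y1, by omega, y3, y4⟩

/-! ### Evaluation of signature codes, and the basic steps on the table. -/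

/-- The code of the signature that follows if `q` is twice the code of a signature plus the choice
at position `t`. -/
def nextCode (W N t q : ℕ) : ℕ :=
  ((decode (2 ^ W) N (q / 2)).next W t (q % 2)).code (2 ^ W) N

section
variable {σ : State} {W N : ℕ}

theorem val_d0 (e : Expr) {c : ℕ} (h10 : σ.vars 10 = (2 ^ W : ℕ)) (h16 : σ.vars 16 = N)
    (he : e.val σ = c) : (d0 e).val σ = (decode (2 ^ W) N c).m0 := by
  simp only [d0, Expr.val_div, he, Expr.val_var, h10, h16, decode]
  push_cast
  rfl

theorem val_d1 (e : Expr) {c : ℕ} (h10 : σ.vars 10 = (2 ^ W : ℕ)) (h16 : σ.vars 16 = N)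
    (he : e.val σ = c) : (d1 e).val σ = (decode (2 ^ W) N c).m1 := by
  simp only [d1, Expr.val_div, Expr.val_mod, he, Expr.val_var, h10, h16, decode]
  push_cast
  rfl

theorem val_d2 (e : Expr) {c : ℕ} (h10 : σ.vars 10 = (2 ^ W : ℕ)) (h16 : σ.vars 16 = N)
    (he : e.val σ = c) : (d2 e).val σ = (decode (2 ^ W) N c).m2 := by
  simp only [d2, Expr.val_div, Expr.val_mod, he, Expr.val_var, h10, h16, decode]
  push_cast
  rfl

theorem val_dp (e : Expr) {c : ℕ} (h16 : σ.vars 16 = N)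
    (he : e.val σ = c) : (dp e).val σ = (decode (2 ^ W) N c).p := by
  simp only [dp, Expr.val_mod, he, Expr.val_var, h16, decode]
  push_cast
  rfl

/-- Array `12` is `0` outside `[0, W)`, which takes care of the case distinctions in `Sig.next`. The
hypothesis `hg` is needed because `t - W` is truncated there and not in the program; it holds for
signatures of actual sets (`Rep.le_of_top`). -/
theorem val_codeE {t q : ℕ} (h9 : σ.vars 9 = W) (h10 : σ.vars 10 = (2 ^ W : ℕ))
    (h16 : σ.vars 16 = N) (h12 : ∀ z, σ.arr 12 z = pw W z) (h20 : σ.vars 20 = t)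
    (h21 : σ.vars 21 = q)
    (hg : 2 ^ W ≤ 2 * (decode (2 ^ W) N (q / 2)).m1 → W ≤ t) :
    codeE.val σ = nextCode W N t q := by
  have hs : (Expr.var 21 / 2 : Expr).val σ = (q / 2 : ℕ) := by simp [h21]
  have hβ : (Expr.mod (Expr.var 21) 2).val σ = (q % 2 : ℕ) := by simp [h21]
  have e0 := val_d0 _ h10 h16 hs
  have e1 := val_d1 _ h10 h16 hs
  have e2 := val_d2 _ h10 h16 hs
  have ep := val_dp (W := W) _ h16 hs
  simp only [codeE, Expr.val_add, Expr.val_mul, e0, hβ, Expr.val_var, h10, Expr.val_mod, e1,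
    Expr.val_two, Expr.val_ite, Test.holds_not, Test.holds_lt, e2, ep, Expr.val_get, Expr.val_sub,
    Expr.val_one, h16, h9, h20, h12, nextCode, Sig.code, Sig.next]
  generalize decode (2 ^ W) N (q / 2) = s at hg
  have c1 : ¬ (2 * (s.m1 : ℤ) < (2 ^ W : ℕ)) ↔ 2 ^ W ≤ 2 * s.m1 := by
    rw [not_lt]
    exact_mod_cast Iff.rfl
  simp only [c1]
  push_cast
  congr 1
  · congr 1
    congr 1
    · congr 1
      congr 1
      · unfold pw
        by_cases htW : t < W
        · rw [if_pos ⟨by omega, by exact_mod_cast htW⟩, if_pos htW]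
          simp
        · rw [if_neg (by omega), if_neg htW]
          simp
    · split_ifs with ho hg2
      · unfold pw
        have := hg ho
        rw [if_pos (by omega)]
        congr 3
        omega
      · unfold pw
        have := hg ho
        rw [if_neg (by omega)]
        simp
      · rfl
  · split_ifs with ho
    · have := hg ho
      omega
    · rfl

end

/-- The bits that the body of the search loop inspects. -/
def SeenBit (hm : ℤ → ℤ) (W N t j : ℕ) (s : Sig) (k : ℕ) : Prop :=
  (s.m0 / pw W k % 2 * hm (j * N + k) ≠ 0 ∨ s.m1 / pw W k % 2 * hm (j * N + (t - k)) ≠ 0) ∨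
    s.m2 / pw W k % 2 * hm (j * N + (s.p - 1 - k)) ≠ 0

theorem pw_nat {W k : ℕ} (hk : k < W) : pw W k = (2 ^ k : ℕ) := by
  rw [pw, if_pos ⟨by omega, by exact_mod_cast hk⟩]
  simp

theorem bit_eq {W k : ℕ} (hk : k < W) (M : ℕ) :
    (M : ℤ) / pw W k % 2 = if M.testBit k = true then 1 else 0 := by
  rw [pw_nat hk, Nat.testBit_eq_decide_div_mod_eq]
  have : ((M : ℤ) / (2 ^ k : ℕ) % 2) = (M / 2 ^ k % 2 : ℕ) := by push_cast; rfl
  rw [this]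
  rcases Nat.mod_two_eq_zero_or_one (M / 2 ^ k) with h | h <;> simp [h]

/-- The representation property guarantees that a set bit refers to a position that is not negative,
so the integer indices of the program agree with truncated subtraction. -/
theorem exists_seenBit_iff {hm : ℤ → ℤ} {W N t j : ℕ} {s : Sig} {H : Finset ℕ}
    (h : Rep W (t + 1) H s) :
    (hm (j * N + s.p) ≠ 0 ∨ ∃ k < W, SeenBit hm W N t j s k) ↔
      ∃ x : ℕ, s.Remembers W (t + 1) x ∧ hm (j * N + x) ≠ 0 := by
  constructor
  · rintro (h0 | ⟨k, hk, hb⟩)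
    · exact ⟨s.p, Or.inl rfl, h0⟩
    · simp only [SeenBit, bit_eq hk, mul_ne_zero_iff, ne_eq, ite_eq_right_iff, one_ne_zero,
        imp_false, not_not] at hb
      rcases hb with (hb | hb) | hb
      · exact ⟨k, Or.inr ⟨k, hk, Or.inl ⟨hb.1, rfl⟩⟩, hb.2⟩
      · have := ((h.bit1 k hk).1 hb.1).1
        refine ⟨t - k, Or.inr ⟨k, hk, Or.inr (Or.inl ⟨hb.1, this, by omega⟩)⟩, ?_⟩
        rw [Nat.cast_sub (by omega)]
        exact hb.2
      · have := (h.bit2 k hb.1).1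
        refine ⟨s.p - 1 - k, Or.inr ⟨k, hk, Or.inr (Or.inr ⟨hb.1, this, by omega⟩)⟩, ?_⟩
        rw [Nat.cast_sub (by omega), Nat.cast_sub (by omega)]
        exact hb.2
  · rintro ⟨x, rfl | ⟨k, hk, hx | hx | hx⟩, hA⟩
    · exact Or.inl hA
    · obtain ⟨hb, rfl⟩ := hx
      exact Or.inr ⟨x, hk, Or.inl (Or.inl (by simp [bit_eq hk, hb, hA]))⟩
    · obtain ⟨hb, hkt, rfl⟩ := hx
      refine Or.inr ⟨k, hk, Or.inl (Or.inr ?_)⟩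
      rw [bit_eq hk, if_pos hb, one_mul]
      convert hA using 4
      omega
    · obtain ⟨hb, hkp, rfl⟩ := hx
      refine Or.inr ⟨k, hk, Or.inr ?_⟩
      rw [bit_eq hk, if_pos hb, one_mul]
      convert hA using 4
      omega

/-- The first and the last command of `pruneBody`. -/
def seenInit : Cmd := .assign 23 (rowE (dp (.var 22)))
def pruneStore : Cmd := .store 25 pruneE (.ite (.eq (.var 23) 0) 0 (.get 25 pruneE))

def pruneTime (W : ℕ) : ℕ :=
  seenInit.time + (W * (seenBody.time + (Expr.var 9).cost + 10) + (Expr.var 9).cost + 10 +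
    pruneStore.time)

open Classical in
theorem pruneBody_spec {Wd B W N S t j c : ℕ} {σ : State} (hB : 2 ≤ B) (hW : B ^ solverExp ≤ Wd)
    (hb : σ.Bdd B) (h9 : σ.vars 9 = W) (h10 : σ.vars 10 = (2 ^ W : ℕ)) (h16 : σ.vars 16 = N)
    (h17 : σ.vars 17 = S) (h12 : ∀ z, σ.arr 12 z = pw W z) (h20 : σ.vars 20 = t)
    (h21 : σ.vars 21 = j) (h22 : σ.vars 22 = c) (hWB : W ≤ B) :
    Tr Wd pruneBody σ (pruneTime W) (fun σ' => σ'.Bdd B ∧ σ'.arr 25 =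
      Function.update (σ.arr 25) ((t + 1) * S + c)
        (if σ.arr 22 (j * N + (decode (2 ^ W) N c).p) ≠ 0 ∨
          ∃ k < W, SeenBit (σ.arr 22) W N t j (decode (2 ^ W) N c) k then
            σ.arr 25 ((t + 1) * S + c) else 0)) := by
  have row (e : Expr) (τ : State) (hv : τ.vars 21 = j) (hv' : τ.vars 16 = N)
      (ha : τ.arr 22 = σ.arr 22) : (rowE e).val τ = σ.arr 22 (j * N + e.val τ) := by
    simp [rowE, hv, hv', ha]
  refine Tr.seq (Q := fun σ' => σ' = σ.setVar 23 (σ.arr 22 (j * N + (decode (2 ^ W) N c).p)))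
    (Tr.block rfl hB hb (fit hB hW (by unfold solverExp; omega)) ?_) ?_
  · rw [Cmd.run_assign, row _ σ h21 h16 rfl, val_dp (W := W) (.var 22) h16 h22]
  rintro _ - rfl
  refine Tr.seq (Q := fun σ' => σ'.Bdd B ∧ (σ'.vars 23 ≠ 0 ↔
    (σ.arr 22 (j * N + (decode (2 ^ W) N c).p) ≠ 0 ∨
      ∃ k < W, SeenBit (σ.arr 22) W N t j (decode (2 ^ W) N c) k))) ?_ ?_
  · refine Tr.forTo (n := W) (T := seenBody.time) (fun k σ' => (σ'.vars 23 ≠ 0 ↔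
      (σ.arr 22 (j * N + (decode (2 ^ W) N c).p) ≠ 0 ∨
        ∃ i < k, SeenBit (σ.arr 22) W N t j (decode (2 ^ W) N c) i))) hB
      (fit hB hW (wt_var_le 9)) hWB (by decide) ?_ (hb.setVar (hb.2 _ _)) ?_ ?_
    · intro τ hs
      rw [Expr.val_var, hs.1 9 (by decide)]
      exact h9
    · simp
    · intro k hk τ hs h26 hbτ ih
      have v9 : τ.vars 9 = W := by rw [hs.1 9 (by decide)]; exact h9
      have v10 : τ.vars 10 = (2 ^ W : ℕ) := by rw [hs.1 10 (by decide)]; exact h10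
      have v16 : τ.vars 16 = N := by rw [hs.1 16 (by decide)]; exact h16
      have v20 : τ.vars 20 = t := by rw [hs.1 20 (by decide)]; exact h20
      have v21 : τ.vars 21 = j := by rw [hs.1 21 (by decide)]; exact h21
      have v22 : (Expr.var 22).val τ = c := by
        rw [Expr.val_var, hs.1 22 (by decide)]; exact h22
      have a22 : τ.arr 22 = σ.arr 22 := by rw [hs.2 22 (by decide)]; rfl
      have a12 : τ.arr 12 = σ.arr 12 := by rw [hs.2 12 (by decide)]; rfl
      refine Tr.block rfl hB hbτ (fit hB hW (by unfold solverExp; omega)) ?_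
      simp only [seenBody, Cmd.run_assign, Expr.val_ite, Test.holds_and, Test.holds_eq,
        Expr.val_mul, bitE, Expr.val_mod, Expr.val_div, val_d0 _ v10 v16 v22, val_d1 _ v10 v16 v22,
        val_d2 _ v10 v16 v22, val_dp (W := W) _ v16 v22, row _ τ v21 v16 a22, Expr.val_get, a12,
        h12, Expr.val_sub, Expr.val_var, h26, v20, Expr.val_zero, Expr.val_one, Expr.val_two,
        State.setVar_vars, show (23 : ℕ) ≠ 26 by decide, if_true, if_false]
      refine ⟨hbτ.setVar ?_, ?_⟩
      · split_ifs
        · simp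
        · rw [abs_one]; exact_mod_cast (by omega : 1 ≤ B)
      · have e : (∃ i < k + 1, SeenBit (σ.arr 22) W N t j (decode (2 ^ W) N c) i) ↔
            (∃ i < k, SeenBit (σ.arr 22) W N t j (decode (2 ^ W) N c) i) ∨
              SeenBit (σ.arr 22) W N t j (decode (2 ^ W) N c) k := by
          simp only [Nat.lt_succ_iff_lt_or_eq, or_and_right, exists_or, exists_eq_left]
        rw [e, ← or_assoc, ← ih]
        simp only [SeenBit]
        split_ifs with hif
        · simp [hif]
        · simp only [ne_eq, one_ne_zero, not_false_eq_true, true_iff]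
          tauto
  · rintro τ hs ⟨hbτ, hif⟩
    refine Tr.block rfl hB hbτ (fit hB hW (by unfold solverExp; omega)) ?_
    have v17 : τ.vars 17 = S := by rw [hs.1 17 (by decide)]; exact h17
    have v20 : τ.vars 20 = t := by rw [hs.1 20 (by decide)]; exact h20
    have v22 : τ.vars 22 = c := by rw [hs.1 22 (by decide)]; exact h22
    have a25 : τ.arr 25 = σ.arr 25 := by rw [hs.2 25 (by decide)]; rfl
    have hp : pruneE.val τ = (t + 1) * S + c := by simp [pruneE, v17, v20, v22]
    simp only [Cmd.run_store, Expr.val_ite, Test.holds_eq, Expr.val_var, Expr.val_zero,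
      Expr.val_get, hp, a25]
    simp only [← hif]
    constructor
    · refine hbτ.setArr ?_
      split_ifs
      · simp
      · exact hb.2 _ _
    · simp only [State.setArr, Function.update_self, a25]
      congr 1
      by_cases h0 : τ.vars 23 = 0 <;> simp [h0]

/-- If the source entry is empty, its code need not belong to any set and the target index is not
controlled. The two stores then only write back what they read, so the state is unchanged. -/
theorem relaxBody_run {W N S t q : ℕ} {σ : State} (h9 : σ.vars 9 = W)
    (h10 : σ.vars 10 = (2 ^ W : ℕ)) (h16 : σ.vars 16 = N) (h17 : σ.vars 17 = S)
    (h12 : ∀ z, σ.arr 12 z = pw W z) (h20 : σ.vars 20 = t) (h21 : σ.vars 21 = q)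
    (hg : σ.arr 25 (t * S + (q / 2 : ℕ)) ≠ 0 →
      2 ^ W ≤ 2 * (decode (2 ^ W) N (q / 2)).m1 → W ≤ t) :
    (σ.arr 25 (t * S + (q / 2 : ℕ)) ≠ 0 → σ.arr 25 ((t + 1) * S + nextCode W N t q) ≠ 0 ∧
      σ.arr 25 ((t + 1) * S + nextCode W N t q) ≤ σ.arr 25 (t * S + (q / 2 : ℕ)) + (q % 2 : ℕ)) ∧
      relaxBody.run σ = σ ∨
    σ.arr 25 (t * S + (q / 2 : ℕ)) ≠ 0 ∧
      (σ.arr 25 ((t + 1) * S + nextCode W N t q) = 0 ∨ σ.arr 25 (t * S + (q / 2 : ℕ)) + (q % 2 : ℕ) <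
        σ.arr 25 ((t + 1) * S + nextCode W N t q)) ∧
      relaxBody.run σ = (σ.setArr 26 ((t + 1) * S + nextCode W N t q) q).setArr 25
        ((t + 1) * S + nextCode W N t q) (σ.arr 25 (t * S + (q / 2 : ℕ)) + (q % 2 : ℕ)) := by
  have same : ∀ (τ : State) (a : ℕ) (i : ℤ), τ.setArr a i (τ.arr a i) = τ := by
    intro τ a i
    simp [State.setArr]
  have hsrc : ∀ τ : State, τ.vars = σ.vars → τ.arr 25 = σ.arr 25 →
      srcE.val τ = σ.arr 25 (t * S + (q / 2 : ℕ)) := by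
    intro τ h1 h2
    simp [srcE, h1, h2, h20, h17, h21]
  have htgt : ∀ τ : State, τ.vars = σ.vars → τ.arr 12 = σ.arr 12 → tgtE.val τ = tgtE.val σ := by
    intro τ h1 h2
    have r : ∀ a ∈ tgtE.ra, a = 12 := by decide
    exact tgtE.val_congr (fun x _ => by rw [h1]) fun a ha => by rw [r a ha, h2]
  have hbet : ∀ τ : State, τ.vars = σ.vars → τ.arr 12 = σ.arr 12 → τ.arr 25 = σ.arr 25 →
      (betterT.holds τ ↔ betterT.holds σ) := by
    intro τ h1 h2 h3
    simp only [betterT, Test.holds_and, Test.holds_not, Test.holds_eq, Test.holds_lt,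
      hsrc τ h1 h3, hsrc σ rfl rfl, Expr.val_get, htgt τ h1 h2, h3, Expr.val_add, Expr.val_mod,
      Expr.val_var, h1, Expr.val_two, Expr.val_zero]
  have hβ : σ.vars 21 % 2 = (q % 2 : ℕ) := by simp [h21]
  have htgt' : σ.arr 25 (t * S + (q / 2 : ℕ)) ≠ 0 →
      tgtE.val σ = (t + 1) * S + nextCode W N t q := by
    intro hne
    have hcode := val_codeE h9 h10 h16 h12 h20 h21 (hg hne)
    simp [tgtE, h20, h17, hcode]
  by_cases hbt : betterT.holds σ
  · right
    have hne : σ.arr 25 (t * S + (q / 2 : ℕ)) ≠ 0 := by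
      rw [← hsrc σ rfl rfl]
      exact hbt.1
    have hidx := htgt' hne
    have hb2 := hbt
    simp only [betterT, Test.holds_and, Test.holds_not, Test.holds_eq, Test.holds_lt,
      hsrc σ rfl rfl, Expr.val_get, hidx, Expr.val_add, Expr.val_mod, Expr.val_var, Expr.val_two,
      Expr.val_zero, hβ] at hb2
    refine ⟨hne, by tauto, ?_⟩
    set τ := σ.setArr 26 ((t + 1) * S + nextCode W N t q) q with hτ
    have f1 : τ.arr 12 = σ.arr 12 := by funext z; simp [hτ]
    have f2 : τ.arr 25 = σ.arr 25 := by funext z; simp [hτ]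
    simp only [relaxBody, Cmd.run_seq, Cmd.run_store, Expr.val_ite, if_pos hbt, hidx, Expr.val_var,
      h21]
    rw [← hτ]
    simp only [htgt τ rfl f1, hidx, if_pos ((hbet τ rfl f1 f2).2 hbt), Expr.val_add,
      hsrc τ rfl f2, Expr.val_mod, Expr.val_var, Expr.val_two]
    rw [show τ.vars 21 % 2 = (q % 2 : ℕ) from hβ]
  · left
    refine ⟨fun hne => ?_, ?_⟩
    · have hidx := htgt' hne
      simp only [betterT, Test.holds_and, Test.holds_not, Test.holds_eq, Test.holds_lt,
        hsrc σ rfl rfl, Expr.val_get, hidx, Expr.val_add, Expr.val_mod, Expr.val_var, Expr.val_two,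
        Expr.val_zero, hβ, not_and, not_lt] at hbt
      have := hbt hne
      tauto
    simp only [relaxBody, Cmd.run_seq, Cmd.run_store, Expr.val_ite, if_neg hbt, Expr.val_get, same]

/-! ### Dynamic programming -/

/-- What is known about the possible positions `A j` of job `j`, where `L j` is the last one. -/
structure Rows (n N W : ℕ) (A : ℕ → ℕ → Prop) (L : ℕ → ℕ) : Prop where
  pos : 1 ≤ W
  lt : ∀ j < n, L j < N
  last : ∀ j < n, A j (L j)
  le : ∀ j < n, ∀ x, A j x → x ≤ L j
  zero : ∀ j < n, ¬ A j 0
  loc : ∀ j < n, Local W (L j + 1) (A j)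

/-- All jobs that have to be decided before `t` are hit. -/
def Valid (n : ℕ) (A : ℕ → ℕ → Prop) (L : ℕ → ℕ) (t : ℕ) (H : Finset ℕ) : Prop :=
  ∀ j < n, L j < t → ∃ x ∈ H, A j x

/-- The code of the signature at time `t`. -/
def cd (W N : ℕ) (H : Finset ℕ) (t : ℕ) : ℕ := (sigOf W H t).code (2 ^ W) N

/-- The set `H` can be read off from the table of choices `P`. -/
def Trace (P : ℤ → ℤ) (S : ℕ) : ℕ → ℕ → Finset ℕ → Prop
  | 0, _, H => H = ∅
  | t + 1, c, H => ∃ (q : ℕ) (H' : Finset ℕ), P ((t + 1 : ℕ) * S + c) = q ∧ q / 2 < S ∧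
      Trace P S t (q / 2) H' ∧ H = if q % 2 = 1 then insert t H' else H'

theorem Trace.congr {P P' : ℤ → ℤ} {S t c : ℕ} {H : Finset ℕ} (h : Trace P S t c H) (hc : c < S)
    (hP : ∀ z < (t + 1 : ℤ) * S, P' z = P z) : Trace P' S t c H := by
  induction t generalizing c H with
  | zero => exact h
  | succ t ih =>
    obtain ⟨q, H', h1, h2, h3, h4⟩ := h
    refine ⟨q, H', ?_, h2, ih h3 h2 fun z hz => hP z ?_, h4⟩
    · rw [hP _ ?_, h1]
      push_cast
      have : (c : ℤ) < S := by exact_mod_cast hc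
      linarith
    · push_cast
      have : (0 : ℤ) ≤ S := by positivity
      linarith

/-- Every entry of level `t` of the table `V` comes from a valid set. -/
def LevelSound (n N W S : ℕ) (A : ℕ → ℕ → Prop) (L : ℕ → ℕ) (V P : ℤ → ℤ) (t : ℕ) : Prop :=
  ∀ c < S, V (t * S + c) ≠ 0 → ∃ H ⊆ Finset.range t, Valid n A L t H ∧ c = cd W N H t ∧
    V (t * S + c) = H.card + 1 ∧ Trace P S t c H

/-- Every valid set is accounted for in level `t` of the table `V`. -/
def LevelComplete (n N W S : ℕ) (A : ℕ → ℕ → Prop) (L : ℕ → ℕ) (V : ℤ → ℤ) (t : ℕ) : Prop :=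
  ∀ H ⊆ Finset.range t, Valid n A L t H →
    V (t * S + cd W N H t) ≠ 0 ∧ V (t * S + cd W N H t) ≤ H.card + 1

/-- The table after the first `k` relaxations of level `t`. -/
structure Relaxed (N W S : ℕ) (V₀ P₀ V P : ℤ → ℤ) (t k : ℕ) : Prop where
  oldV : ∀ z < (t + 1 : ℤ) * S, V z = V₀ z
  oldP : ∀ z < (t + 1 : ℤ) * S, P z = P₀ z
  new : ∀ z, (t + 2 : ℤ) * S ≤ z → V z = 0
  sound : ∀ c < S, V ((t + 1) * S + c) ≠ 0 → ∃ q < k, P ((t + 1) * S + c) = q ∧ q / 2 < S ∧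
    V₀ (t * S + (q / 2 : ℕ)) ≠ 0 ∧ V ((t + 1) * S + c) = V₀ (t * S + (q / 2 : ℕ)) + (q % 2 : ℕ) ∧
    nextCode W N t q = c
  complete : ∀ q < k, V₀ (t * S + (q / 2 : ℕ)) ≠ 0 → V ((t + 1) * S + nextCode W N t q) ≠ 0 ∧
    V ((t + 1) * S + nextCode W N t q) ≤ V₀ (t * S + (q / 2 : ℕ)) + (q % 2 : ℕ)

section
variable {n N W S : ℕ} {A : ℕ → ℕ → Prop} {L : ℕ → ℕ} {V P : ℤ → ℤ} {t : ℕ} {H : Finset ℕ}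

theorem decode_cd (hW : 1 ≤ W) (ht : t ≤ N) (hN : 0 < N) :
    decode (2 ^ W) N (cd W N H t) = sigOf W H t := by
  have r := rep_sigOf hW H t
  have := r.le_p
  exact decode_code r.lt1 r.lt2 (by omega)

theorem cd_lt (hW : 1 ≤ W) (ht : t ≤ N) (hN : 0 < N) :
    cd W N H t < 2 ^ W * 2 ^ W * 2 ^ W * N := by
  have r := rep_sigOf hW H t
  have := r.le_p
  exact code_lt r.lt0 r.lt1 r.lt2 (by omega)

theorem Rep.le_of_top {s : Sig} (hW : 1 ≤ W) (h : Rep W t H s) (hs : 2 ^ W ≤ 2 * s.m1) : W ≤ t := by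
  obtain ⟨V, rfl⟩ : ∃ V, W = V + 1 := ⟨W - 1, by omega⟩
  have := (h.bit1 V (by omega)).1
    (Nat.testBit_of_two_pow_le_and_two_pow_add_one_gt (by rw [pow_succ] at hs; omega) h.lt1)
  omega

/-- The signature at time `t` depends only on elements below `t`, so adding `t` to the set affects
just the last step. -/
theorem nextCode_eq (hW : 1 ≤ W) (ht : t < N) (hH : H ⊆ Finset.range t) {q : ℕ}
    (hq : q / 2 = cd W N H t) :
    nextCode W N t q = cd W N (if q % 2 = 1 then insert t H else H) (t + 1) := by
  have htH : t ∉ H := fun h => by simpa using hH h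
  rw [nextCode, hq, decode_cd hW ht.le (by omega), cd, sigOf]
  have e : sigOf W (if q % 2 = 1 then insert t H else H) t = sigOf W H t := by
    refine sigOf_congr fun x hx => ?_
    split_ifs
    · simp [hx.ne]
    · rfl
  rw [e]
  rcases Nat.mod_two_eq_zero_or_one q with h | h <;> simp [h, htH]

theorem level_inj {c d : ℕ} {t : ℤ} : t * S + c = t * S + (d : ℤ) ↔ c = d := by
  rw [add_right_inj, Nat.cast_inj]

theorem relax_spec {Wd B : ℕ} {σ : State} (hB : 2 ≤ B) (hWd : B ^ solverExp ≤ Wd) (hb : σ.Bdd B)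
    (hW : 1 ≤ W) (h9 : σ.vars 9 = W) (h10 : σ.vars 10 = (2 ^ W : ℕ)) (h16 : σ.vars 16 = N)
    (h17 : σ.vars 17 = S) (hS : S = 2 ^ W * 2 ^ W * 2 ^ W * N) (h12 : ∀ z, σ.arr 12 z = pw W z)
    (h20 : σ.vars 20 = t) (htN : t < N) (hSB : 2 * S ≤ B) (hNB : N + 1 ≤ B)
    (hsound : LevelSound n N W S A L (σ.arr 25) (σ.arr 26) t)
    (hnew : ∀ z, (t + 1 : ℤ) * S ≤ z → σ.arr 25 z = 0) :
    Tr Wd (.forTo 21 (2 * .var 17) relaxBody) σ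
      (2 * S * (relaxBody.time + (2 * .var 17 : Expr).cost + 10) + (2 * .var 17 : Expr).cost + 10)
      (fun σ' => σ'.Bdd B ∧
        Relaxed N W S (σ.arr 25) (σ.arr 26) (σ'.arr 25) (σ'.arr 26) t (2 * S)) := by
  have hSpos : (0 : ℤ) ≤ S := by positivity
  refine Tr.forTo (fun k σ' => Relaxed N W S (σ.arr 25) (σ.arr 26) (σ'.arr 25) (σ'.arr 26) t k) hB
    (fit hB hWd (by unfold solverExp; omega)) hSB (by decide) ?_ hb ?_ ?_
  · intro τ hs
    simp only [Expr.val_mul, Expr.val_two, Expr.val_var]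
    rw [hs.1 17 (by decide), h17]
    push_cast
    rfl
  · refine ⟨fun _ _ => rfl, fun _ _ => rfl, fun z hz => hnew z ?_, fun c hc hne => ?_,
      fun q hq => by omega⟩
    · linarith
    · exact absurd (hnew _ (by positivity |> fun h : (0:ℤ) ≤ c => by linarith)) hne
  · intro q hq τ hs h21 hbτ hr
    have hq2 : q / 2 < S := by omega
    have hq2' : ((q / 2 : ℕ) : ℤ) < S := by exact_mod_cast hq2
    have hsrc : τ.arr 25 (t * S + (q / 2 : ℕ)) = σ.arr 25 (t * S + (q / 2 : ℕ)) :=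
      hr.oldV _ (by linarith)
    -- A nonempty source entry comes from an actual set. This provides the hypothesis `hg` for
    -- `val_codeE` and bounds the stored cost.
    have hex : τ.arr 25 (t * S + (q / 2 : ℕ)) ≠ 0 → ∃ H ⊆ Finset.range t, q / 2 = cd W N H t ∧
        τ.arr 25 (t * S + (q / 2 : ℕ)) = H.card + 1 := by
      intro hne
      rw [hsrc] at hne ⊢
      obtain ⟨H, h1, -, h3, h4, -⟩ := hsound _ hq2 hne
      exact ⟨H, h1, h3, h4⟩
    refine Tr.block rfl hB hbτ (fit hB hWd (by unfold solverExp; omega)) ?_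
    simp only [State.setVar_arr]
    have run := relaxBody_run (σ := τ) (W := W) (N := N) (S := S) (t := t) (q := q)
      (by rw [hs.1 9 (by decide), h9]) (by rw [hs.1 10 (by decide), h10])
      (by rw [hs.1 16 (by decide), h16]) (by rw [hs.1 17 (by decide), h17])
      (by intro z; rw [hs.2 12 (by decide), h12]) (by rw [hs.1 20 (by decide), h20]) h21 (by
        intro hne
        obtain ⟨H, hH, hc, -⟩ := hex hne
        rw [hc, decode_cd hW htN.le (by omega)]
        exact (rep_sigOf hW H t).le_of_top hW)
    rcases run with ⟨hno, hrun⟩ | ⟨hne, hbet, hrun⟩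
    · rw [hrun]
      refine ⟨hbτ, hr.oldV, hr.oldP, hr.new, fun c hc hne => ?_, fun q' hq' hne => ?_⟩
      · obtain ⟨q', h1, h2⟩ := hr.sound c hc hne
        exact ⟨q', by omega, h2⟩
      · rcases Nat.lt_succ_iff_lt_or_eq.1 hq' with h | rfl
        · exact hr.complete q' h hne
        · rw [hsrc] at hno
          exact hno hne
    · obtain ⟨H, hH, hc, hcard⟩ := hex hne
      have hnc : nextCode W N t q < S := by
        rw [nextCode_eq hW htN hH hc, hS]
        exact cd_lt hW htN (by omega)
      have hnc' : ((nextCode W N t q : ℕ) : ℤ) < S := by exact_mod_cast hnc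
      have hHt : H.card ≤ t := by simpa using Finset.card_le_card hH
      generalize hi : ((t : ℤ) + 1) * S + nextCode W N t q = i at hbet hrun
      have f25 : ∀ z, (relaxBody.run τ).arr 25 z = if z = i then
          τ.arr 25 (t * S + (q / 2 : ℕ)) + (q % 2 : ℕ) else τ.arr 25 z := by
        intro z; rw [hrun]; simp
      have f26 : ∀ z, (relaxBody.run τ).arr 26 z = if z = i then (q : ℤ) else τ.arr 26 z := by
        intro z; rw [hrun]; simp
      refine ⟨?_, fun z hz => ?_, fun z hz => ?_, fun z hz => ?_, fun c hc hne' => ?_,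
        fun q' hq' hne' => ?_⟩
      · rw [hrun]
        refine (hbτ.setArr (abs_lt_of_nat (by omega))).setArr ?_
        rw [hcard]
        exact_mod_cast abs_lt_of_nat (show H.card + 1 + q % 2 ≤ B by omega)
      · have hc0 : (0 : ℤ) ≤ (nextCode W N t q : ℕ) := by positivity
        rw [f25, if_neg (by linarith)]
        exact hr.oldV z hz
      · have hc0 : (0 : ℤ) ≤ (nextCode W N t q : ℕ) := by positivity
        rw [f26, if_neg (by linarith)]
        exact hr.oldP z hz
      · rw [f25, if_neg (by linarith)]
        exact hr.new z hz
      · by_cases hci : nextCode W N t q = c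
        · rw [hci] at hi
          refine ⟨q, by omega, by rw [f26, if_pos hi], hq2, by rwa [← hsrc], ?_, hci⟩
          rw [f25, if_pos hi, hsrc]
        · have : ((t : ℤ) + 1) * S + c ≠ i := by
            rw [← hi]
            exact fun h => hci (level_inj.1 h).symm
          rw [f25, if_neg this] at hne' ⊢
          rw [f26, if_neg this]
          obtain ⟨q', h1, h2⟩ := hr.sound c hc hne'
          exact ⟨q', by omega, h2⟩
      · have hpos : τ.arr 25 (t * S + (q / 2 : ℕ)) + (q % 2 : ℕ) ≠ 0 := by
          rw [hcard]; positivity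
        by_cases hqq : q' = q
        · subst hqq
          rw [hi, f25, if_pos rfl, ← hsrc]
          exact ⟨hpos, le_rfl⟩
        · have old := hr.complete q' (by omega) hne'
          by_cases hci : ((t : ℤ) + 1) * S + nextCode W N t q' = i
          · rw [hci] at old ⊢
            rw [f25, if_pos rfl]
            refine ⟨hpos, ?_⟩
            rcases hbet with h | h
            · exact absurd h old.1
            · linarith [old.2]
          · rw [f25, if_neg hci]
            exact old

end

/-! ### Removal of signatures that miss a job, and correctness of one level. -/

/-- What the program finds out about job `j` and the signature with code `c`. -/
def RawSeen (hm : ℤ → ℤ) (W N t j c : ℕ) : Prop :=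
  hm (j * N + (decode (2 ^ W) N c).p) ≠ 0 ∨
    ∃ k < W, SeenBit hm W N t j (decode (2 ^ W) N c) k

open Classical in
/-- The table `V` after the removal of some entries of level `t + 1`. -/
noncomputable def pruned (V : ℤ → ℤ) (S t : ℕ) (Z : ℕ → Prop) (z : ℤ) : ℤ :=
  if ∃ c < S, z = (t + 1) * S + c ∧ Z c then 0 else V z

theorem pruned_congr {V : ℤ → ℤ} {S t : ℕ} {Z Z' : ℕ → Prop} (h : ∀ c < S, Z c ↔ Z' c) :
    pruned V S t Z = pruned V S t Z' := by
  funext z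
  unfold pruned
  congr 1
  exact propext (exists_congr fun c => and_congr_right fun hc => and_congr_right fun _ => h c hc)

theorem update_pruned {V : ℤ → ℤ} {S t c : ℕ} {Z : ℕ → Prop} {R : Prop} [Decidable R] (hc : c < S) :
    Function.update (pruned V S t Z) ((t + 1) * S + c)
      (if R then pruned V S t Z ((t + 1) * S + c) else 0) =
    pruned V S t fun d => Z d ∨ d = c ∧ ¬ R := by
  funext z
  rw [Function.update_apply]
  unfold pruned
  by_cases hz : z = (t + 1) * S + c
  · subst hz
    simp only [if_true, level_inj]
    by_cases hR : R
    · simp only [if_pos hR]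
      congr 1
      simp only [hR, not_true, and_false, or_false]
    · rw [if_neg hR, if_pos ⟨c, hc, rfl, Or.inr ⟨rfl, hR⟩⟩]
  · rw [if_neg hz]
    congr 1
    refine propext (exists_congr fun d => and_congr_right fun _ => and_congr_right fun hd => ?_)
    constructor
    · exact Or.inl
    · rintro (h | ⟨rfl, -⟩)
      · exact h
      · exact absurd hd hz

/-- The running time of the loop over all signatures. -/
def pruneLoopTime (W S : ℕ) : ℕ :=
  S * (pruneTime W + (Expr.var 17).cost + 10) + (Expr.var 17).cost + 10

def lastE : Expr := .eq (.get 24 (.var 21)) (.var 20)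

def checkTime (n W S : ℕ) (L : ℕ → ℕ) (t : ℕ) : ℕ :=
  ∑ j ∈ Finset.range n, (lastE.cost + 1 + (if L j = t then pruneLoopTime W S else Cmd.skip.time) +
    (Expr.var 0).cost + 10) + (Expr.var 0).cost + 10

section
variable {n N W S : ℕ} {A : ℕ → ℕ → Prop} {L : ℕ → ℕ} {V P : ℤ → ℤ} {t : ℕ} {H : Finset ℕ}

-- The time is kept as a sum over the jobs, with the expensive term only for `L j = t`; summation
-- over `t` then yields the amortised bound.
open Classical in
theorem check_spec {Wd B : ℕ} {σ : State} (hB : 2 ≤ B) (hWd : B ^ solverExp ≤ Wd) (hb : σ.Bdd B)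
    (h0 : σ.vars 0 = n) (h9 : σ.vars 9 = W) (h10 : σ.vars 10 = (2 ^ W : ℕ))
    (h16 : σ.vars 16 = N) (h17 : σ.vars 17 = S) (h12 : ∀ z, σ.arr 12 z = pw W z)
    (h20 : σ.vars 20 = t) (hL : ∀ j < n, σ.arr 24 (j : ℕ) = L j) (hSB : S ≤ B) (hnB : n ≤ B)
    (hWB : W ≤ B) :
    Tr Wd (.forTo 21 (.var 0) checkBody) σ (checkTime n W S L t) (fun σ' => σ'.Bdd B ∧
      σ'.arr 25 = pruned (σ.arr 25) S t
        fun c => ∃ j < n, L j = t ∧ ¬ RawSeen (σ.arr 22) W N t j c) := by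
  refine Tr.forTo_sum
    (T := fun j => lastE.cost + 1 + if L j = t then pruneLoopTime W S else Cmd.skip.time)
    (fun k σ' => σ'.arr 25 = pruned (σ.arr 25) S t
      fun c => ∃ j < k, L j = t ∧ ¬ RawSeen (σ.arr 22) W N t j c) hB
    (fit hB hWd (wt_var_le 0)) hnB (by decide) ?_ hb ?_ ?_
  · intro τ hs
    rw [Expr.val_var, hs.1 0 (by decide), h0]
  · funext z
    simp [pruned]
  · intro j hj τ hs h21 hbτ hV
    have v0 : τ.vars 0 = n := by rw [hs.1 0 (by decide), h0]
    have v9 : τ.vars 9 = W := by rw [hs.1 9 (by decide), h9]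
    have v10 : τ.vars 10 = (2 ^ W : ℕ) := by rw [hs.1 10 (by decide), h10]
    have v16 : τ.vars 16 = N := by rw [hs.1 16 (by decide), h16]
    have v17 : τ.vars 17 = S := by rw [hs.1 17 (by decide), h17]
    have v20 : τ.vars 20 = t := by rw [hs.1 20 (by decide), h20]
    have a12 : ∀ z, τ.arr 12 z = pw W z := by rw [hs.2 12 (by decide)]; exact h12
    have a22 : τ.arr 22 = σ.arr 22 := hs.2 22 (by decide)
    have hval : lastE.val τ = if L j = t then 1 else 0 := by
      have : τ.arr 24 j = L j := by rw [hs.2 24 (by decide), hL j hj]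
      simp only [lastE, Expr.val, h21, this, v20]
      simp
    simp only [State.setVar_arr]
    have split (k : ℕ) (Q : ℕ → Prop) : (∃ i < k + 1, Q i) ↔ (∃ i < k, Q i) ∨ Q k := by
      simp only [Nat.lt_succ_iff_lt_or_eq, or_and_right, exists_or, exists_eq_left]
    refine Tr.cond hB hbτ (fit hB hWd (by unfold solverExp; omega)) ?_ ?_
    · intro hne
      have hLt : L j = t := by
        by_contra h
        exact hne (by rw [← lastE, hval, if_neg h])
      rw [if_pos hLt]
      have inner := Tr.forTo (Wd := Wd) (B := B) (n := S) (T := pruneTime W) (i := 22)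
        (e := .var 17) (c := pruneBody) (σ₀ := τ)
        (fun k τ' => τ'.arr 25 = pruned (σ.arr 25) S t
          fun c => (∃ i < j, L i = t ∧ ¬ RawSeen (σ.arr 22) W N t i c) ∨
            c < k ∧ ¬ RawSeen (σ.arr 22) W N t j c) hB
        (fit hB hWd (wt_var_le 17)) hSB (by decide)
        (by intro τ' hs'; rw [Expr.val_var, hs'.1 17 (by decide), v17]) hbτ
        (by
          simp only [State.setVar_arr, hV]
          refine pruned_congr fun c _ => ?_
          simp)
        (by
          intro c hc τ' hs' h22 hb' hV'
          have := pruneBody_spec (Wd := Wd) (B := B) (W := W) (N := N) (S := S) (t := t) (j := j)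
            (c := c) (σ := τ') hB hWd hb' (by rw [hs'.1 9 (by decide), v9])
            (by rw [hs'.1 10 (by decide), v10]) (by rw [hs'.1 16 (by decide), v16])
            (by rw [hs'.1 17 (by decide), v17])
            (by rw [hs'.2 12 (by decide)]; exact a12) (by rw [hs'.1 20 (by decide), v20])
            (by rw [hs'.1 21 (by decide), h21]) h22 hWB
          refine this.mono le_rfl ?_
          rintro τ'' - ⟨hb'', h25⟩
          refine ⟨hb'', ?_⟩
          have e22 : τ'.arr 22 = σ.arr 22 := (hs'.2 22 (by decide)).trans a22
          rw [State.setVar_arr, h25, hV', e22]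
          refine (update_pruned hc).trans (pruned_congr fun d _ => ?_)
          rw [or_assoc]
          refine or_congr Iff.rfl ?_
          constructor
          · rintro (⟨h1, h2⟩ | ⟨rfl, h2⟩)
            · exact ⟨by omega, h2⟩
            · exact ⟨by omega, h2⟩
          · rintro ⟨h1, h2⟩
            rcases Nat.lt_succ_iff_lt_or_eq.1 h1 with h | rfl
            · exact Or.inl ⟨h, h2⟩
            · exact Or.inr ⟨rfl, h2⟩)
      refine inner.mono le_rfl ?_
      rintro τ' - ⟨hb', h25⟩
      refine ⟨hb', ?_⟩
      rw [h25]
      refine pruned_congr fun c hc => ?_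
      rw [split]
      simp [hc, hLt]
    · intro h0'
      have hLt : L j ≠ t := by
        intro h
        rw [← lastE, hval, if_pos h] at h0'
        exact one_ne_zero h0'
      rw [if_neg hLt]
      refine Tr.block rfl hB hbτ (fit hB hWd (by unfold solverExp; omega)) ⟨hbτ, ?_⟩
      rw [show Cmd.skip.run τ = τ from rfl, hV]
      refine pruned_congr fun c hc => ?_
      rw [split]
      simp [hLt]

/-- A remembered position is a true element of `H` except possibly `0`, which no job uses.
Conversely, if `H` meets `A j`, then the locality of `A j` makes the signature remember an element
of `A j`, possibly a different one. -/
theorem rawSeen_iff {hm : ℤ → ℤ} (hr : Rows n N W A L) (ht : t < N)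
    (hA : ∀ j < n, ∀ x < N, hm ((j : ℕ) * N + (x : ℕ)) ≠ 0 ↔ A j x)
    (hH : H ⊆ Finset.range (t + 1)) {j : ℕ} (hj : j < n) (hL : L j = t) :
    RawSeen hm W N t j (cd W N H (t + 1)) ↔ ∃ x ∈ H, A j x := by
  have rep := rep_sigOf hr.pos H (t + 1)
  rw [RawSeen, decode_cd hr.pos (by omega) (by omega), exists_seenBit_iff rep]
  constructor
  · rintro ⟨x, hx, hne⟩
    have hmem := rep.mem_of_remembers hx
    have hxN : x < N := by omega
    have hAx := (hA j hj x hxN).1 hne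
    rcases hmem with rfl | h
    · exact absurd hAx (hr.zero j hj)
    · exact ⟨x, h.1, hAx⟩
  · rintro ⟨x, hx, hAx⟩
    have hloc := hr.loc j hj
    rw [hL] at hloc
    obtain ⟨y, hy, hAy⟩ := rep.exists_remembers hloc hx (by simpa using hH hx) hAx
    have hle := hr.le j hj y hAy
    exact ⟨y, hy, (hA j hj y (by omega)).2 hAy⟩

/-- Two sets with the same signature at time `t + 1` hit the same jobs that are due there, and
appending the same choices keeps their signatures equal. So one cheapest representative per
signature is enough. -/
theorem level_step {hm V₀ P₀ : ℤ → ℤ} (hr : Rows n N W A L) (hS : S = 2 ^ W * 2 ^ W * 2 ^ W * N)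
    (ht : t < N) (hA : ∀ j < n, ∀ x < N, hm ((j : ℕ) * N + (x : ℕ)) ≠ 0 ↔ A j x)
    (hs : LevelSound n N W S A L V₀ P₀ t) (hc : LevelComplete n N W S A L V₀ t)
    (hrel : Relaxed N W S V₀ P₀ V P t (2 * S)) :
    LevelSound n N W S A L
        (pruned V S t fun c => ∃ j < n, L j = t ∧ ¬ RawSeen hm W N t j c) P (t + 1) ∧
      LevelComplete n N W S A L
        (pruned V S t fun c => ∃ j < n, L j = t ∧ ¬ RawSeen hm W N t j c) (t + 1) ∧
      ∀ z, (t + 2 : ℤ) * S ≤ z →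
        pruned V S t (fun c => ∃ j < n, L j = t ∧ ¬ RawSeen hm W N t j c) z = 0 := by
  have hN : 0 < N := by omega
  have dead (c : ℕ) (hcS : c < S) (Z : ℕ → Prop) : (Z c → pruned V S t Z ((t + 1) * S + c) = 0) ∧
      (¬ Z c → pruned V S t Z ((t + 1) * S + c) = V ((t + 1) * S + c)) := by
    constructor
    · exact fun h => if_pos ⟨c, hcS, rfl, h⟩
    · intro h
      refine if_neg ?_
      rintro ⟨d, -, hd, hZ⟩
      rw [level_inj.1 hd] at h
      exact h hZ
  refine ⟨?_, ?_, ?_⟩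
  · intro c hcS hne
    push_cast at hne ⊢
    set Z : ℕ → Prop := fun c => ∃ j < n, L j = t ∧ ¬ RawSeen hm W N t j c
    have hZ : ¬ Z c := fun h => hne ((dead c hcS Z).1 h)
    rw [(dead c hcS Z).2 hZ] at hne ⊢
    obtain ⟨q, hq, h1, h2, h3, h4, h5⟩ := hrel.sound c hcS hne
    obtain ⟨H, hH, hv, hcd, hcard, htr⟩ := hs _ h2 h3
    have htH : t ∉ H := fun h => by simpa using hH h
    set H' := if q % 2 = 1 then insert t H else H with hH'
    have hsub : H ⊆ H' := by
      rw [hH']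
      split_ifs
      · exact Finset.subset_insert _ _
      · exact subset_rfl
    have hH'r : H' ⊆ Finset.range (t + 1) := by
      have : H ⊆ Finset.range (t + 1) :=
        hH.trans (Finset.range_subset_range.2 (by omega))
      rw [hH']
      split_ifs
      · exact Finset.insert_subset (by simp) this
      · exact this
    have hceq : c = cd W N H' (t + 1) := by rw [← h5, nextCode_eq hr.pos ht hH hcd]
    refine ⟨H', hH'r, ?_, hceq, ?_, ⟨q, H, by push_cast; exact h1, h2, ?_, hH'⟩⟩
    · intro j hj hLj
      rcases Nat.lt_succ_iff_lt_or_eq.1 hLj with hlt | heq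
      · obtain ⟨x, hx, hAx⟩ := hv j hj hlt
        exact ⟨x, hsub hx, hAx⟩
      · by_contra hno
        refine hZ ⟨j, hj, heq, ?_⟩
        rw [hceq, rawSeen_iff hr ht hA hH'r hj heq]
        exact hno
    · rw [h4, hcard, hH']
      rcases Nat.mod_two_eq_zero_or_one q with h | h <;> simp [h, htH]
    · exact htr.congr h2 hrel.oldP
  · intro H hH hv
    push_cast
    set Z : ℕ → Prop := fun c => ∃ j < n, L j = t ∧ ¬ RawSeen hm W N t j c
    have hcS : cd W N H (t + 1) < S := by rw [hS]; exact cd_lt hr.pos (by omega) hN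
    have hZ : ¬ Z (cd W N H (t + 1)) := by
      rintro ⟨j, hj, hL, hno⟩
      rw [rawSeen_iff hr ht hA hH hj hL] at hno
      exact hno (hv j hj (by omega))
    rw [(dead _ hcS Z).2 hZ]
    set H₀ := H.erase t with hH₀
    have hH₀r : H₀ ⊆ Finset.range t := by
      intro x hx
      have h1 := Finset.ne_of_mem_erase hx
      have h2 := hH (Finset.mem_of_mem_erase hx)
      rw [Finset.mem_range] at h2 ⊢
      omega
    -- Jobs due before `t` use only positions below `t`, so removing `t` does not hurt them.
    have hv₀ : Valid n A L t H₀ := by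
      intro j hj hLj
      obtain ⟨x, hx, hAx⟩ := hv j hj (by omega)
      have := hr.le j hj x hAx
      exact ⟨x, Finset.mem_erase.2 ⟨by omega, hx⟩, hAx⟩
    obtain ⟨c1, c2⟩ := hc H₀ hH₀r hv₀
    have hc₀ : cd W N H₀ t < S := by rw [hS]; exact cd_lt hr.pos ht.le hN
    -- The transition `2 * code + b` leads from `H.erase t` to `H`.
    set b : ℕ := if t ∈ H then 1 else 0 with hb
    have hb2 : b < 2 := by rw [hb]; split_ifs <;> omega
    have hq2 : (2 * cd W N H₀ t + b) / 2 = cd W N H₀ t := by omega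
    have hqm : (2 * cd W N H₀ t + b) % 2 = b := by omega
    have hback : (if b = 1 then insert t H₀ else H₀) = H := by
      rw [hb, hH₀]
      by_cases hm : t ∈ H
      · simp [hm, Finset.insert_erase]
      · simp [hm, Finset.erase_eq_of_notMem]
    have hcard : H₀.card + b = H.card := by
      rw [hb, hH₀]
      by_cases hm : t ∈ H
      · rw [if_pos hm, Finset.card_erase_add_one hm]
      · simp [hm, Finset.erase_eq_of_notMem]
    have hcomp := hrel.complete (2 * cd W N H₀ t + b) (by omega) (by rw [hq2]; exact c1)
    rw [nextCode_eq hr.pos ht hH₀r hq2, hqm, hq2, hback] at hcomp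
    refine ⟨hcomp.1, hcomp.2.trans ?_⟩
    rw [← hcard]
    push_cast
    linarith
  · intro z hz
    unfold pruned
    split_ifs
    · rfl
    · exact hrel.new z hz

/-- The running time of level `t` of the dynamic program. -/
def levelTime (n W S : ℕ) (L : ℕ → ℕ) (t : ℕ) : ℕ :=
  2 * S * (relaxBody.time + (2 * .var 17 : Expr).cost + 10) + (2 * .var 17 : Expr).cost + 10 +
    checkTime n W S L t

theorem dpCmd_spec {Wd B : ℕ} {σ : State} (hB : 2 ≤ B) (hWd : B ^ solverExp ≤ Wd) (hb : σ.Bdd B)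
    (hr : Rows n N W A L) (h0 : σ.vars 0 = n) (h9 : σ.vars 9 = W) (h10 : σ.vars 10 = (2 ^ W : ℕ))
    (h16 : σ.vars 16 = N) (h17 : σ.vars 17 = S) (hS : S = 2 ^ W * 2 ^ W * 2 ^ W * N)
    (h12 : ∀ z, σ.arr 12 z = pw W z) (hL : ∀ j < n, σ.arr 24 (j : ℕ) = L j)
    (hA : ∀ j < n, ∀ x < N, σ.arr 22 ((j : ℕ) * N + (x : ℕ)) ≠ 0 ↔ A j x)
    (h25 : ∀ z, σ.arr 25 z = 0) (hN : 0 < N) (hSB : 2 * S ≤ B) (hNB : N + 1 ≤ B) (hnB : n ≤ B)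
    (hWB : W ≤ B) :
    Tr Wd dpCmd σ ((Cmd.store 25 0 1).time +
        (∑ t ∈ Finset.range N, (levelTime n W S L t + (Expr.var 16).cost + 10) +
          (Expr.var 16).cost + 10))
      (fun σ' => σ'.Bdd B ∧ LevelSound n N W S A L (σ'.arr 25) (σ'.arr 26) N ∧
        LevelComplete n N W S A L (σ'.arr 25) N) := by
  have hSpos : 0 < S := by rw [hS]; positivity
  refine Tr.seq (Q := fun σ' => σ' = σ.setArr 25 0 1) (Tr.block rfl hB hb
    (fit hB hWd (by unfold solverExp; omega)) (by simp)) ?_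
  rintro _ - rfl
  -- Level `0` has one entry, the value `1` at code `0`; it represents the empty set with cost `0`.
  have cd0 (H : Finset ℕ) : cd W N H 0 = 0 := by simp [cd, sigOf, Sig.code]
  refine (Tr.forTo_sum (T := levelTime n W S L)
    (fun t σ' => LevelSound n N W S A L (σ'.arr 25) (σ'.arr 26) t ∧
      LevelComplete n N W S A L (σ'.arr 25) t ∧ ∀ z, (t + 1 : ℤ) * S ≤ z → σ'.arr 25 z = 0) hB
    (fit hB hWd (wt_var_le 16)) (by omega) (by decide) ?_
    (hb.setArr (by rw [abs_one]; exact_mod_cast (by omega : 1 ≤ B))) ⟨?_, ?_, ?_⟩ ?_).mono le_rfl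
    (fun _ _ h => ⟨h.1, h.2.1, h.2.2.1⟩)
  · intro τ hs
    rw [Expr.val_var, hs.1 16 (by decide)]
    exact h16
  · intro c hc hne
    have hc0 : c = 0 := by
      by_contra h
      refine hne ?_
      simp [h25, h]
    subst hc0
    refine ⟨∅, by simp, fun j hj h => by omega, (cd0 _).symm, by simp, rfl⟩
  · intro H hH hv
    rw [cd0]
    simp only [State.setVar_arr, State.setArr_arr]
    simp
  · intro z hz
    have : z ≠ 0 := by
      rintro rfl
      push_cast at hz
      have : (0 : ℤ) < S := by exact_mod_cast hSpos
      linarith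
    simp [h25, this]
  · rintro t ht τ hs h20 hbτ ⟨hsound, hcomp, hnew⟩
    have v0 : τ.vars 0 = n := by rw [hs.1 0 (by decide)]; exact h0
    have v9 : τ.vars 9 = W := by rw [hs.1 9 (by decide)]; exact h9
    have v10 : τ.vars 10 = (2 ^ W : ℕ) := by rw [hs.1 10 (by decide)]; exact h10
    have v16 : τ.vars 16 = N := by rw [hs.1 16 (by decide)]; exact h16
    have v17 : τ.vars 17 = S := by rw [hs.1 17 (by decide)]; exact h17
    have a12 : ∀ z, τ.arr 12 z = pw W z := by
      intro z; rw [hs.2 12 (by decide)]; simpa using h12 z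
    have a22 : τ.arr 22 = σ.arr 22 := by rw [hs.2 22 (by decide)]; funext z; simp
    have a24 : τ.arr 24 = σ.arr 24 := by rw [hs.2 24 (by decide)]; funext z; simp
    refine Tr.seq (relax_spec (Wd := Wd) (n := n) (N := N) (W := W) (S := S) (A := A) (L := L)
      (t := t) (σ := τ) hB hWd hbτ hr.pos v9 v10 v16 v17 hS a12 h20 ht hSB hNB hsound hnew) ?_
    rintro τ' hs' ⟨hb', hrel⟩
    refine (check_spec (Wd := Wd) (n := n) (N := N) (W := W) (S := S) (L := L) (t := t) (σ := τ')
      hB hWd hb' (by rw [hs'.1 0 (by decide), v0]) (by rw [hs'.1 9 (by decide), v9])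
      (by rw [hs'.1 10 (by decide), v10]) (by rw [hs'.1 16 (by decide), v16])
      (by rw [hs'.1 17 (by decide), v17]) (by rw [hs'.2 12 (by decide)]; exact a12)
      (by rw [hs'.1 20 (by decide), h20])
      (by rw [hs'.2 24 (by decide), a24]; exact hL) (by omega) hnB hWB).mono le_rfl ?_
    rintro τ'' hs'' ⟨hb'', h25''⟩
    have e22 : τ'.arr 22 = σ.arr 22 := (hs'.2 22 (by decide)).trans a22
    have e26 : τ''.arr 26 = τ'.arr 26 := hs''.2 26 (by decide)
    have step := level_step (hm := σ.arr 22) hr hS ht hA hsound hcomp hrel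
    simp only [State.setVar_arr]
    rw [h25'', e26, e22]
    refine ⟨hb'', step.1, step.2.1, fun z hz => step.2.2 z ?_⟩
    push_cast at hz
    linarith

end

/-! ### Best final signature, backtracking and output. -/

theorem Trace.subset {P : ℤ → ℤ} {S t c : ℕ} {H : Finset ℕ} (h : Trace P S t c H) :
    H ⊆ Finset.range t := by
  induction t generalizing c H with
  | zero => rw [show H = ∅ from h]; simp
  | succ t ih =>
    obtain ⟨q, H', -, -, h3, rfl⟩ := h
    have : H' ⊆ Finset.range (t + 1) := (ih h3).trans (Finset.range_subset_range.2 (by omega))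
    split_ifs
    · exact Finset.insert_subset (by simp) this
    · exact this

/-- The best of the first `k` entries of the table `V` is `v`, for the index `b`. -/
def Best (V : ℕ → ℤ) (k : ℕ) (v b : ℤ) : Prop :=
  (v = 0 ∧ ∀ c < k, V c = 0) ∨
    ∃ c₀ < k, b = (c₀ : ℕ) ∧ v = V c₀ ∧ v ≠ 0 ∧ ∀ c < k, V c ≠ 0 → v ≤ V c

theorem best_spec {Wd B S N : ℕ} {σ : State} (hB : 2 ≤ B) (hWd : B ^ solverExp ≤ Wd)
    (hb : σ.Bdd B) (h16 : σ.vars 16 = N) (h17 : σ.vars 17 = S) (h24 : σ.vars 24 = 0)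
    (hS : S ≤ B) :
    Tr Wd (.forTo 20 (.var 17) bestBody) σ
      (S * (bestBody.time + (Expr.var 17).cost + 10) + (Expr.var 17).cost + 10)
      (fun σ' => σ'.Bdd B ∧
        Best (fun c => σ.arr 25 ((N : ℤ) * S + c)) S (σ'.vars 24) (σ'.vars 25)) := by
  refine Tr.forTo (fun k σ' => Best (fun c => σ.arr 25 ((N : ℤ) * S + c)) k (σ'.vars 24)
    (σ'.vars 25)) hB (fit hB hWd (wt_var_le 17)) hS (by decide)
    (by intro τ hs; rw [Expr.val_var, hs.1 17 (by decide)]; exact h17) hb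
    (Or.inl ⟨by simpa using h24, by omega⟩) ?_
  intro k hk τ hs h20 hbτ hI
  have v16 : τ.vars 16 = N := by rw [hs.1 16 (by decide)]; exact h16
  have v17 : τ.vars 17 = S := by rw [hs.1 17 (by decide)]; exact h17
  have a25 : τ.arr 25 = σ.arr 25 := hs.2 25 (by decide)
  set V : ℕ → ℤ := fun c => σ.arr 25 ((N : ℤ) * S + c) with hV
  have hf : ∀ z, finalE.val (τ.setVar 25 z) = V k := by
    intro z
    simp [finalE, v16, v17, h20, a25, hV]
  have hf0 : finalE.val τ = V k := by simp [finalE, v16, v17, h20, a25, hV]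
  set p : Prop := V k ≠ 0 ∧ ¬ (τ.vars 24 ≠ 0 ∧ ¬ V k < τ.vars 24) with hp
  have hT : ∀ z, bestT.holds (τ.setVar 25 z) ↔ p := by
    intro z
    simp only [bestT, Test.holds_and, Test.holds_not, Test.holds_eq, Test.holds_lt, hf, hp]
    simp
  have hT0 : bestT.holds τ ↔ p := by
    simp only [bestT, Test.holds_and, Test.holds_not, Test.holds_eq, Test.holds_lt, hf0, hp]
    simp
  have hVB : |V k| ≤ B := by rw [hV, ← a25]; exact hbτ.2 _ _
  refine Tr.block rfl hB hbτ (fit hB hWd (by unfold solverExp; omega)) ?_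
  by_cases hpp : p
  · have hrun : bestBody.run τ = (τ.setVar 25 k).setVar 24 (V k) := by
      simp [bestBody, hT, hT0, hpp, hf, h20]
    rw [hrun]
    refine ⟨(hbτ.setVar (abs_lt_of_nat (by omega))).setVar hVB, ?_⟩
    refine Or.inr ⟨k, by omega, by simp, by simp, by simpa using hpp.1, ?_⟩
    intro c hc hne
    simp only [State.setVar_vars, if_true, show (24 : ℕ) ≠ 20 by decide, if_false]
    rcases Nat.lt_succ_iff_lt_or_eq.1 hc with h | rfl
    · rcases hI with ⟨h1, h2⟩ | ⟨c₀, -, -, h1, h2, h3⟩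
      · exact absurd (h2 c h) hne
      · have := h3 c h hne
        have h4 := hpp.2
        push Not at h4
        exact (h4 h2).le.trans this
    · exact le_rfl
  · have hrun : bestBody.run τ = (τ.setVar 25 (τ.vars 25)).setVar 24 (τ.vars 24) := by
      simp [bestBody, hT, hT0, hpp]
    rw [hrun]
    refine ⟨(hbτ.setVar (hbτ.1 _)).setVar (hbτ.1 _), ?_⟩
    have e24 : (((τ.setVar 25 (τ.vars 25)).setVar 24 (τ.vars 24)).setVar 20 ((k : ℤ) + 1)).vars 24 =
      τ.vars 24 := by simp
    have e25 : (((τ.setVar 25 (τ.vars 25)).setVar 24 (τ.vars 24)).setVar 20 ((k : ℤ) + 1)).vars 25 =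
      τ.vars 25 := by simp
    rw [e24, e25]
    rcases hI with ⟨h1, h2⟩ | ⟨c₀, c1, c2, h1, h2, h3⟩
    · refine Or.inl ⟨h1, fun c hc => ?_⟩
      rcases Nat.lt_succ_iff_lt_or_eq.1 hc with h | rfl
      · exact h2 c h
      · by_contra hne
        exact hpp ⟨hne, fun h => h.1 h1⟩
    · refine Or.inr ⟨c₀, by omega, c2, h1, h2, fun c hc hne => ?_⟩
      rcases Nat.lt_succ_iff_lt_or_eq.1 hc with h | rfl
      · exact h3 c h hne
      · by_contra hlt
        exact hpp ⟨hne, fun h => h.2 (by omega)⟩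

/-- Backtracking runs from level `N` downwards. The invariant keeps a set `H'` that is traced by the
remaining table and agrees with `H` below the current level, while the bits above it are already
written. -/
theorem trace_spec {Wd B S N c : ℕ} {σ : State} {H : Finset ℕ} (hB : 2 ≤ B)
    (hWd : B ^ solverExp ≤ Wd) (hb : σ.Bdd B) (h16 : σ.vars 16 = N) (h17 : σ.vars 17 = S)
    (h25 : σ.vars 25 = c) (hH : Trace (σ.arr 26) S N c H) (hc : c < S) (hS : S ≤ B) (hN : N ≤ B) :
    Tr Wd (.forTo 20 (.var 16) traceBody) σ
      (N * (traceBody.time + (Expr.var 16).cost + 10) + (Expr.var 16).cost + 10)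
      (fun σ' => σ'.Bdd B ∧ ∀ x < N, σ'.arr 27 (x : ℕ) ≠ 0 ↔ x ∈ H) := by
  refine (Tr.forTo (fun k σ' => ∃ (c : ℕ) (H' : Finset ℕ), σ'.vars 25 = c ∧ c < S ∧
    Trace (σ.arr 26) S (N - k) c H' ∧ (∀ x < N - k, x ∈ H ↔ x ∈ H') ∧
    ∀ x < N, N - k ≤ x → (σ'.arr 27 (x : ℕ) ≠ 0 ↔ x ∈ H)) hB (fit hB hWd (wt_var_le 16)) hN
    (by decide) (by intro τ hs; rw [Expr.val_var, hs.1 16 (by decide)]; exact h16) hb ?_ ?_).mono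
    le_rfl ?_
  · exact ⟨c, H, by simpa using h25, hc, hH, fun _ _ => Iff.rfl, fun x h1 h2 => by omega⟩
  · rintro k hk τ hs h20 hbτ ⟨c, H', v25, hcS, htr, hHH, hdone⟩
    have v16 : τ.vars 16 = N := by rw [hs.1 16 (by decide)]; exact h16
    have v17 : τ.vars 17 = S := by rw [hs.1 17 (by decide)]; exact h17
    have a26 : τ.arr 26 = σ.arr 26 := hs.2 26 (by decide)
    obtain ⟨t, ht⟩ : ∃ t, N - k = t + 1 := ⟨N - k - 1, by omega⟩
    have htk : (N : ℤ) - k = t + 1 := by omega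
    rw [ht] at htr
    obtain ⟨q, H'', hq, hq2, htr', rfl⟩ := htr
    have hval : ∀ ρ : State, ρ.vars = τ.vars → ρ.arr 26 = τ.arr 26 → traceE.val ρ = q := by
      intro ρ h1 h2
      simp only [traceE, Expr.val_get, Expr.val_add, Expr.val_mul, Expr.val_sub, Expr.val_var,
        h1, h2, v16, v17, h20, v25, a26, htk]
      exact_mod_cast hq
    have hrun : traceBody.run τ = (τ.setArr 27 t (q % 2 : ℕ)).setVar 25 (q / 2 : ℕ) := by
      have e : (Expr.var 16 - Expr.var 20 - 1).val τ = t := by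
        simp [v16, h20, htk]
      simp only [traceBody, Cmd.run_seq, Cmd.run_store, Cmd.run_assign, Expr.val_mod, Expr.val_div,
        Expr.val_two, e, hval τ rfl rfl]
      rw [hval (τ.setArr 27 t ((q : ℤ) % 2)) rfl (by funext z; simp)]
      push_cast
      rfl
    refine Tr.block rfl hB hbτ (fit hB hWd (by unfold solverExp; omega)) ?_
    rw [hrun]
    refine ⟨(hbτ.setArr (abs_lt_of_nat (by omega))).setVar (abs_lt_of_nat (by omega)), q / 2, H'',
      by simp, hq2, by rwa [show N - (k + 1) = t by omega], ?_, ?_⟩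
    · intro x hx
      rw [hHH x (by omega)]
      split_ifs
      · simp [show x ≠ t by omega]
      · rfl
    · intro x hx hxk
      simp only [State.setVar_arr, State.setArr_arr, true_and, Nat.cast_inj]
      by_cases hxt : x = t
      · subst hxt
        rw [if_pos rfl, hHH x (by omega)]
        have hnot : x ∉ H'' := fun h => by simpa using htr'.subset h
        rcases Nat.mod_two_eq_zero_or_one q with h | h <;> simp [h, hnot]
      · rw [if_neg hxt]
        exact hdone x hx (by omega)
  · rintro σ' - ⟨hb', c, H', -, -, -, -, h⟩
    exact ⟨hb', fun x hx => h x hx (by omega)⟩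

theorem traceCmd_spec {Wd B n N W S : ℕ} {A : ℕ → ℕ → Prop} {L : ℕ → ℕ} {σ : State} (hB : 2 ≤ B)
    (hWd : B ^ solverExp ≤ Wd) (hb : σ.Bdd B) (hr : Rows n N W A L) (h16 : σ.vars 16 = N)
    (h17 : σ.vars 17 = S) (hS : S = 2 ^ W * 2 ^ W * 2 ^ W * N) (h24 : σ.vars 24 = 0)
    (hSB : S ≤ B) (hNB : N ≤ B) (hN : 0 < N)
    (hsound : LevelSound n N W S A L (σ.arr 25) (σ.arr 26) N)
    (hcomp : LevelComplete n N W S A L (σ.arr 25) N) :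
    Tr Wd traceCmd σ ((S * (bestBody.time + (Expr.var 17).cost + 10) + (Expr.var 17).cost + 10) +
        (N * (traceBody.time + (Expr.var 16).cost + 10) + (Expr.var 16).cost + 10))
      (fun σ' => σ'.Bdd B ∧ ∃ H ⊆ Finset.range N, (∀ j < n, ∃ x ∈ H, A j x) ∧
        (∀ H' ⊆ Finset.range N, (∀ j < n, ∃ x ∈ H', A j x) → H.card ≤ H'.card) ∧
        ∀ x < N, σ'.arr 27 (x : ℕ) ≠ 0 ↔ x ∈ H) := by
  have hval (H : Finset ℕ) : Valid n A L N H ↔ ∀ j < n, ∃ x ∈ H, A j x :=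
    ⟨fun h j hj => h j hj (hr.lt j hj), fun h j hj _ => h j hj⟩
  have hcdS (H : Finset ℕ) (hH : H ⊆ Finset.range N) : cd W N H N < S := by
    rw [hS]
    exact cd_lt hr.pos le_rfl hN
  refine Tr.seq (best_spec hB hWd hb h16 h17 h24 hSB) ?_
  rintro τ hs ⟨hbτ, hbest⟩
  rcases hbest with ⟨-, hz⟩ | ⟨c, hcS, v25, hv, hv0, hmin⟩
  · have := (hcomp (Finset.range N) subset_rfl ((hval _).2 fun j hj =>
      ⟨L j, by simpa using hr.lt j hj, hr.last j hj⟩)).1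
    exact absurd (hz _ (hcdS _ subset_rfl)) this
  · obtain ⟨H, hH, hHv, -, hcard, htr⟩ := hsound c hcS (by rw [hv] at hv0; exact hv0)
    have a26 : τ.arr 26 = σ.arr 26 := hs.2 26 (by decide)
    refine (trace_spec (σ := τ) hB hWd hbτ (by rw [hs.1 16 (by decide), h16])
      (by rw [hs.1 17 (by decide), h17]) v25 (by rw [a26]; exact htr) hcS hSB hNB).mono le_rfl ?_
    rintro τ' - ⟨hb', h27⟩
    refine ⟨hb', H, hH, (hval H).1 hHv, fun H' hH' hA => ?_, h27⟩
    obtain ⟨h1, h2⟩ := hcomp H' hH' ((hval H').2 hA)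
    have := hmin _ (hcdS H' hH') h1
    simp only at hv this
    rw [hv, hcard] at this
    have := this.trans h2
    omega

/-- The outcome for job `j` uses some chosen position. -/
def OutDone (σ₀ : State) (N j : ℕ) (σ : State) : Prop :=
  ∃ x < N, σ₀.arr 27 (x : ℕ) ≠ 0 ∧ σ₀.arr 22 ((j : ℤ) * N + x) ≠ 0 ∧
    σ.arr 10 (j : ℕ) = σ₀.arr 23 ((j : ℤ) * N + x) ∧ σ.arr 11 (j : ℕ) = σ₀.arr 13 (j : ℕ)

/-- Several chosen positions may suit a job. Later ones overwrite earlier ones, and any of them will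
do. -/
theorem outCmd_spec {Wd B N n : ℕ} {σ : State} (hB : 2 ≤ B) (hWd : B ^ solverExp ≤ Wd)
    (hb : σ.Bdd B) (h0 : σ.vars 0 = n) (h16 : σ.vars 16 = N) (hn : n ≤ B) (hN : N ≤ B)
    (hu : ∀ j < n, ∃ x < N, σ.arr 27 (x : ℕ) ≠ 0 ∧ σ.arr 22 ((j : ℤ) * N + (x : ℕ)) ≠ 0) :
    Tr Wd outCmd σ (n * (N * (outBody.time + (Expr.var 16).cost + 10) + (Expr.var 16).cost + 10 +
        (Expr.var 0).cost + 10) + (Expr.var 0).cost + 10)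
      (fun σ' => σ'.Bdd B ∧ ∀ j < n, OutDone σ N j σ') := by
  refine Tr.forTo (fun k σ' => ∀ j < k, OutDone σ N j σ') hB
    (fit hB hWd (wt_var_le 0)) hn (by decide)
    (by intro σ' hs; rw [Expr.val_var, hs.1 0 (by decide)]; exact h0) hb
    (by intro j hj; omega) ?_
  intro k hk σ' hs h20 hb' hd
  have inner := Tr.forTo (Wd := Wd) (n := N) (T := outBody.time) (i := 21) (e := .var 16)
    (c := outBody) (σ₀ := σ') (fun c τ => (∀ j < k, OutDone σ N j τ) ∧
      ((∃ x < c, σ.arr 27 (x : ℕ) ≠ 0 ∧ σ.arr 22 ((k : ℤ) * N + (x : ℕ)) ≠ 0) →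
        OutDone σ N k τ)) hB
    (fit hB hWd (wt_var_le 16)) hN (by decide)
    (by intro τ hτ; rw [Expr.val_var, hτ.1 16 (by decide), hs.1 16 (by decide)]; exact h16) hb'
    ⟨hd, by rintro ⟨x, hx, -⟩; omega⟩
    (by
      rintro c hc τ hτ h21 hbτ ⟨hd1, hd2⟩
      have v20 : τ.vars 20 = k := by rw [hτ.1 20 (by decide), h20]
      have v16 : τ.vars 16 = N := by rw [hτ.1 16 (by decide), hs.1 16 (by decide), h16]
      have a13 : τ.arr 13 = σ.arr 13 := (hτ.2 13 (by decide)).trans (hs.2 13 (by decide))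
      have a22 : τ.arr 22 = σ.arr 22 := (hτ.2 22 (by decide)).trans (hs.2 22 (by decide))
      have a23 : τ.arr 23 = σ.arr 23 := (hτ.2 23 (by decide)).trans (hs.2 23 (by decide))
      have a27 : τ.arr 27 = σ.arr 27 := (hτ.2 27 (by decide)).trans (hs.2 27 (by decide))
      have hcell : ∀ ρ : State, ρ.vars = τ.vars → cellE.val ρ = (k : ℤ) * N + c := by
        intro ρ hρ
        simp [cellE, hρ, v20, v16, h21]
      set p : Prop := σ.arr 27 (c : ℕ) ≠ 0 ∧ σ.arr 22 ((k : ℤ) * N + c) ≠ 0 with hp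
      have hT : ∀ ρ : State, ρ.vars = τ.vars → ρ.arr 27 = τ.arr 27 → ρ.arr 22 = τ.arr 22 →
          (useT.holds ρ ↔ p) := by
        intro ρ h1 h2 h3
        simp only [useT, Test.holds_not, Test.holds_eq, Expr.val_mul, Expr.val_get, hcell ρ h1,
          Expr.val_var, h1, h2, h3, h21, a22, a27, Expr.val_zero, mul_eq_zero, hp, not_or]
      refine Tr.block rfl hB hbτ (fit hB hWd (by unfold solverExp; omega)) ?_
      set u := if p then σ.arr 23 ((k : ℤ) * N + c) else τ.arr 10 k with hu'
      have e1 : (τ.setArr 10 k u).arr 27 = τ.arr 27 := by funext z; simp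
      have e2 : (τ.setArr 10 k u).arr 22 = τ.arr 22 := by funext z; simp
      have hrun : outBody.run τ = (τ.setArr 10 k u).setArr 11 k
          (if p then σ.arr 13 k else τ.arr 11 k) := by
        simp only [outBody, Cmd.run_seq, Cmd.run_store, Expr.val_ite, hT τ rfl rfl rfl,
          Expr.val_get, Expr.val_var, hcell τ rfl, v20, a23]
        rw [← hu']
        have e3 := hT (τ.setArr 10 k u) rfl e1 e2
        simp only [State.setArr_vars, v20, State.setArr_arr, a13]
        simp [e3]
      rw [hrun]
      refine ⟨(hbτ.setArr ?_).setArr ?_, ?_, ?_⟩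
      · rw [hu']
        split_ifs
        · rw [← a23]; exact hbτ.2 _ _
        · exact hbτ.2 _ _
      · split_ifs
        · rw [← a13]; exact hbτ.2 _ _
        · exact hbτ.2 _ _
      · intro j hj
        obtain ⟨x, hx, x1, x2, x3, x4⟩ := hd1 j hj
        exact ⟨x, hx, x1, x2, by simpa [show j ≠ k by omega] using x3, by simpa [show j ≠ k by omega] using x4⟩
      · rintro ⟨x, hx, h1, h2⟩
        by_cases hpp : p
        · exact ⟨c, hc, hpp.1, hpp.2, by simp [hu', hpp], by simp [hpp]⟩
        · have hxc : x < c := by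
            rcases Nat.lt_succ_iff_lt_or_eq.1 hx with h | rfl
            · exact h
            · exact absurd ⟨h1, h2⟩ hpp
          obtain ⟨y, hy, y1, y2, y3, y4⟩ := hd2 ⟨x, hxc, h1, h2⟩
          exact ⟨y, hy, y1, y2, by simpa [hu', hpp] using y3, by simpa [hpp] using y4⟩)
  refine inner.mono le_rfl ?_
  rintro τ - ⟨hbτ, hd1, hd2⟩
  refine ⟨hbτ, ?_⟩
  intro j hj
  rcases Nat.lt_succ_iff_lt_or_eq.1 hj with h | rfl
  · exact hd1 j h
  · exact hd2 (hu j hk)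

/-! ### From train paths to intervals on the integer line -/

/-- The train is inside the section exactly during `[t + δ l₁ / L, t + δ l₂ / L]`, and this interval
has to meet `[s, s + p]`. -/
theorem exists_meet {t δ l₁ l₂ L s p : ℝ} (hL : 0 < L) (hδ : 0 < δ) (hp : 0 ≤ p) (h1 : 0 ≤ l₁)
    (h12 : l₁ ≤ l₂) (h2 : l₂ ≤ L) :
    (∃ x, 0 ≤ x ∧ x ≤ 1 ∧ (s ≤ t + x * δ ∧ t + x * δ ≤ s + p) ∧ l₁ ≤ x * L ∧ x * L ≤ l₂) ↔
      t + δ * l₁ / L - p ≤ s ∧ s ≤ t + δ * l₂ / L := by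
  have e (l : ℝ) : δ * l / L = l / L * δ := by ring
  constructor
  · rintro ⟨x, x0, x1, ⟨hs, hsp⟩, hx1, hx2⟩
    have i1 : l₁ / L * δ ≤ x * δ := mul_le_mul_of_nonneg_right ((div_le_iff₀ hL).2 hx1) hδ.le
    have i2 : x * δ ≤ l₂ / L * δ := mul_le_mul_of_nonneg_right ((le_div_iff₀ hL).2 hx2) hδ.le
    rw [e, e]
    constructor <;> linarith
  · rw [e, e]
    rintro ⟨hs1, hs2⟩
    have d12 : l₁ / L ≤ l₂ / L := div_le_div_of_nonneg_right h12 hL.le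
    have d2 : l₂ / L ≤ 1 := (div_le_one hL).2 h2
    have d1 : 0 ≤ l₁ / L := div_nonneg h1 hL.le
    have hx : (s - t) / δ * δ = s - t := div_mul_cancel₀ _ hδ.ne'
    have hx2 : (s - t) / δ ≤ l₂ / L := by
      rw [div_le_iff₀ hδ]
      linarith
    -- The first moment at which the train has reached the section and the job has started.
    refine ⟨max (l₁ / L) ((s - t) / δ), d1.trans (le_max_left _ _),
      (max_le d12 hx2).trans d2, ⟨?_, ?_⟩, ?_, ?_⟩
    · have := mul_le_mul_of_nonneg_right (le_max_right (l₁ / L) ((s - t) / δ)) hδ.le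
      linarith
    · rcases max_choice (l₁ / L) ((s - t) / δ) with h | h <;> rw [h] <;> linarith
    · rw [← div_le_iff₀ hL]
      exact le_max_left _ _
    · rw [← le_div_iff₀ hL]
      exact max_le d12 hx2

section
variable {I : Inst} (hI : I.IsValid) (j : Fin I.n) (s : ℝ) (i : Fin I.m)
include hI

theorem inl_mem_cancelled : Sum.inl i ∈ I.cancelled j s ↔
    ((i : ℕ) + 1) * (I.Δ : ℝ) + (I.δ * (I.job j).ls / I.L - (I.job j).p) ≤ s ∧
      s ≤ ((i : ℕ) + 1) * (I.Δ : ℝ) + I.δ * (I.job j).le / I.L := by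
  have hL : (0 : ℝ) < I.L := by exact_mod_cast hI.L_pos
  have hδ : (0 : ℝ) < I.δ := by exact_mod_cast hI.travel_pos
  have hp : (0 : ℝ) ≤ (I.job j).p := by exact_mod_cast hI.p_nonneg j
  have h1 : (0 : ℝ) ≤ (I.job j).ls := by exact_mod_cast hI.ls_nonneg j
  have h12 : ((I.job j).ls : ℝ) ≤ (I.job j).le := by exact_mod_cast hI.ls_le j
  have h2 : ((I.job j).le : ℝ) ≤ I.L := by exact_mod_cast hI.le_L j
  rw [← add_sub_assoc, ← exists_meet hL hδ hp h1 h12 h2]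
  simp only [Inst.cancelled, Inst.seg, Inst.box, Set.mem_ofPred_eq, segment_eq_image']
  constructor
  · rintro ⟨z, ⟨x, hx, rfl⟩, hz⟩
    simp only [Set.mem_prod, Set.mem_Icc, Prod.fst_add, Prod.snd_add, Prod.smul_fst,
      Prod.smul_snd, Prod.fst_sub, Prod.snd_sub, smul_eq_mul, add_sub_cancel_left, sub_zero,
      zero_add] at hz
    exact ⟨x, hx.1, hx.2, hz⟩
  · rintro ⟨x, x0, x1, h⟩
    refine ⟨_, ⟨x, ⟨x0, x1⟩, rfl⟩, ?_⟩
    simp only [Set.mem_prod, Set.mem_Icc, Prod.fst_add, Prod.snd_add, Prod.smul_fst,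
      Prod.smul_snd, Prod.fst_sub, Prod.snd_sub, smul_eq_mul, add_sub_cancel_left, sub_zero,
      zero_add]
    exact h

/-- The reflection `l ↦ L - l` turns a down-path into an up-path and exchanges the ends of the
section. -/
theorem inr_mem_cancelled : Sum.inr i ∈ I.cancelled j s ↔
    ((i : ℕ) + 1) * (I.Δ : ℝ) + (I.δ - I.δ * (I.job j).le / I.L - (I.job j).p) ≤ s ∧
      s ≤ ((i : ℕ) + 1) * (I.Δ : ℝ) + (I.δ - I.δ * (I.job j).ls / I.L) := by
  have hL : (0 : ℝ) < I.L := by exact_mod_cast hI.L_pos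
  have hδ : (0 : ℝ) < I.δ := by exact_mod_cast hI.travel_pos
  have hp : (0 : ℝ) ≤ (I.job j).p := by exact_mod_cast hI.p_nonneg j
  have h1 : (0 : ℝ) ≤ (I.job j).ls := by exact_mod_cast hI.ls_nonneg j
  have h12 : ((I.job j).ls : ℝ) ≤ (I.job j).le := by exact_mod_cast hI.ls_le j
  have h2 : ((I.job j).le : ℝ) ≤ I.L := by exact_mod_cast hI.le_L j
  have e (l : ℝ) : (I.δ : ℝ) * (I.L - l) / I.L = I.δ - I.δ * l / I.L := by
    field_simp
  rw [← add_sub_assoc, ← e, ← e, exists_meet hL hδ hp (sub_nonneg.2 h2)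
    (sub_le_sub_left h12 _) (sub_le_self _ h1) |>.symm]
  simp only [Inst.cancelled, Inst.seg, Inst.box, Set.mem_ofPred_eq, segment_eq_image']
  constructor
  · rintro ⟨z, ⟨x, hx, rfl⟩, hz⟩
    simp only [Set.mem_prod, Set.mem_Icc, Prod.fst_add, Prod.snd_add, Prod.smul_fst,
      Prod.smul_snd, Prod.fst_sub, Prod.snd_sub, smul_eq_mul, add_sub_cancel_left] at hz
    refine ⟨x, hx.1, hx.2, hz.1, ?_, ?_⟩ <;> linarith [hz.2.1, hz.2.2]
  · rintro ⟨x, x0, x1, h, h3, h4⟩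
    refine ⟨_, ⟨x, ⟨x0, x1⟩, rfl⟩, ?_⟩
    simp only [Set.mem_prod, Set.mem_Icc, Prod.fst_add, Prod.snd_add, Prod.smul_fst,
      Prod.smul_snd, Prod.fst_sub, Prod.snd_sub, smul_eq_mul, add_sub_cancel_left]
    refine ⟨h, ?_, ?_⟩ <;> linarith

end

/-! ### Scaling to integer data. -/

/-- Even integers that describe job `j` if the unit of time is divided by `Q`. -/
structure Scaled (I : Inst) (j : Fin I.n) (Q D w a b r e : ℤ) : Prop where
  pos : 0 < Q
  even : 2 ∣ D ∧ 2 ∣ w ∧ 2 ∣ a ∧ 2 ∣ b ∧ 2 ∣ r ∧ 2 ∣ e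
  D_eq : (D : ℚ) = Q * I.Δ
  w_eq : (w : ℚ) = Q * ((I.job j).p + I.δ * (I.job j).le / I.L - I.δ * (I.job j).ls / I.L)
  a_eq : (a : ℚ) = Q * (I.δ * (I.job j).ls / I.L - (I.job j).p)
  b_eq : (b : ℚ) = Q * (I.δ - I.δ * (I.job j).le / I.L - (I.job j).p)
  r_eq : (r : ℚ) = Q * (I.job j).r
  e_eq : (e : ℚ) = Q * ((I.job j).d - (I.job j).p)

theorem scaled_div {Q x c : ℤ} (hc : 0 < c) (h : 2 * c ∣ Q) :
    2 ∣ Q * x / c ∧ ((Q * x / c : ℤ) : ℚ) = Q * (x / c) := by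
  obtain ⟨k, rfl⟩ := h
  have e : 2 * c * k * x / c = 2 * (k * x) := by
    rw [show 2 * c * k * x = c * (2 * (k * x)) by ring, Int.mul_ediv_cancel_left _ hc.ne']
  rw [e]
  refine ⟨dvd_mul_right _ _, ?_⟩
  have : (c : ℚ) ≠ 0 := by exact_mod_cast hc.ne'
  push_cast
  field_simp

/-- `scaleE` contains every denominator of the data. It also contains the numerator of `L`, because
locations are divided by `L`. Its factor `2` makes all scaled quantities even. -/
theorem scaled_input {I : Inst} (hI : I.IsValid) (j : Fin I.n) :
    Scaled I j (scaleE.val (I.input.setVar 20 (j : ℕ))) (headwayE.val (I.input.setVar 20 (j : ℕ)))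
      (lengthE.val (I.input.setVar 20 (j : ℕ))) (upE.val (I.input.setVar 20 (j : ℕ)))
      (downE.val (I.input.setVar 20 (j : ℕ))) (releaseE.val (I.input.setVar 20 (j : ℕ)))
      (latestE.val (I.input.setVar 20 (j : ℕ))) := by
  set σ := I.input.setVar 20 (j : ℕ) with hσ
  have v20 : σ.vars 20 = (j : ℕ) := by simp [hσ]
  have v2 : σ.vars 2 = I.L.num := by simp [hσ, Inst.input, Inst.globalData]
  have v3 : σ.vars 3 = I.L.den := by simp [hσ, Inst.input, Inst.globalData]
  have v4 : σ.vars 4 = I.Δ.num := by simp [hσ, Inst.input, Inst.globalData]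
  have v5 : σ.vars 5 = I.Δ.den := by simp [hσ, Inst.input, Inst.globalData]
  have v6 : σ.vars 6 = I.δ.num := by simp [hσ, Inst.input, Inst.globalData]
  have v7 : σ.vars 7 = I.δ.den := by simp [hσ, Inst.input, Inst.globalData]
  have ar (a : ℕ) : σ.arr a (j : ℕ) = (I.job j).data a := by
    simp [hσ, Inst.input]
  obtain ⟨Q, hQ⟩ : ∃ Q, scaleE.val σ = Q := ⟨_, rfl⟩
  have hQ' : Q = 2 * I.Δ.den * (I.job j).r.den * (I.job j).d.den * (I.job j).p.den * I.δ.den *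
      (I.job j).ls.den * (I.job j).le.den * I.L.num := by
    rw [← hQ]
    simp [scaleE, v20, v2, v5, v7, ar, Job.data]
  have hLn : 0 < I.L.num := Rat.num_pos.2 hI.L_pos
  have dp (x : ℚ) : (0 : ℤ) < x.den := by exact_mod_cast x.den_pos
  have jobV (e : Expr) (k : ℕ) (he : e.val σ = Q) :
      (jobExpr e k).val σ = Q * (I.job j).data k / (I.job j).data (k + 1) := by
    simp [jobExpr, he, v20, ar]
  have runV (k : ℕ) : (runE k).val σ = Q * (I.δ.num * (I.job j).data k * I.L.den) /
      (I.δ.den * (I.job j).data (k + 1) * I.L.num) := by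
    simp [runE, hQ, v20, ar, v6, v3, v7, v2, mul_assoc]
  have div (x y : ℚ) : (x.num : ℚ) / (x.den : ℤ) = x := by exact_mod_cast x.num_div_den
  have frac (x : ℚ) : (x.num : ℚ) / ((x.den : ℤ) : ℚ) = x := by exact_mod_cast x.num_div_den
  have runF (x : ℚ) : ((I.δ.num * x.num * I.L.den : ℤ) : ℚ) / ((I.δ.den * x.den * I.L.num : ℤ) : ℚ) =
      I.δ * x / I.L := by
    conv_rhs => rw [← frac I.δ, ← frac x, ← frac I.L]
    push_cast
    have := hLn.ne'
    field_simp
  have hr := scaled_div (Q := Q) (x := (I.job j).r.num) (dp (I.job j).r) (by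
    rw [hQ']; exact ⟨I.Δ.den * (I.job j).d.den * (I.job j).p.den * I.δ.den *
      (I.job j).ls.den * (I.job j).le.den * I.L.num, by ring⟩)
  have hd := scaled_div (Q := Q) (x := (I.job j).d.num) (dp (I.job j).d) (by
    rw [hQ']; exact ⟨I.Δ.den * (I.job j).r.den * (I.job j).p.den * I.δ.den *
      (I.job j).ls.den * (I.job j).le.den * I.L.num, by ring⟩)
  have hp := scaled_div (Q := Q) (x := (I.job j).p.num) (dp (I.job j).p) (by
    rw [hQ']; exact ⟨I.Δ.den * (I.job j).r.den * (I.job j).d.den * I.δ.den *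
      (I.job j).ls.den * (I.job j).le.den * I.L.num, by ring⟩)
  have hΔ := scaled_div (Q := Q) (x := I.Δ.num) (dp I.Δ) (by
    rw [hQ']; exact ⟨(I.job j).r.den * (I.job j).d.den * (I.job j).p.den * I.δ.den *
      (I.job j).ls.den * (I.job j).le.den * I.L.num, by ring⟩)
  have hδ := scaled_div (Q := Q) (x := I.δ.num) (dp I.δ) (by
    rw [hQ']; exact ⟨I.Δ.den * (I.job j).r.den * (I.job j).d.den * (I.job j).p.den *
      (I.job j).ls.den * (I.job j).le.den * I.L.num, by ring⟩)
  have hls := scaled_div (Q := Q) (x := I.δ.num * (I.job j).ls.num * I.L.den)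
    (mul_pos (mul_pos (dp I.δ) (dp (I.job j).ls)) hLn) (by
    rw [hQ']; exact ⟨I.Δ.den * (I.job j).r.den * (I.job j).d.den * (I.job j).p.den *
      (I.job j).le.den, by ring⟩)
  have hle := scaled_div (Q := Q) (x := I.δ.num * (I.job j).le.num * I.L.den)
    (mul_pos (mul_pos (dp I.δ) (dp (I.job j).le)) hLn) (by
    rw [hQ']; exact ⟨I.Δ.den * (I.job j).r.den * (I.job j).d.den * (I.job j).p.den *
      (I.job j).ls.den, by ring⟩)
  rw [frac] at hr hd hp hΔ hδ
  rw [runF] at hls hle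
  have e0 := jobV scaleE 0 hQ
  have e2 := jobV scaleE 2 hQ
  have e4 := jobV scaleE 4 hQ
  have e6 := runV 6
  have e8 := runV 8
  simp only [Job.data] at e0 e2 e4 e6 e8
  have eD : headwayE.val σ = Q * I.Δ.num / I.Δ.den := by simp [headwayE, hQ, v4, v5]
  have eδ : (scaleE * .var 6 / .var 7 : Expr).val σ = Q * I.δ.num / I.δ.den := by simp [hQ, v6, v7]
  simp only [lengthE, upE, downE, releaseE, latestE, Expr.val_sub, Expr.val_add _ (jobExpr _ _),
    e0, e2, e4, e6, e8, eD, eδ, hQ]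
  refine ⟨?_, ⟨hΔ.1, dvd_sub (dvd_add hp.1 hle.1) hls.1, dvd_sub hls.1 hp.1,
    dvd_sub (dvd_sub hδ.1 hle.1) hp.1, hr.1, dvd_sub hd.1 hp.1⟩, hΔ.2, ?_, ?_, ?_, hr.2, ?_⟩
  · rw [hQ']
    have := dp I.Δ
    have := dp (I.job j).r
    have := dp (I.job j).d
    have := dp (I.job j).p
    have := dp I.δ
    have := dp (I.job j).ls
    have := dp (I.job j).le
    positivity
  all_goals push_cast [hp.2, hle.2, hls.2, hδ.2, hd.2]; ring

/-- Real numbers can be replaced by integers in comparisons with even integers. -/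
theorem exists_round (y : ℝ) : ∃ z : ℤ, ∀ x : ℤ, 2 ∣ x → ((x : ℝ) ≤ y ↔ x ≤ z) ∧ (y ≤ x ↔ z ≤ x) := by
  -- This is `y` if `y` is an even integer, and otherwise the odd integer between the two even
  -- neighbours of `y`.
  refine ⟨⌊y / 2⌋ + ⌈y / 2⌉, ?_⟩
  rintro _ ⟨x, rfl⟩
  have h1 : ⌊y / 2⌋ ≤ ⌈y / 2⌉ := Int.floor_le_ceil _
  have h2 : ⌈y / 2⌉ ≤ ⌊y / 2⌋ + 1 := Int.ceil_le_floor_add_one _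
  have h3 : x ≤ ⌊y / 2⌋ ↔ (x : ℝ) ≤ y / 2 := Int.le_floor
  have h4 : ⌈y / 2⌉ ≤ x ↔ y / 2 ≤ (x : ℝ) := Int.ceil_le
  constructor
  · rw [show ((2 * x : ℤ) : ℝ) ≤ y ↔ (x : ℝ) ≤ y / 2 by push_cast; constructor <;> intro h <;> linarith,
      ← h3]
    omega
  · rw [show y ≤ ((2 * x : ℤ) : ℝ) ↔ y / 2 ≤ x by push_cast; constructor <;> intro h <;> linarith,
      ← h4]
    omega

/-- Job `j` can be scheduled such that only path `l` is cancelled. -/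
def Inst.Single (I : Inst) (j : Fin I.n) (l : TrainPath I.m) : Prop :=
  ∃ s ∈ I.startTimes j, I.cancelled j s = {l}

namespace Scaled

variable {I : Inst} {j : Fin I.n} {Q D w a b r e : ℤ} (h : Scaled I j Q D w a b r e)
include h

theorem mem_inl (hI : I.IsValid) (s : ℝ) (i : Fin I.m) : Sum.inl i ∈ I.cancelled j s ↔
    ((((i : ℕ) + 1) * D + a : ℤ) : ℝ) ≤ Q * s ∧ Q * s ≤ ((((i : ℕ) + 1) * D + a + w : ℤ) : ℝ) := by
  have hQ : (0 : ℝ) < Q := by exact_mod_cast h.pos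
  have eD : (D : ℝ) = Q * I.Δ := by exact_mod_cast congrArg (Rat.cast : ℚ → ℝ) h.D_eq
  have ew : (w : ℝ) = Q * ((I.job j).p + I.δ * (I.job j).le / I.L - I.δ * (I.job j).ls / I.L) := by
    exact_mod_cast congrArg (Rat.cast : ℚ → ℝ) h.w_eq
  have ea : (a : ℝ) = Q * (I.δ * (I.job j).ls / I.L - (I.job j).p) := by
    exact_mod_cast congrArg (Rat.cast : ℚ → ℝ) h.a_eq
  have e1 : ((((i : ℕ) + 1) * D + a : ℤ) : ℝ) =
      Q * (((i : ℕ) + 1) * (I.Δ : ℝ) + (I.δ * (I.job j).ls / I.L - (I.job j).p)) := by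
    push_cast; rw [eD, ea]; ring
  have e2 : ((((i : ℕ) + 1) * D + a + w : ℤ) : ℝ) =
      Q * (((i : ℕ) + 1) * (I.Δ : ℝ) + I.δ * (I.job j).le / I.L) := by
    push_cast; rw [eD, ea, ew]; ring
  rw [inl_mem_cancelled hI, e1, e2, mul_le_mul_iff_right₀ hQ, mul_le_mul_iff_right₀ hQ]

theorem mem_inr (hI : I.IsValid) (s : ℝ) (i : Fin I.m) : Sum.inr i ∈ I.cancelled j s ↔
    ((((i : ℕ) + 1) * D + b : ℤ) : ℝ) ≤ Q * s ∧ Q * s ≤ ((((i : ℕ) + 1) * D + b + w : ℤ) : ℝ) := by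
  have hQ : (0 : ℝ) < Q := by exact_mod_cast h.pos
  have eD : (D : ℝ) = Q * I.Δ := by exact_mod_cast congrArg (Rat.cast : ℚ → ℝ) h.D_eq
  have ew : (w : ℝ) = Q * ((I.job j).p + I.δ * (I.job j).le / I.L - I.δ * (I.job j).ls / I.L) := by
    exact_mod_cast congrArg (Rat.cast : ℚ → ℝ) h.w_eq
  have eb : (b : ℝ) = Q * (I.δ - I.δ * (I.job j).le / I.L - (I.job j).p) := by
    exact_mod_cast congrArg (Rat.cast : ℚ → ℝ) h.b_eq
  have e1 : ((((i : ℕ) + 1) * D + b : ℤ) : ℝ) =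
      Q * (((i : ℕ) + 1) * (I.Δ : ℝ) + (I.δ - I.δ * (I.job j).le / I.L - (I.job j).p)) := by
    push_cast; rw [eD, eb]; ring
  have e2 : ((((i : ℕ) + 1) * D + b + w : ℤ) : ℝ) =
      Q * (((i : ℕ) + 1) * (I.Δ : ℝ) + (I.δ - I.δ * (I.job j).ls / I.L)) := by
    push_cast; rw [eD, eb, ew]; ring
  rw [inr_mem_cancelled hI, e1, e2, mul_le_mul_iff_right₀ hQ, mul_le_mul_iff_right₀ hQ]

theorem mem_startTimes (s : ℝ) : s ∈ I.startTimes j ↔ (r : ℝ) ≤ Q * s ∧ Q * s ≤ (e : ℝ) := by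
  have hQ : (0 : ℝ) < Q := by exact_mod_cast h.pos
  have er : (r : ℝ) = Q * (I.job j).r := by exact_mod_cast congrArg (Rat.cast : ℚ → ℝ) h.r_eq
  have ee : (e : ℝ) = Q * ((I.job j).d - (I.job j).p) := by
    exact_mod_cast congrArg (Rat.cast : ℚ → ℝ) h.e_eq
  rw [er, ee, mul_le_mul_iff_right₀ hQ, mul_le_mul_iff_right₀ hQ]
  rfl

theorem mul_div_self (z : ℤ) : (Q : ℝ) * ((z : ℝ) / Q) = z :=
  mul_div_cancel₀ _ (by exact_mod_cast h.pos.ne')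

theorem div_mem_startTimes (z : ℤ) : (z : ℝ) / Q ∈ I.startTimes j ↔ r ≤ z ∧ z ≤ e := by
  rw [h.mem_startTimes, h.mul_div_self, Int.cast_le, Int.cast_le]

theorem covers_inl (hI : I.IsValid) (z : ℤ) (i : Fin I.m) :
    Sum.inl i ∈ I.cancelled j (z / Q) ↔ Covers I.m D w a ((i : ℕ) + 1) z := by
  rw [h.mem_inl hI, h.mul_div_self, Int.cast_le, Int.cast_le, Covers]
  have := i.2
  omega

theorem covers_inr (hI : I.IsValid) (z : ℤ) (i : Fin I.m) :
    Sum.inr i ∈ I.cancelled j (z / Q) ↔ Covers I.m D w b ((i : ℕ) + 1) z := by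
  rw [h.mem_inr hI, h.mul_div_self, Int.cast_le, Int.cast_le, Covers]
  have := i.2
  omega

/-- All breakpoints of the cancelled set are even after scaling, so by `exists_round` an odd integer
can represent each open gap between consecutive even integers. -/
theorem exists_int (hI : I.IsValid) {s : ℝ} (hs : s ∈ I.startTimes j) :
    ∃ z : ℤ, r ≤ z ∧ z ≤ e ∧ I.cancelled j s = I.cancelled j (z / Q) := by
  obtain ⟨z, hz⟩ := exists_round (Q * s)
  obtain ⟨hD, hw, ha, hb, hr, he⟩ := h.even
  rw [h.mem_startTimes] at hs
  refine ⟨z, (hz r hr).1.1 hs.1, (hz e he).2.1 hs.2, ?_⟩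
  ext l
  rcases l with i | i
  · have d1 : 2 ∣ ((i : ℕ) + 1) * D + a := dvd_add (Dvd.dvd.mul_left hD _) ha
    rw [h.mem_inl hI, h.mem_inl hI, h.mul_div_self, (hz _ d1).1, (hz _ (dvd_add d1 hw)).2,
      Int.cast_le, Int.cast_le]
  · have d1 : 2 ∣ ((i : ℕ) + 1) * D + b := dvd_add (Dvd.dvd.mul_left hD _) hb
    rw [h.mem_inr hI, h.mem_inr hI, h.mul_div_self, (hz _ d1).1, (hz _ (dvd_add d1 hw)).2,
      Int.cast_le, Int.cast_le]

theorem cancelled_eq_inl (hI : I.IsValid) (z : ℤ) (i : Fin I.m) :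
    I.cancelled j (z / Q) = {Sum.inl i} ↔ Solo I.m D w a b ((i : ℕ) + 1) z := by
  rw [Set.eq_singleton_iff_unique_mem, h.covers_inl hI, Solo]
  refine and_congr_right fun _ => ⟨fun H => ⟨fun k hk => ?_, fun k hk => ?_⟩, fun H l hl => ?_⟩
  · have := H (Sum.inl ⟨(k - 1).toNat, by have := hk.1; have := hk.2.1; omega⟩)
      ((h.covers_inl hI z _).2 (by
        have := hk.1
        rwa [show (((k - 1).toNat : ℕ) : ℤ) + 1 = k by omega]))
    have := congrArg Fin.val (Sum.inl.inj this)
    simp only at this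
    have := hk.1
    omega
  · have := H (Sum.inr ⟨(k - 1).toNat, by have := hk.1; have := hk.2.1; omega⟩)
      ((h.covers_inr hI z _).2 (by
        have := hk.1
        rwa [show (((k - 1).toNat : ℕ) : ℤ) + 1 = k by omega]))
    exact absurd this (by simp)
  · rcases l with k | k
    · have := H.1 _ ((h.covers_inl hI z k).1 hl)
      congr 1
      ext
      omega
    · exact absurd ((h.covers_inr hI z k).1 hl) (H.2 _)

theorem cancelled_eq_inr (hI : I.IsValid) (z : ℤ) (i : Fin I.m) :
    I.cancelled j (z / Q) = {Sum.inr i} ↔ Solo I.m D w b a ((i : ℕ) + 1) z := by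
  rw [Set.eq_singleton_iff_unique_mem, h.covers_inr hI, Solo]
  refine and_congr_right fun _ => ⟨fun H => ⟨fun k hk => ?_, fun k hk => ?_⟩, fun H l hl => ?_⟩
  · have := H (Sum.inr ⟨(k - 1).toNat, by have := hk.1; have := hk.2.1; omega⟩)
      ((h.covers_inr hI z _).2 (by
        have := hk.1
        rwa [show (((k - 1).toNat : ℕ) : ℤ) + 1 = k by omega]))
    have := congrArg Fin.val (Sum.inr.inj this)
    simp only at this
    have := hk.1
    omega
  · have := H (Sum.inl ⟨(k - 1).toNat, by have := hk.1; have := hk.2.1; omega⟩)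
      ((h.covers_inl hI z _).2 (by
        have := hk.1
        rwa [show (((k - 1).toNat : ℕ) : ℤ) + 1 = k by omega]))
    exact absurd this (by simp)
  · rcases l with k | k
    · exact absurd ((h.covers_inl hI z k).1 hl) (H.2 _)
    · have := H.1 _ ((h.covers_inr hI z k).1 hl)
      congr 1
      ext
      omega

/-- By parity, a gap between consecutive intervals contains an integer point, as it contains real
points. -/
theorem gap : w < D → w + 2 ≤ D := by
  obtain ⟨⟨D', rfl⟩, ⟨w', rfl⟩, -⟩ := h.even
  omega

theorem D_pos (hI : I.IsValid) : 0 < D := by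
  have : (0 : ℚ) < D := by
    rw [h.D_eq]
    exact mul_pos (by exact_mod_cast h.pos) hI.headway_pos
  exact_mod_cast this

theorem w_nonneg (hI : I.IsValid) : 0 ≤ w := by
  have : (0 : ℚ) ≤ w := by
    rw [h.w_eq, add_sub_assoc, ← sub_div, ← mul_sub]
    have := hI.p_nonneg j
    have := sub_nonneg.2 (hI.ls_le j)
    have := hI.L_pos
    have := hI.travel_pos
    have : (0 : ℚ) < Q := by exact_mod_cast h.pos
    positivity
  exact_mod_cast this

/-- The processing time cancels in `b - a`, which is `Q * (δ - δ ls / L - δ le / L)` and hence at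
most `Q * δ` in absolute value. -/
theorem abs_sub_lt (hI : I.IsValid) {κ : ℤ} (hκ : I.δ < (κ + 1) * I.Δ) :
    |b - a| < (κ + 1) * D := by
  have hQ : (0 : ℚ) < Q := by exact_mod_cast h.pos
  have h1 : (0 : ℚ) ≤ I.δ * (I.job j).ls / I.L :=
    div_nonneg (mul_nonneg hI.travel_pos.le (hI.ls_nonneg j)) hI.L_pos.le
  have h2 : I.δ * (I.job j).le / I.L ≤ I.δ := by
    rw [div_le_iff₀ hI.L_pos]
    exact mul_le_mul_of_nonneg_left (hI.le_L j) hI.travel_pos.le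
  have h3 : I.δ * (I.job j).ls / I.L ≤ I.δ * (I.job j).le / I.L :=
    div_le_div_of_nonneg_right (mul_le_mul_of_nonneg_left (hI.ls_le j) hI.travel_pos.le) hI.L_pos.le
  have : |(b : ℚ) - a| < (κ + 1) * D := by
    rw [h.b_eq, h.a_eq, h.D_eq, ← mul_sub, abs_mul, abs_of_pos hQ,
      show (κ + 1 : ℚ) * (Q * I.Δ) = Q * ((κ + 1) * I.Δ) by ring]
    refine mul_lt_mul_of_pos_left (lt_of_le_of_lt ?_ hκ) hQ
    rw [abs_le]
    constructor <;> linarith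
  exact_mod_cast this

theorem single_inl (hI : I.IsValid) (i : Fin I.m) :
    I.Single j (Sum.inl i) ↔ Hit I.m D w a b r e ((i : ℕ) + 1) := by
  rw [hit_iff (h.D_pos hI) h.gap]
  constructor
  · rintro ⟨s, hs, hc⟩
    obtain ⟨z, h1, h2, h3⟩ := h.exists_int hI hs
    exact ⟨z, h1, h2, (h.cancelled_eq_inl hI z i).1 (h3 ▸ hc)⟩
  · rintro ⟨z, h1, h2, h3⟩
    exact ⟨_, (h.div_mem_startTimes z).2 ⟨h1, h2⟩, (h.cancelled_eq_inl hI z i).2 h3⟩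

theorem single_inr (hI : I.IsValid) (i : Fin I.m) :
    I.Single j (Sum.inr i) ↔ Hit I.m D w b a r e ((i : ℕ) + 1) := by
  rw [hit_iff (h.D_pos hI) h.gap]
  constructor
  · rintro ⟨s, hs, hc⟩
    obtain ⟨z, h1, h2, h3⟩ := h.exists_int hI hs
    exact ⟨z, h1, h2, (h.cancelled_eq_inr hI z i).1 (h3 ▸ hc)⟩
  · rintro ⟨z, h1, h2, h3⟩
    exact ⟨_, (h.div_mem_startTimes z).2 ⟨h1, h2⟩, (h.cancelled_eq_inr hI z i).2 h3⟩

end Scaled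

/-! ### Reduction to a hitting set problem. -/

/-- Each set of cancelled paths contains a path that can be the only cancelled one. -/
theorem Inst.SingletonPossessions.exists_single {I : Inst} (hP : I.SingletonPossessions)
    {j : Fin I.n} {s : ℝ} (hs : s ∈ I.startTimes j) : ∃ l ∈ I.cancelled j s, I.Single j l := by
  -- Below any set in a finite family there is a minimal one, and minimal ones are singletons by
  -- hypothesis.
  obtain ⟨R, hR, hmin⟩ := (Set.toFinite (I.allPossessions j)).exists_le_minimal ⟨s, hs, rfl⟩
  obtain ⟨l, rfl⟩ := Set.ncard_eq_one.1 (hP j R hmin)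
  obtain ⟨s', hs', hc⟩ := hmin.prop
  exact ⟨l, hR rfl, s', hs', hc⟩

theorem Scaled.covered {I : Inst} {j : Fin I.n} {Q D w a b r e : ℤ}
    (h : Scaled I j Q D w a b r e) (hI : I.IsValid) (hP : I.SingletonPossessions) (z : ℤ)
    (h1 : r ≤ z) (h2 : z ≤ e) : ∃ k, Covers I.m D w a k z ∨ Covers I.m D w b k z := by
  obtain ⟨l, hl, -⟩ := hP.exists_single ((h.div_mem_startTimes z).2 ⟨h1, h2⟩)
  rcases l with i | i
  · exact ⟨_, Or.inl ((h.covers_inl hI z i).1 hl)⟩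
  · exact ⟨_, Or.inr ((h.covers_inr hI z i).1 hl)⟩

/-- A smallest set of paths that contains a possession of each job yields an optimal solution. -/
theorem Inst.isOptimal_of_hitting {I : Inst} (hP : I.SingletonPossessions)
    {H : Finset (TrainPath I.m)} {s : Fin I.n → ℝ} (hs : I.IsFeasible s)
    (hH : ∀ j, ∃ l ∈ H, I.cancelled j (s j) = {l})
    (hmin : ∀ H' : Finset (TrainPath I.m), (∀ j, ∃ l ∈ H', I.Single j l) → H.card ≤ H'.card) :
    I.IsOptimal s := by
  refine ⟨hs, fun s' hs' => ?_⟩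
  have h1 : I.cost s ≤ H.card := by
    rw [← Set.ncard_coe_finset]
    refine Set.ncard_le_ncard (Set.iUnion_subset fun j => ?_) (Finset.finite_toSet H)
    obtain ⟨l, hl, hc⟩ := hH j
    rw [hc, Set.singleton_subset_iff]
    exact hl
  refine h1.trans ?_
  classical
  rw [Inst.cost, Set.ncard_eq_toFinset_card' ]
  -- The paths that an arbitrary feasible `s'` cancels form a hitting set themselves.
  refine hmin _ fun j => ?_
  obtain ⟨l, hl, hs⟩ := hP.exists_single (hs' j)
  exact ⟨l, by simpa using ⟨j, hl⟩, hs⟩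

/-! ### Shape of the possessions of one job, and compression of the path numbers. -/

/-- Assumptions on the scaled data of a job. -/
structure Admissible (m D w a b r e κ : ℤ) : Prop where
  D_pos : 0 < D
  gap : w < D → w + 2 ≤ D
  w_nonneg : 0 ≤ w
  κ_nonneg : 0 ≤ κ
  sub : |b - a| < (κ + 1) * D
  cov : ∀ z, r ≤ z → z ≤ e → ∃ k, Covers m D w a k z ∨ Covers m D w b k z

namespace Admissible

variable {m D w a b r e κ : ℤ} (g : Admissible m D w a b r e κ) {a' b' i : ℤ}
  (hab : a' = a ∧ b' = b ∨ a' = b ∧ b' = a)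
include g hab

theorem near_ends (hw : D ≤ w) (h : Hit m D w a' b' r e i) : i ≤ κ + 1 ∨ m - κ ≤ i := by
  obtain ⟨-, -, hs⟩ := h.solo g.D_pos g.gap
  refine hs.near_ends g.D_pos hw ?_
  rcases hab with ⟨rfl, rfl⟩ | ⟨rfl, rfl⟩
  · rw [abs_sub_comm]; exact g.sub
  · exact g.sub

/-- Both directions are measured from the same offset `a`, so that two blocks of numbers per job
suffice. -/
theorem sub_center : |a' - a| < (κ + 1) * D := by
  rcases hab with ⟨rfl, rfl⟩ | ⟨rfl, rfl⟩
  · rw [sub_self, abs_zero]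
    exact mul_pos (by have := g.κ_nonneg; omega) g.D_pos
  · exact g.sub

theorem range (hw : w < D) (h : Hit m D w a' b' r e i) :
    (r - a) / D - (κ + 2) ≤ i ∧ i ≤ (e - a) / D + (κ + 2) := by
  obtain ⟨h1, h2, hs⟩ := h.solo g.D_pos g.gap
  exact hs.1.index_mem g.D_pos hw (g.sub_center hab) h1 h2

theorem middle (hw : w < D) (h1 : 1 ≤ i) (hm : i ≤ m) (hr : (r - a) / D + (κ + 2) ≤ i)
    (he : i ≤ (e - a) / D - (κ + 2)) : Hit m D w a' b' r e i := by
  rw [hit_iff g.D_pos g.gap]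
  refine exists_solo g.D_pos g.w_nonneg (g.gap hw) (g.sub_center hab) (fun s hs1 hs2 => ?_) h1 hm
    hr he
  obtain ⟨k, hk⟩ := g.cov s hs1 hs2
  rcases hab with ⟨rfl, rfl⟩ | ⟨rfl, rfl⟩
  · exact ⟨k, hk⟩
  · exact ⟨k, hk.symm⟩

end Admissible

/-- An increasing list of path numbers, preceded by `0`, that contains all numbers within distance
`h` of the numbers `0`, `m + 1`, `ρ`, `ε`. -/
structure Grid (m : ℤ) (h : ℕ) (ρ ε : ℤ) (tt : ℤ → ℤ) (cnt : ℕ) : Prop where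
  pos : 1 ≤ cnt
  zero : tt 0 = 0
  lt : ∀ i j : ℕ, i < j → j < cnt → tt i < tt j
  mem : ∀ i : ℕ, 1 ≤ i → i < cnt → 1 ≤ tt i ∧ tt i ≤ m
  near : ∀ x, 1 ≤ x → x ≤ m → (x ≤ h ∨ m + 1 - h ≤ x ∨ ρ - h ≤ x ∧ x ≤ ρ + h ∨
    ε - h ≤ x ∧ x ≤ ε + h) → ∃ i : ℕ, 1 ≤ i ∧ i < cnt ∧ tt i = x
  rest : ∀ i : ℕ, cnt ≤ i → tt i = 0

/-- Position `c` of the list, taken for the upward path if `c` is even and for the downward path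
otherwise, is a possession. -/
def PosHit (m D w a b r e : ℤ) (tt : ℤ → ℤ) (c : ℕ) : Prop :=
  Hit m D w (if (c : ℤ) % 2 = 0 then a else b) (if (c : ℤ) % 2 = 0 then b else a) r e
    (tt ((c : ℤ) / 2))

theorem ite_family (c : ℕ) (a b : ℤ) :
    (if (c : ℤ) % 2 = 0 then a else b) = a ∧ (if (c : ℤ) % 2 = 0 then b else a) = b ∨
    (if (c : ℤ) % 2 = 0 then a else b) = b ∧ (if (c : ℤ) % 2 = 0 then b else a) = a := by
  split_ifs <;> simp

namespace Grid

variable {m ρ ε : ℤ} {h cnt : ℕ} {tt : ℤ → ℤ} (G : Grid m h ρ ε tt cnt)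
include G

theorem add_le (i d : ℕ) (hd : i + d < cnt) : tt i + d ≤ tt (i + d : ℕ) := by
  induction d with
  | zero => simp
  | succ d ih =>
    have h1 := ih (by omega)
    have h2 := G.lt (i + d) (i + (d + 1)) (by omega) hd
    push_cast at h1 h2 ⊢
    omega

/-- Compression does not increase distances, since the listed numbers are strictly increasing
integers. -/
theorem sub_le {i j : ℕ} (hij : i ≤ j) (hj : j < cnt) : (j : ℤ) - i ≤ tt j - tt i := by
  have := G.add_le i (j - i) (by omega)
  rw [show i + (j - i) = j by omega] at this
  omega

theorem lt_of_one_le {i : ℕ} (hi : 1 ≤ tt i) : 1 ≤ i ∧ i < cnt := by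
  constructor
  · by_contra h0
    rw [show i = 0 by omega] at hi
    have := G.zero
    push_cast at hi
    omega
  · by_contra h0
    have := G.rest i (by omega)
    omega

/-- The first position, after the ghost, with a number that is at least `x`. -/
theorem exists_first (x : ℤ) : ∃ k : ℕ, 1 ≤ k ∧ k ≤ cnt ∧ (∀ i : ℕ, 1 ≤ i → i < k → tt i < x) ∧
    ∀ i : ℕ, k ≤ i → i < cnt → x ≤ tt i := by
  classical
  have ex : ∃ k : ℕ, 1 ≤ k ∧ (cnt ≤ k ∨ x ≤ tt k) := ⟨cnt, G.pos, Or.inl le_rfl⟩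
  obtain ⟨h1, h2⟩ := Nat.find_spec ex
  refine ⟨Nat.find ex, h1, Nat.find_min' ex ⟨G.pos, Or.inl le_rfl⟩, fun i hi hik => ?_,
    fun i hik hi => ?_⟩
  · by_contra! hx
    exact Nat.find_min ex hik ⟨hi, Or.inr hx⟩
  · have h3 : x ≤ tt (Nat.find ex) := h2.resolve_left (by omega)
    have := G.sub_le hik hi
    omega

end Grid

section
variable {m D w a b r e κ : ℤ} {h cnt : ℕ} {tt : ℤ → ℤ} (g : Admissible m D w a b r e κ)
  (G : Grid m h ((r - a) / D) ((e - a) / D) tt cnt) (hh : (h : ℤ) = m ∨ (h : ℤ) = κ + 2)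
include g G hh

/-- An unlisted hit `i` is far from all four centres. So `h = κ + 2`, the intervals are short, and
`i` lies strictly inside the middle range, where every number is a hit. The number `min m (ε - h)`
is listed and belongs to that range, so the next listed number after `i` does not leave it. -/
theorem Grid.hit_next {a' b' i : ℤ} (hab : a' = a ∧ b' = b ∨ a' = b ∧ b' = a)
    (hi : Hit m D w a' b' r e i) {k : ℕ} (hk : ∀ j : ℕ, 1 ≤ j → j < k → tt j < i)
    (hk' : ∀ j : ℕ, k ≤ j → j < cnt → i ≤ tt j) : k < cnt ∧ Hit m D w a' b' r e (tt k) := by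
  have listed : ∀ {q : ℕ}, 1 ≤ q → q < cnt → i ≤ tt q → k ≤ q := by
    intro q h1 h2 h3
    by_contra hlt
    have := hk q h1 (by omega)
    omega
  have h1 := hi.1
  have hm := hi.2.1
  by_cases hT : ∃ q : ℕ, 1 ≤ q ∧ q < cnt ∧ tt q = i
  · obtain ⟨q, q1, q2, rfl⟩ := hT
    have hkq := listed q1 q2 le_rfl
    refine ⟨by omega, ?_⟩
    rcases hkq.lt_or_eq with hlt | rfl
    · have := hk' k le_rfl (by omega)
      have := G.lt k q hlt q2
      omega
    · exact hi
  · have hnear := fun hx => hT (G.near i h1 hm hx)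
    obtain ⟨n1, n2, n3, n4⟩ : ¬ i ≤ h ∧ ¬ m + 1 - h ≤ i ∧
        ¬ ((r - a) / D - h ≤ i ∧ i ≤ (r - a) / D + h) ∧
        ¬ ((e - a) / D - h ≤ i ∧ i ≤ (e - a) / D + h) :=
      ⟨fun h => hnear (by tauto), fun h => hnear (by tauto), fun h => hnear (by tauto),
        fun h => hnear (by tauto)⟩
    have hκ : (h : ℤ) = κ + 2 := by omega
    rcases le_or_gt D w with hw | hw
    · have := g.near_ends hab hw hi
      omega
    · have hr := g.range hab hw hi
      have hκ0 := g.κ_nonneg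
      obtain ⟨q, q1, q2, q3⟩ := G.near (min m ((e - a) / D - h)) (by omega) (min_le_left _ _) (by
        rcases min_choice m ((e - a) / D - h) with hc | hc <;> rw [hc] <;> omega)
      have hkq := listed q1 q2 (by rw [q3]; omega)
      have hkc : k < cnt := by omega
      have l1 := hk' k le_rfl hkc
      have l2 := G.sub_le hkq q2
      refine ⟨hkc, g.middle hab hw (by omega) ?_ ?_ ?_⟩ <;> omega

/-- The uncertain zones at the ends of a range span about `2 * h` numbers each, hence about `4 * h`
positions, as a number has two positions. This is where the window length `4 * h + 4` comes from. -/
theorem Grid.local {c : ℕ} (hc : PosHit m D w a b r e tt c)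
    (hmax : ∀ x, PosHit m D w a b r e tt x → x ≤ c) :
    Local (4 * h + 4) (c + 1) (PosHit m D w a b r e tt) := by
  have hκ0 := g.κ_nonneg
  have two (x : ℕ) : (x : ℤ) / 2 = (x / 2 : ℕ) := by push_cast; rfl
  have valid {x : ℕ} (hx : PosHit m D w a b r e tt x) : 1 ≤ x / 2 ∧ x / 2 < cnt := by
    have h1 := hx.1
    rw [two] at h1
    exact G.lt_of_one_le h1
  have index_ge {q : ℕ} (hq : q < cnt) : (q : ℤ) ≤ tt q := by
    have := G.sub_le (Nat.zero_le q) hq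
    have := G.zero
    push_cast at *
    omega
  rcases hh with hm | hκ
  -- If `h = m`, there are so few numbers that all positions are among the first `4 * h + 4`.
  · refine Or.inl fun x hx => Or.inl ?_
    obtain ⟨v1, v2⟩ := valid hx
    have := index_ge v2
    have := (G.mem _ v1 v2).2
    omega
  · rcases le_or_gt D w with hw | hw
    -- Long intervals: hits are near one of the ends of `1, …, m`, hence among the first positions
    -- or close to the last hit `c`.
    · refine Or.inl fun x hx => ?_
      obtain ⟨v1, v2⟩ := valid hx
      obtain ⟨c1, c2⟩ := valid hc
      rcases g.near_ends (ite_family x a b) hw hx with hn | hn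
      · rw [two] at hn
        have := index_ge v2
        omega
      · rw [two] at hn
        have := hmax x hx
        have := G.sub_le (Nat.div_le_div_right (c := 2) this) c2
        have := (G.mem _ c1 c2).2
        omega
    -- Short intervals: `q` is the first position whose number is past the uncertain zone at the
    -- left end. The zone at the right end is within the last `4 * h + 4` positions.
    · obtain ⟨k, k1, k2, k3, k4⟩ := G.exists_first ((r - a) / D + h)
      refine Or.inr ⟨2 * k, fun x hx => ?_, fun x hx hxc => ?_⟩
      · obtain ⟨v1, v2⟩ := valid hx
        have hr := (g.range (ite_family x a b) hw hx).1
        rw [two] at hr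
        by_contra! hlt
        have := k3 (k - 1) (by omega) (by omega)
        have := G.sub_le (show x / 2 ≤ k - 1 by omega) (by omega)
        omega
      · obtain ⟨c1, c2⟩ := valid hc
        have hr := (g.range (ite_family c a b) hw hc).2
        rw [two] at hr
        have hxc2 : x / 2 ≤ c / 2 := by omega
        have h1 := k4 (x / 2) (by omega) (by omega)
        have h2 := G.sub_le hxc2 c2
        have h3 := G.mem (x / 2) (by omega) (by omega)
        refine g.middle (ite_family x a b) hw ?_ ?_ ?_ ?_ <;> rw [two] <;> omega

end

theorem Scaled.admissible {I : Inst} {j : Fin I.n} {Q D w a b r e κ : ℤ}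
    (h : Scaled I j Q D w a b r e) (hI : I.IsValid) (hP : I.SingletonPossessions) (hκ0 : 0 ≤ κ)
    (hκ : I.δ < (κ + 1) * I.Δ) : Admissible I.m D w a b r e κ :=
  ⟨h.D_pos hI, h.gap, h.w_nonneg hI, hκ0, h.abs_sub_lt hI hκ, h.covered hI hP⟩

/-- A number for each path. -/
def pathCode {m : ℕ} : TrainPath m → ℤ
  | Sum.inl i => 2 * ((i : ℕ) + 1)
  | Sum.inr i => 2 * ((i : ℕ) + 1) + 1

theorem pathCode_injective {m : ℕ} : Function.Injective (pathCode (m := m)) := by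
  rintro (i | i) (k | k) h <;> simp only [pathCode] at h
  · congr 1; ext; omega
  · omega
  · omega
  · congr 1; ext; omega

/-- The witness for position `c`. -/
def posWit (m D w a b r : ℤ) (tt : ℤ → ℤ) (c : ℕ) : ℤ :=
  wit m D w (if (c : ℤ) % 2 = 0 then a else b) (if (c : ℤ) % 2 = 0 then b else a) r
    (tt ((c : ℤ) / 2))

section
variable {I : Inst} {j : Fin I.n} {Q D w a b r e κ : ℤ} {tt : ℤ → ℤ}

theorem PosHit.cancelled (hI : I.IsValid) (hs : Scaled I j Q D w a b r e) {c : ℕ}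
    (hc : PosHit I.m D w a b r e tt c) :
    (posWit I.m D w a b r tt c : ℝ) / Q ∈ I.startTimes j ∧
      ∃ l : TrainPath I.m, pathCode l = 2 * tt ((c : ℤ) / 2) + (c : ℤ) % 2 ∧
        I.cancelled j ((posWit I.m D w a b r tt c : ℝ) / Q) = {l} := by
  obtain ⟨h1, h2, h3⟩ := hc.solo (hs.D_pos hI) hs.gap
  change Solo _ _ _ _ _ _ (posWit I.m D w a b r tt c) at h3
  refine ⟨(hs.div_mem_startTimes _).2 ⟨h1, h2⟩, ?_⟩
  have i1 := hc.1
  have i2 := hc.2.1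
  obtain ⟨i, hi⟩ : ∃ i : Fin I.m, tt ((c : ℤ) / 2) = (i : ℕ) + 1 :=
    ⟨⟨(tt ((c : ℤ) / 2) - 1).toNat, by omega⟩, by simp only; omega⟩
  rcases Int.emod_two_eq_zero_or_one (c : ℤ) with h0 | h0
  · refine ⟨Sum.inl i, by rw [hi, h0, pathCode]; ring, (hs.cancelled_eq_inl hI _ i).2 ?_⟩
    rw [if_pos h0, if_pos h0, hi] at h3
    exact h3
  · refine ⟨Sum.inr i, by rw [hi, h0, pathCode], (hs.cancelled_eq_inr hI _ i).2 ?_⟩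
    rw [if_neg (by omega), if_neg (by omega), hi] at h3
    exact h3

/-- The replacement of a path by one in the list, given the function `k` that finds the next number
in the list. -/
def nextPos {m : ℕ} (k : ℤ → ℕ) : TrainPath m → ℕ
  | Sum.inl i => 2 * k ((i : ℕ) + 1)
  | Sum.inr i => 2 * k ((i : ℕ) + 1) + 1

/-- The replacement keeps the direction of the path and depends on the list alone, so a hitting set
can be moved to listed positions for all jobs simultaneously. -/
theorem posHit_nextPos {h cnt : ℕ} (hI : I.IsValid) (hP : I.SingletonPossessions) (hκ0 : 0 ≤ κ)
    (hκ : I.δ < (κ + 1) * I.Δ) (hs : Scaled I j Q D w a b r e)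
    (G : Grid I.m h ((r - a) / D) ((e - a) / D) tt cnt) (hh : (h : ℤ) = I.m ∨ (h : ℤ) = κ + 2)
    {k : ℤ → ℕ} (hk : ∀ x, ∀ i : ℕ, 1 ≤ i → i < k x → tt i < x)
    (hk' : ∀ x, ∀ i : ℕ, k x ≤ i → i < cnt → x ≤ tt i) {l : TrainPath I.m} (hl : I.Single j l) :
    nextPos k l < 2 * cnt ∧ PosHit I.m D w a b r e tt (nextPos k l) := by
  have g := hs.admissible hI hP hκ0 hκ
  rcases l with i | i
  · obtain ⟨h1, h2⟩ := G.hit_next g hh (Or.inl ⟨rfl, rfl⟩) ((hs.single_inl hI i).1 hl) (hk _) (hk' _)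
    refine ⟨by rw [nextPos]; omega, ?_⟩
    rw [PosHit, nextPos]
    push_cast
    rw [Int.mul_emod_right, if_pos rfl, if_pos rfl, Int.mul_ediv_cancel_left _ two_ne_zero]
    exact h2
  · obtain ⟨h1, h2⟩ := G.hit_next g hh (Or.inr ⟨rfl, rfl⟩) ((hs.single_inr hI i).1 hl) (hk _) (hk' _)
    refine ⟨by rw [nextPos]; omega, ?_⟩
    rw [PosHit, nextPos]
    push_cast
    rw [if_neg (by omega), if_neg (by omega),
      show (2 * (k ((i : ℕ) + 1) : ℤ) + 1) / 2 = k ((i : ℕ) + 1) by omega]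
    exact h2

theorem exists_posHit {h cnt : ℕ} (hI : I.IsValid) (hP : I.SingletonPossessions) (hκ0 : 0 ≤ κ)
    (hκ : I.δ < (κ + 1) * I.Δ) (hs : Scaled I j Q D w a b r e)
    (G : Grid I.m h ((r - a) / D) ((e - a) / D) tt cnt) (hh : (h : ℤ) = I.m ∨ (h : ℤ) = κ + 2) :
    ∃ x < 2 * cnt, PosHit I.m D w a b r e tt x := by
  have hne : ((I.job j).r : ℝ) ∈ I.startTimes j :=
    ⟨le_rfl, by have := hI.window j; exact_mod_cast this⟩
  obtain ⟨l, -, hl⟩ := hP.exists_single hne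
  choose k k1 k2 k3 k4 using G.exists_first
  exact ⟨_, posHit_nextPos hI hP hκ0 hκ hs G hh k3 k4 hl⟩

end

/-- A smallest set of positions that contains a possession of each job yields an optimal
solution. -/
theorem Inst.isOptimal_of_positions {I : Inst} (hI : I.IsValid) (hP : I.SingletonPossessions)
    {Q D w a b r e : Fin I.n → ℤ} {κ : ℤ} {h cnt : ℕ} {tt : ℤ → ℤ} (hκ0 : 0 ≤ κ)
    (hκ : I.δ < (κ + 1) * I.Δ) (hs : ∀ j, Scaled I j (Q j) (D j) (w j) (a j) (b j) (r j) (e j))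
    (G : ∀ j, Grid I.m h ((r j - a j) / D j) ((e j - a j) / D j) tt cnt)
    (hh : (h : ℤ) = I.m ∨ (h : ℤ) = κ + 2) {H : Finset ℕ}
    (hmin : ∀ H' ⊆ Finset.range (2 * cnt),
      (∀ j, ∃ x ∈ H', PosHit I.m (D j) (w j) (a j) (b j) (r j) (e j) tt x) → H.card ≤ H'.card)
    {s : Fin I.n → ℝ} (hsH : ∀ j, ∃ x ∈ H, PosHit I.m (D j) (w j) (a j) (b j) (r j) (e j) tt x ∧
      s j = (posWit I.m (D j) (w j) (a j) (b j) (r j) tt x : ℝ) / Q j) : I.IsOptimal s := by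
  classical
  choose x hxH hx hsx using hsH
  have hc := fun j => (hx j).cancelled hI (hs j)
  choose hst l hcode hcl using hc
  simp only [← hsx] at hst hcl
  refine I.isOptimal_of_hitting hP (H := Finset.univ.image l) hst
    (fun j => ⟨l j, Finset.mem_image_of_mem _ (Finset.mem_univ j), hcl j⟩) fun H' hH' => ?_
  -- A position determines its path through `pathCode`, so the paths in use are not more numerous
  -- than the positions in `H`.
  have h1 : (Finset.univ.image l).card ≤ H.card := by
    rw [← Finset.card_image_of_injective _ pathCode_injective]
    refine le_trans (Finset.card_le_card ?_)
      (Finset.card_image_le (f := fun c : ℕ => 2 * tt ((c : ℤ) / 2) + (c : ℤ) % 2))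
    intro z hz
    simp only [Finset.mem_image, Finset.mem_univ, true_and] at hz ⊢
    obtain ⟨_, ⟨j, rfl⟩, rfl⟩ := hz
    exact ⟨x j, hxH j, (hcode j).symm⟩
  refine h1.trans ?_
  rcases isEmpty_or_nonempty (Fin I.n) with hn | ⟨⟨j₀⟩⟩
  · exact (hmin ∅ (by simp) fun j => hn.elim j).trans (by simp)
  -- All jobs share the list, so the grid of any one job yields the replacement for all. The filter
  -- below discards paths that are sent behind the end of the list; no job needs those.
  · choose k k1 k2 k3 k4 using (G j₀).exists_first
    refine (hmin ((H'.image (nextPos k)).filter (· < 2 * cnt)) (fun y hy => ?_) fun j => ?_).trans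
      ((Finset.card_filter_le _ _).trans Finset.card_image_le)
    · simpa using (Finset.mem_filter.1 hy).2
    · obtain ⟨l, hl, hS⟩ := hH' j
      obtain ⟨p1, p2⟩ := posHit_nextPos hI hP hκ0 hκ (hs j) (G j) hh k3 k4 hS
      exact ⟨_, Finset.mem_filter.2 ⟨Finset.mem_image_of_mem _ hl, p1⟩, p2⟩

/-- The first upward path intersects the downward paths that start not too late. -/
theorem Inst.IntersectionsBounded.min_le {I : Inst} {K k : ℕ} (hI : I.IsValid)
    (hK : I.IntersectionsBounded K) (hkm : k ≤ I.m) (hk : ((k : ℚ) - 1) * I.Δ ≤ I.δ) : k ≤ K := by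
  rcases Nat.eq_zero_or_pos k with rfl | hk0
  · exact Nat.zero_le _
  refine le_trans ?_ (hK (Sum.inl ⟨0, by omega⟩))
  have hinj : Function.Injective fun i : Fin k => (Sum.inr (Fin.castLE hkm i) : TrainPath I.m) :=
    fun i i' h => Fin.castLE_injective hkm (Sum.inr.inj h)
  refine le_trans (by rw [Set.ncard_range_of_injective hinj, Nat.card_fin])
    (Set.ncard_le_ncard (s := Set.range fun i : Fin k => (Sum.inr (Fin.castLE hkm i) : TrainPath I.m)) ?_
      (Set.toFinite _))
  rintro _ ⟨i, rfl⟩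
  refine ⟨by simp, ?_⟩
  have hδ : (0 : ℝ) < I.δ := by exact_mod_cast hI.travel_pos
  have hΔ : (0 : ℝ) < I.Δ := by exact_mod_cast hI.headway_pos
  have hk' : ((k : ℝ) - 1) * I.Δ ≤ I.δ := by exact_mod_cast hk
  have hik : ((i : ℕ) : ℝ) ≤ k - 1 := by
    have : (i : ℕ) + 1 ≤ k := i.2
    have : (((i : ℕ) + 1 : ℕ) : ℝ) ≤ k := by exact_mod_cast this
    push_cast at this
    linarith
  have h1 : ((i : ℕ) : ℝ) * I.Δ / I.δ ≤ 1 := by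
    rw [div_le_one hδ]
    exact (mul_le_mul_of_nonneg_right hik hΔ.le).trans hk'
  have h0 : (0 : ℝ) ≤ ((i : ℕ) : ℝ) * I.Δ / I.δ := by positivity
  have hmul : ((i : ℕ) : ℝ) * I.Δ / I.δ * I.δ = (i : ℕ) * I.Δ := div_mul_cancel₀ _ hδ.ne'
  set y := ((i : ℕ) : ℝ) * I.Δ / I.δ with hy
  -- The crossing of the first up-path with a down-path that starts `y * δ` later.
  refine ⟨((1 + y) / 2 * I.δ + I.Δ, (1 + y) / 2 * I.L), ?_, ?_⟩
  · simp only [Inst.seg, segment_eq_image']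
    refine ⟨(1 + y) / 2, ⟨by linarith, by linarith⟩, ?_⟩
    ext
    · simp
      ring
    · simp
  · simp only [Inst.seg, segment_eq_image']
    refine ⟨(1 - y) / 2, ⟨by linarith, by linarith⟩, ?_⟩
    ext
    · simp
      linarith
    · simp
      ring

/-! ### Running time -/

/-- The left side has the form of the time bound in `Tr.forTo`, so nested loops are estimated by
nesting this lemma. -/
theorem loop_le {y k T d c₁ c₂ p q : ℕ} (hy : 1 ≤ y) (hk : k ≤ c₁ * y ^ p) (hT : T ≤ c₂ * y ^ q) :
    k * (T + d + 10) + d + 10 ≤ (c₁ * (c₂ + d + 10) + d + 10) * y ^ (p + q) := by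
  have one (s : ℕ) : 1 ≤ y ^ s := Nat.one_le_pow _ _ hy
  calc k * (T + d + 10) + d + 10
      ≤ c₁ * y ^ p * (c₂ * y ^ q + (d + 10) * y ^ q) + (d + 10) * y ^ (p + q) := by
        rw [add_assoc T, add_assoc _ d 10]
        exact Nat.add_le_add (Nat.mul_le_mul hk (Nat.add_le_add hT (Nat.le_mul_of_pos_right _ (one q))))
          (Nat.le_mul_of_pos_right _ (one _))
    _ = _ := by rw [pow_add]; ring

theorem const_le {y : ℕ} (hy : 1 ≤ y) (c q : ℕ) : c ≤ c * y ^ q :=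
  Nat.le_mul_of_pos_right _ (Nat.one_le_pow _ _ hy)

theorem add_le_mul_pow {y a b c d q : ℕ} (ha : a ≤ c * y ^ q) (hb : b ≤ d * y ^ q) :
    a + b ≤ (c + d) * y ^ q := by
  rw [add_mul]
  exact Nat.add_le_add ha hb

theorem mul_pow_mono {y a c p q : ℕ} (hy : 1 ≤ y) (hpq : p ≤ q) (ha : a ≤ c * y ^ p) :
    a ≤ c * y ^ q :=
  ha.trans (Nat.mul_le_mul_left _ (Nat.pow_le_pow_right hy hpq))

def powTime (h : ℕ) : ℕ :=
  initCmd.time + ((4 * h + 4) * (powBody.time + (Expr.var 9).cost + 10) + (Expr.var 9).cost + 10)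

def jobTime (n : ℕ) : ℕ :=
  n * (jobBody.time + (Expr.var 0).cost + 10) + (Expr.var 0).cost + 10 + jobFinish.time

def listTime (NC h : ℕ) : ℕ :=
  NC * (2 * h + 1) * (listBodyTime NC + (Expr.var 12).cost + 10) + (Expr.var 12).cost + 10 +
    listFinish.time

def hitTime (n N : ℕ) : ℕ :=
  n * (N * (hitBody.time + (Expr.var 16).cost + 10) + (Expr.var 16).cost + 10 +
    (Expr.var 0).cost + 10) + (Expr.var 0).cost + 10

def dpTime (n N W S : ℕ) (L : ℕ → ℕ) : ℕ :=
  (Cmd.store 25 0 1).time + (∑ t ∈ Finset.range N, (levelTime n W S L t + (Expr.var 16).cost + 10) +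
    (Expr.var 16).cost + 10)

def traceTime (N S : ℕ) : ℕ :=
  (S * (bestBody.time + (Expr.var 17).cost + 10) + (Expr.var 17).cost + 10) +
    (N * (traceBody.time + (Expr.var 16).cost + 10) + (Expr.var 16).cost + 10)

def outTime (n N : ℕ) : ℕ :=
  n * (N * (outBody.time + (Expr.var 16).cost + 10) + (Expr.var 16).cost + 10 +
    (Expr.var 0).cost + 10) + (Expr.var 0).cost + 10

/-- After exchanging the two sums, each job contributes the expensive loop at most once, at `t = L
j`. Charging that loop on each level to each job would give a cubic bound. -/
theorem sum_checkTime_le (n N W S : ℕ) (L : ℕ → ℕ) :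
    ∑ t ∈ Finset.range N, checkTime n W S L t ≤
      N * (n * (lastE.cost + 1 + Cmd.skip.time + (Expr.var 0).cost + 10) + (Expr.var 0).cost + 10) +
        n * pruneLoopTime W S := by
  have h1 (t : ℕ) : checkTime n W S L t ≤
      (n * (lastE.cost + 1 + Cmd.skip.time + (Expr.var 0).cost + 10) + (Expr.var 0).cost + 10) +
        ∑ j ∈ Finset.range n, if L j = t then pruneLoopTime W S else 0 := by
    have : ∑ j ∈ Finset.range n, (lastE.cost + 1 + (if L j = t then pruneLoopTime W S
        else Cmd.skip.time) + (Expr.var 0).cost + 10) ≤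
        ∑ j ∈ Finset.range n, ((lastE.cost + 1 + Cmd.skip.time + (Expr.var 0).cost + 10) +
          if L j = t then pruneLoopTime W S else 0) := by
      refine Finset.sum_le_sum fun j _ => ?_
      split_ifs <;> omega
    have h := this.trans_eq Finset.sum_add_distrib
    rw [Finset.sum_const, Finset.card_range, smul_eq_mul] at h
    unfold checkTime
    omega
  refine (Finset.sum_le_sum fun t _ => h1 t).trans ?_
  rw [Finset.sum_add_distrib, Finset.sum_const, Finset.card_range, smul_eq_mul, Finset.sum_comm]
  refine Nat.add_le_add_left ?_ _
  refine (Finset.sum_le_card_nsmul _ _ (pruneLoopTime W S) fun j _ => ?_).trans (by simp)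
  rw [Finset.sum_ite_eq]
  split_ifs
  · exact le_rfl
  · exact Nat.zero_le _

section
variable (b : ℕ)

/-- Here and below, the constants are left to unification with the right-hand sides of the
estimates. -/
theorem exists_powTime_le : ∃ c, ∀ y h : ℕ, 1 ≤ y → h ≤ b → powTime h ≤ c * y ^ 2 :=
  ⟨_, fun y h hy hh => add_le_mul_pow (const_le hy _ 2)
    (mul_pow_mono hy (by omega : 0 + 0 ≤ 2) (loop_le hy (c₁ := 4 * b + 4) (by simp; omega)
      (const_le hy _ _)))⟩

theorem exists_jobTime_le : ∃ c, ∀ y n : ℕ, 1 ≤ y → n ≤ y → jobTime n ≤ c * y ^ 2 :=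
  ⟨_, fun y h hy hn => add_le_mul_pow (mul_pow_mono hy (by omega : 1 + 0 ≤ 2)
    (loop_le hy (c₁ := 1) (by simpa using hn) (const_le hy _ _))) (const_le hy _ 2)⟩

theorem exists_listTime_le : ∃ c, ∀ y NC h : ℕ, 1 ≤ y → h ≤ b → NC ≤ 2 * y →
    listTime NC h ≤ c * y ^ 2 :=
  ⟨_, fun y NC h hy hh hNC => add_le_mul_pow (loop_le (p := 1) (q := 1) (c₁ := 2 * (2 * b + 1)) hy
    (by
      have := Nat.mul_le_mul hNC (show 2 * h + 1 ≤ 2 * b + 1 by omega)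
      rw [pow_one]
      linarith)
    (add_le_mul_pow (const_le hy _ _) (add_le_mul_pow (loop_le (p := 1) (q := 0) hy
      (by rwa [pow_one]) (const_le hy _ _)) (const_le hy _ _)))) (const_le hy _ 2)⟩

theorem exists_hitTime_le : ∃ c, ∀ y n N : ℕ, 1 ≤ y → n ≤ y → N ≤ b * y →
    hitTime n N ≤ c * y ^ 2 :=
  ⟨_, fun y n N hy hn hN => loop_le (p := 1) (q := 1) (c₁ := 1) hy (by simpa using hn)
    (loop_le (p := 1) (q := 0) (c₁ := b) hy (by simpa using hN) (const_le hy _ _))⟩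

theorem exists_outTime_le : ∃ c, ∀ y n N : ℕ, 1 ≤ y → n ≤ y → N ≤ b * y →
    outTime n N ≤ c * y ^ 2 :=
  ⟨_, fun y n N hy hn hN => loop_le (p := 1) (q := 1) (c₁ := 1) hy (by simpa using hn)
    (loop_le (p := 1) (q := 0) (c₁ := b) hy (by simpa using hN) (const_le hy _ _))⟩

theorem exists_traceTime_le : ∃ c, ∀ y N S : ℕ, 1 ≤ y → N ≤ b * y → S ≤ b * y →
    traceTime N S ≤ c * y ^ 2 :=
  ⟨_, fun y N S hy hN hS => mul_pow_mono hy (by omega : 1 ≤ 2) (add_le_mul_pow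
    (loop_le (p := 1) (q := 0) (c₁ := b) hy (by simpa using hS) (const_le hy _ _))
    (loop_le (p := 1) (q := 0) (c₁ := b) hy (by simpa using hN) (const_le hy _ _)))⟩

theorem exists_pruneLoopTime_le : ∃ c, ∀ y W S : ℕ, 1 ≤ y → W ≤ b → S ≤ b * y →
    pruneLoopTime W S ≤ c * y ^ 1 :=
  ⟨_, fun y W S hy hW hS => loop_le (p := 1) (q := 0) (c₁ := b) hy (by simpa using hS)
    (add_le_mul_pow (const_le hy _ _) (add_le_mul_pow (loop_le (p := 0) (q := 0) (c₁ := b) hy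
      (by simpa using hW) (const_le hy _ _)) (const_le hy _ _)))⟩

theorem exists_dpTime_le : ∃ c, ∀ (y n N W S : ℕ) (L : ℕ → ℕ), 1 ≤ y → n ≤ y → W ≤ b →
    N ≤ b * y → S ≤ b * y → dpTime n N W S L ≤ c * y ^ 2 := by
  obtain ⟨c, hc⟩ := exists_pruneLoopTime_le b
  -- The terms `0 + 10` are padding that brings the sum into the form of `loop_le` with `d = 0`.
  have split (n N W S : ℕ) (L : ℕ → ℕ) :
      ∑ t ∈ Finset.range N, (levelTime n W S L t + (Expr.var 16).cost + 10) ≤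
        N * (2 * S * (relaxBody.time + (2 * .var 17 : Expr).cost + 10) + (2 * .var 17 : Expr).cost +
          10 + (Expr.var 16).cost + 10) +
        (N * (n * (lastE.cost + 1 + Cmd.skip.time + (Expr.var 0).cost + 10) + (Expr.var 0).cost +
          10 + 0 + 10) + 0 + 10 + n * pruneLoopTime W S) := by
    have h1 := sum_checkTime_le n N W S L
    have h2 : ∑ t ∈ Finset.range N, (levelTime n W S L t + (Expr.var 16).cost + 10) =
        N * (2 * S * (relaxBody.time + (2 * .var 17 : Expr).cost + 10) + (2 * .var 17 : Expr).cost +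
          10 + (Expr.var 16).cost + 10) + ∑ t ∈ Finset.range N, checkTime n W S L t := by
      rw [show N * (2 * S * (relaxBody.time + (2 * .var 17 : Expr).cost + 10) +
        (2 * .var 17 : Expr).cost + 10 + (Expr.var 16).cost + 10) = ∑ _t ∈ Finset.range N,
          (2 * S * (relaxBody.time + (2 * .var 17 : Expr).cost + 10) + (2 * .var 17 : Expr).cost +
            10 + (Expr.var 16).cost + 10) by simp, ← Finset.sum_add_distrib]
      refine Finset.sum_congr rfl fun t _ => ?_
      rw [levelTime]
      omega
    rw [h2]
    refine Nat.add_le_add_left (h1.trans ?_) _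
    refine Nat.add_le_add_right ?_ _
    have : N * (n * (lastE.cost + 1 + Cmd.skip.time + (Expr.var 0).cost + 10) +
        (Expr.var 0).cost + 10) ≤ N * (n * (lastE.cost + 1 + Cmd.skip.time + (Expr.var 0).cost + 10) +
        (Expr.var 0).cost + 10 + 0 + 10) := Nat.mul_le_mul_left _ (by omega)
    omega
  apply Exists.intro
  intro y n N W S L hy hn hW hN hS
  have hN' : N ≤ b * y ^ 1 := by simpa using hN
  have hn' : n ≤ 1 * y ^ 1 := by simpa using hn
  have t1 := loop_le (p := 1) (q := 1) (d := (Expr.var 16).cost) hy hN'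
    (loop_le (p := 1) (q := 0) (T := relaxBody.time) (d := (2 * .var 17 : Expr).cost) (k := 2 * S)
      (c₁ := 2 * b) hy (by rw [pow_one]; linarith) (const_le hy _ _))
  have t2 := loop_le (p := 1) (q := 1) (d := 0) hy hN'
    (loop_le (p := 1) (q := 0) (T := lastE.cost + 1 + Cmd.skip.time) (d := (Expr.var 0).cost) hy
      hn' (const_le hy _ _))
  have t3 : n * pruneLoopTime W S ≤ c * y ^ 2 := by
    calc n * pruneLoopTime W S ≤ y * (c * y ^ 1) := Nat.mul_le_mul hn (hc y W S hy hW hS)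
      _ = c * y ^ 2 := by ring
  refine add_le_mul_pow (const_le hy _ 2) (add_le_mul_pow (add_le_mul_pow ((split n N W S L).trans
    (add_le_mul_pow (le_trans ?_ t1) (add_le_mul_pow t2 t3))) (const_le hy _ 2)) (const_le hy _ 2))
  omega

end

/-! ### Assembly of the phases. -/

/-- The value of an expression for job `j` in the initial state. -/
def Inst.jobVal (I : Inst) (e : Expr) (j : ℕ) : ℤ := e.val (I.input.setVar 20 j)

/-- Position `x` is a possession of job `j`, in terms of the input. -/
def Inst.JobHit (I : Inst) (tt : ℤ → ℤ) (j x : ℕ) : Prop :=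
  PosHit I.m (I.jobVal headwayE j) (I.jobVal lengthE j) (I.jobVal upE j) (I.jobVal downE j)
    (I.jobVal releaseE j) (I.jobVal latestE j) tt x

/-- The witness for `JobHit`. -/
def Inst.jobWit (I : Inst) (tt : ℤ → ℤ) (j x : ℕ) : ℤ :=
  posWit I.m (I.jobVal headwayE j) (I.jobVal lengthE j) (I.jobVal upE j) (I.jobVal downE j)
    (I.jobVal releaseE j) tt x

theorem Inst.IsValid.scaled {I : Inst} (hI : I.IsValid) (j : Fin I.n) :
    Scaled I j (I.jobVal scaleE j) (I.jobVal headwayE j) (I.jobVal lengthE j) (I.jobVal upE j)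
      (I.jobVal downE j) (I.jobVal releaseE j) (I.jobVal latestE j) :=
  scaled_input hI j

/-- The arrays hold the scaled data of all jobs. -/
def JobsDone.ofInput (I : Inst) (σ : State) : Prop :=
  ∀ j < I.n, σ.arr 13 j = I.jobVal scaleE j ∧ σ.arr 14 j = I.jobVal headwayE j ∧
    σ.arr 15 j = I.jobVal lengthE j ∧ σ.arr 16 j = I.jobVal upE j ∧
    σ.arr 17 j = I.jobVal downE j ∧ σ.arr 18 j = I.jobVal releaseE j ∧
    σ.arr 19 j = I.jobVal latestE j

theorem JobsDone.stHit {I : Inst} {σ : State} (h : JobsDone.ofInput I σ) {j : ℕ} (hj : j < I.n)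
    (x : ℕ) : (StHit σ I.m j x ↔ I.JobHit (σ.arr 21) j x) ∧
      stWit σ I.m j x = I.jobWit (σ.arr 21) j x := by
  obtain ⟨-, h14, h15, h16, h17, h18, h19⟩ := h j hj
  simp only [StHit, stWit, Inst.JobHit, Inst.jobWit, PosHit, posWit, h14, h15, h16, h17, h18, h19,
    and_self]

theorem Listing.grid {m : ℤ} {h n j cnt : ℕ} {cen tt : ℤ → ℤ} {cur : ℤ}
    (hl : Listing (fun x => 1 ≤ x ∧ x ≤ m ∧ InBlocks cen h (2 * n + 2) x) tt cnt cur)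
    (hall : ∀ x : ℤ, 1 ≤ x ∧ x ≤ m ∧ InBlocks cen h (2 * n + 2) x →
      ∃ i : ℕ, 1 ≤ i ∧ i < cnt ∧ tt i = x)
    (h0 : cen (2 * n) = 0) (h1 : cen (2 * n + 1) = m + 1) (hj : j < n) :
    Grid m h (cen (2 * j)) (cen (2 * j + 1)) tt cnt := by
  refine ⟨hl.pos, hl.zero, hl.lt, fun i hi hic => ⟨(hl.mem i hi hic).1, (hl.mem i hi hic).2.1⟩,
    fun x hx1 hxm hx => hall x ⟨hx1, hxm, ?_⟩, hl.rest⟩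
  rcases hx with hx | hx | hx | hx
  · exact ⟨2 * n, by omega, by push_cast; rw [h0]; omega⟩
  · exact ⟨2 * n + 1, by omega, by push_cast; rw [h1]; omega⟩
  · exact ⟨2 * j, by omega, by push_cast; exact hx⟩
  · exact ⟨2 * j + 1, by omega, by push_cast; exact hx⟩

/-- Every job has a usable position by `exists_posHit`, so array `24` really holds the last one and
not the initial `0`. The remaining conditions of `Rows` come from the grid. -/
theorem HitsDone.rows {I : Inst} (hI : I.IsValid) (hP : I.SingletonPossessions) {σ : State}
    {P : ℕ → ℕ → Prop} {u : ℕ → ℕ → ℤ} {h cnt : ℕ} {tt : ℤ → ℤ} {κ : ℤ}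
    (hd : HitsDone P u (2 * cnt) I.n 0 σ) (hPJ : ∀ j < I.n, ∀ x, P j x ↔ I.JobHit tt j x)
    (hκ0 : 0 ≤ κ) (hκ : I.δ < (κ + 1) * I.Δ)
    (G : ∀ j < I.n, Grid I.m h ((I.jobVal releaseE j - I.jobVal upE j) / I.jobVal headwayE j)
      ((I.jobVal latestE j - I.jobVal upE j) / I.jobVal headwayE j) tt cnt)
    (hh : (h : ℤ) = I.m ∨ (h : ℤ) = κ + 2) :
    Rows I.n (2 * cnt) (4 * h + 4) (I.JobHit tt) (fun j => (σ.arr 24 j).toNat) ∧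
      ∀ j < I.n, σ.arr 24 j = ((σ.arr 24 j).toNat : ℤ) := by
  have bound {j x : ℕ} (hj : j < I.n) (hx : I.JobHit tt j x) : 1 ≤ x / 2 ∧ x < 2 * cnt := by
    have h1 : 1 ≤ tt ((x / 2 : ℕ) : ℤ) := by push_cast; exact hx.1
    have := (G j hj).lt_of_one_le h1
    omega
  have key (j : ℕ) (hj : j < I.n) : ∃ y < 2 * cnt, I.JobHit tt j y ∧ σ.arr 24 j = y ∧
      ∀ x, I.JobHit tt j x → x ≤ y := by
    obtain ⟨x, hxN, hx⟩ := exists_posHit hI hP hκ0 hκ (hI.scaled ⟨j, hj⟩) (G j hj) hh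
    obtain ⟨y, -, hy, hPy, h24⟩ := (hd j x hxN (Or.inl hj)).2.2 ((hPJ j hj x).2 hx)
    refine ⟨y, by omega, (hPJ j hj y).1 hPy, h24, fun x' hx' => ?_⟩
    obtain ⟨y', hle, -, -, h24'⟩ :=
      (hd j x' (bound hj hx').2 (Or.inl hj)).2.2 ((hPJ j hj x').2 hx')
    rw [h24] at h24'
    omega
  have eq (j : ℕ) (hj : j < I.n) : σ.arr 24 j = ((σ.arr 24 j).toNat : ℤ) := by
    obtain ⟨y, -, -, h24, -⟩ := key j hj
    rw [h24, Int.toNat_natCast]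
  refine ⟨⟨by omega, fun j hj => ?_, fun j hj => ?_, fun j hj x hx => ?_, fun j hj h0 => ?_,
    fun j hj => ?_⟩, eq⟩
  · obtain ⟨y, hy, -, h24, -⟩ := key j hj
    simp only [h24, Int.toNat_natCast]
    exact hy
  · obtain ⟨y, -, hy, h24, -⟩ := key j hj
    simp only [h24, Int.toNat_natCast]
    exact hy
  · obtain ⟨y, -, -, h24, hy⟩ := key j hj
    simp only [h24, Int.toNat_natCast]
    exact hy x hx
  · have := (bound hj h0).1
    omega
  · obtain ⟨y, -, hy, h24, hmax⟩ := key j hj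
    simp only [h24, Int.toNat_natCast]
    exact (G j hj).local ((hI.scaled ⟨j, hj⟩).admissible hI hP hκ0 hκ) hh hy hmax

/-- The quotient of travel time and headway, rounded down. -/
def Inst.ratio (I : Inst) : ℤ := I.δ.num * I.Δ.den / (I.δ.den * I.Δ.num)

section
variable {I : Inst} (hI : I.IsValid)
include hI

theorem Inst.IsValid.ratio_spec :
    0 ≤ I.ratio ∧ I.ratio * I.Δ ≤ I.δ ∧ I.δ < (I.ratio + 1) * I.Δ := by
  have hΔn : 0 < I.Δ.num := Rat.num_pos.2 hI.headway_pos
  have hδn : 0 < I.δ.num := Rat.num_pos.2 hI.travel_pos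
  have hΔd : (0 : ℤ) < I.Δ.den := by exact_mod_cast I.Δ.den_pos
  have hδd : (0 : ℤ) < I.δ.den := by exact_mod_cast I.δ.den_pos
  have hc : 0 < I.δ.den * I.Δ.num := mul_pos hδd hΔn
  have h1 := Int.ediv_mul_le (I.δ.num * I.Δ.den) hc.ne'
  have h2 := Int.lt_ediv_add_one_mul_self (I.δ.num * I.Δ.den) hc
  have hΔd' : (0 : ℚ) < I.Δ.den := by exact_mod_cast hΔd
  have hδd' : (0 : ℚ) < I.δ.den := by exact_mod_cast hδd
  refine ⟨Int.ediv_nonneg (mul_pos hδn hΔd).le hc.le, ?_, ?_⟩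
  · conv_rhs => rw [← I.δ.num_div_den]
    conv_lhs => rw [← I.Δ.num_div_den]
    rw [← mul_div_assoc, div_le_div_iff₀ hΔd' hδd']
    have : I.ratio * I.Δ.num * I.δ.den ≤ I.δ.num * I.Δ.den := by rw [Inst.ratio]; linarith
    exact_mod_cast this
  · conv_lhs => rw [← I.δ.num_div_den]
    conv_rhs => rw [← I.Δ.num_div_den]
    rw [← mul_div_assoc, div_lt_div_iff₀ hδd' hΔd']
    have : I.δ.num * I.Δ.den < (I.ratio + 1) * I.Δ.num * I.δ.den := by rw [Inst.ratio]; linarith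
    exact_mod_cast this

/-- The window length parameter. -/
theorem Inst.IsValid.exists_radius {K : ℕ} (hK : I.IntersectionsBounded K) :
    ∃ h : ℕ, min (I.ratio + 2) (I.m : ℤ) = h ∧ h ≤ K + 1 := by
  obtain ⟨h0, h1, -⟩ := hI.ratio_spec
  refine ⟨(min (I.ratio + 2) (I.m : ℤ)).toNat, by omega, ?_⟩
  have hk := hK.min_le (k := (min (I.ratio + 1) (I.m : ℤ)).toNat) hI (by omega) (by
    refine le_trans (mul_le_mul_of_nonneg_right ?_ hI.headway_pos.le) h1
    have : (((min (I.ratio + 1) (I.m : ℤ)).toNat : ℕ) : ℤ) - 1 ≤ I.ratio := by omega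
    exact_mod_cast this)
  omega

end

theorem Inst.input_arr_of_le (I : Inst) {a : ℕ} (ha : 10 ≤ a) (z : ℤ) : I.input.arr a z = 0 := by
  obtain ⟨k, rfl⟩ := Nat.exists_eq_add_of_le' ha
  simp only [Inst.input]
  split_ifs <;> rfl

theorem Inst.input_vars_of_le (I : Inst) {x : ℕ} (hx : 8 ≤ x) : I.input.vars x = 0 := by
  obtain ⟨k, rfl⟩ := Nat.exists_eq_add_of_le' hx
  rfl

theorem jobVal_eq {I : Inst} {σ : State} (hs : Same powCmd I.input σ) {e : Expr}
    (he : e ∈ jobExprs) (j : ℕ) : e.val (σ.setVar 20 j) = I.jobVal e j := by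
  have h1 : ∀ x < 8, x ∉ powCmd.wv := by decide
  have h2 : ∀ a < 10, a ∉ powCmd.wa := by decide
  refine jobExprs_congr he (fun x hx => ?_) fun a ha => hs.2 a (h2 a ha)
  simp only [State.setVar_vars]
  split_ifs with h
  · rfl
  · exact hs.1 x (h1 x (by omega))

theorem JobsDone.toInput {I : Inst} {σ σ' : State} (hs : Same powCmd I.input σ)
    (h : JobsDone σ I.n σ') : JobsDone.ofInput I σ' ∧ ∀ j < I.n,
      σ'.arr 20 (2 * j) = (I.jobVal releaseE j - I.jobVal upE j) / I.jobVal headwayE j ∧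
      σ'.arr 20 (2 * j + 1) = (I.jobVal latestE j - I.jobVal upE j) / I.jobVal headwayE j := by
  have m (e : Expr) (he : e ∈ jobExprs) (j : ℕ) := jobVal_eq (I := I) hs he j
  constructor
  · intro j hj
    obtain ⟨h13, h14, h15, h16, h17, h18, h19, -, -⟩ := h j hj
    exact ⟨h13.trans (m _ (by simp [jobExprs]) j), h14.trans (m _ (by simp [jobExprs]) j),
      h15.trans (m _ (by simp [jobExprs]) j), h16.trans (m _ (by simp [jobExprs]) j),
      h17.trans (m _ (by simp [jobExprs]) j), h18.trans (m _ (by simp [jobExprs]) j),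
      h19.trans (m _ (by simp [jobExprs]) j)⟩
  · intro j hj
    obtain ⟨-, -, -, -, -, -, -, h1, h2⟩ := h j hj
    exact ⟨h1.trans (m _ (by simp [jobExprs]) j), h2.trans (m _ (by simp [jobExprs]) j)⟩

theorem JobsDone.ofInput.congr {I : Inst} {σ σ' : State} (h : JobsDone.ofInput I σ)
    (ha : ∀ a, 13 ≤ a → a ≤ 19 → σ'.arr a = σ.arr a) : JobsDone.ofInput I σ' := by
  intro j hj
  simp only [ha 13 (by omega) (by omega), ha 14 (by omega) (by omega), ha 15 (by omega) (by omega),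
    ha 16 (by omega) (by omega), ha 17 (by omega) (by omega), ha 18 (by omega) (by omega),
    ha 19 (by omega) (by omega)]
  exact h j hj

theorem OutDone.solves {I : Inst} (hI : I.IsValid) (hP : I.SingletonPossessions)
    {σ σ' : State} {P : ℕ → ℕ → Prop} {u : ℕ → ℕ → ℤ} {h cnt : ℕ} {tt : ℤ → ℤ} {κ : ℤ}
    {H : Finset ℕ} (hout : ∀ j < I.n, OutDone σ (2 * cnt) j σ')
    (hd : HitsDone P u (2 * cnt) I.n 0 σ) (hPJ : ∀ j < I.n, ∀ x, P j x ↔ I.JobHit tt j x)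
    (hu : ∀ j < I.n, ∀ x, u j x = I.jobWit tt j x) (h13 : JobsDone.ofInput I σ)
    (hκ0 : 0 ≤ κ) (hκ : I.δ < (κ + 1) * I.Δ)
    (G : ∀ j < I.n, Grid I.m h ((I.jobVal releaseE j - I.jobVal upE j) / I.jobVal headwayE j)
      ((I.jobVal latestE j - I.jobVal upE j) / I.jobVal headwayE j) tt cnt)
    (hh : (h : ℤ) = I.m ∨ (h : ℤ) = κ + 2)
    (hmin : ∀ H' ⊆ Finset.range (2 * cnt), (∀ j < I.n, ∃ x ∈ H', I.JobHit tt j x) →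
      H.card ≤ H'.card)
    (hH : ∀ x < 2 * cnt, σ.arr 27 (x : ℕ) ≠ 0 ↔ x ∈ H) : I.Solves σ' := by
  refine ⟨fun j => ?_, ?_⟩
  · obtain ⟨x, -, -, -, -, h11⟩ := hout j j.2
    rw [h11, (h13 j j.2).1]
    exact (hI.scaled j).pos
  · refine I.isOptimal_of_positions hI hP hκ0 hκ hI.scaled (fun j => G j j.2) hh (H := H)
      (fun H' hH' hj => hmin H' hH' fun j hjn => hj ⟨j, hjn⟩) fun j => ?_
    obtain ⟨x, hxN, h27, h22, h10, h11⟩ := hout j j.2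
    obtain ⟨d1, d2, -⟩ := hd j x hxN (Or.inl j.2)
    have hPx : P j x := by
      by_contra hno
      rw [if_neg hno] at d1
      exact h22 d1
    refine ⟨x, (hH x hxN).1 h27, (hPJ j j.2 x).1 hPx, ?_⟩
    rw [h10, h11, d2 hPx, hu j j.2, (h13 j j.2).1]
    rfl

theorem solver_spec {I : Inst} (hI : I.IsValid) (hP : I.SingletonPossessions)
    {Wd B h Th Td Tt To : ℕ} (hB : 2 ≤ B) (hWd : B ^ solverExp ≤ Wd) (hb : I.input.Bdd B)
    (hz : ∀ e ∈ jobExprs, ∀ j < I.n, |I.jobVal e j| ≤ B)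
    (hh : min (I.ratio + 2) (I.m : ℤ) = h)
    (hS : 2 ^ (4 * h + 4) * 2 ^ (4 * h + 4) * 2 ^ (4 * h + 4) *
      (2 * ((2 * I.n + 2) * (2 * h + 1) + 1)) * 2 ≤ B) (hmB : I.m + 1 ≤ B)
    (tH : ∀ cnt ≤ (2 * I.n + 2) * (2 * h + 1) + 1, hitTime I.n (2 * cnt) ≤ Th)
    (tD : ∀ cnt ≤ (2 * I.n + 2) * (2 * h + 1) + 1, ∀ L, dpTime I.n (2 * cnt) (4 * h + 4)
      (2 ^ (4 * h + 4) * 2 ^ (4 * h + 4) * 2 ^ (4 * h + 4) * (2 * cnt)) L ≤ Td)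
    (tT : ∀ cnt ≤ (2 * I.n + 2) * (2 * h + 1) + 1, traceTime (2 * cnt)
      (2 ^ (4 * h + 4) * 2 ^ (4 * h + 4) * 2 ^ (4 * h + 4) * (2 * cnt)) ≤ Tt)
    (tO : ∀ cnt ≤ (2 * I.n + 2) * (2 * h + 1) + 1, outTime I.n (2 * cnt) ≤ To) :
    Tr Wd solver I.input (powTime h + (jobTime I.n + (listTime (2 * I.n + 2) h +
      (Th + (Td + (Tt + To)))))) I.Solves := by
  obtain ⟨hκ0, -, hκ⟩ := hI.ratio_spec
  have hh' : (h : ℤ) = I.m ∨ (h : ℤ) = I.ratio + 2 := by omega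
  obtain ⟨p, hp⟩ : ∃ p, 2 ^ (4 * h + 4) = p := ⟨_, rfl⟩
  obtain ⟨F, hF⟩ : ∃ F, (2 * I.n + 2) * (2 * h + 1) = F := ⟨_, rfl⟩
  have hWp : 4 * h + 4 < p := hp ▸ Nat.lt_two_pow_self
  have hnF : 2 * I.n + 2 ≤ F := hF ▸ Nat.le_mul_of_pos_right _ (by omega)
  rw [hp, hF] at hS
  have hp3 : 1 ≤ p * p * p := Nat.mul_pos (Nat.mul_pos (by omega) (by omega)) (by omega)
  have hF4 : 2 * (F + 1) * 2 ≤ B := by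
    refine le_trans ?_ hS
    rw [mul_assoc (p * p * p)]
    exact Nat.le_mul_of_pos_left _ hp3
  have hpB : p ≤ B := by
    refine le_trans ?_ hS
    rw [mul_assoc (p * p * p), mul_assoc (p * p), mul_assoc p]
    refine Nat.le_mul_of_pos_right _ (Nat.mul_pos (by omega) (Nat.mul_pos (by omega) (by omega)))
  have hS1 : p * p * p * (2 * (F + 1)) ≤ B := le_trans (Nat.le_mul_of_pos_right _ two_pos) hS
  -- powers of two
  refine Tr.seq (powCmd_spec hB hWd hb hh (by rw [hp]; exact hpB)
    (I.input_arr_of_le (by norm_num))) ?_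
  rintro σ1 s1 ⟨b1, v8, v9, v10, a12⟩
  -- data of the jobs
  refine Tr.seq (jobCmd_spec (n := I.n) (m := I.m) hB hWd b1 (s1.1 0 (by decide))
    (s1.1 1 (by decide)) v8
    (fun z => by rw [s1.2 20 (by decide), I.input_arr_of_le (by norm_num)])
    (fun e he j hj => by rw [jobVal_eq s1 he]; exact hz e he j hj) (by omega) (by omega)) ?_
  rintro σ2 s2 ⟨b2, jd, c0, c1, v11, v12, v13⟩
  obtain ⟨jd2, cen⟩ := jd.toInput s1
  -- the list of path numbers
  have var2 (x : ℕ) (h1 : x ∉ powCmd.wv) (h2 : x ∉ jobCmd.wv) : σ2.vars x = I.input.vars x :=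
    (s2.1 x h2).trans (s1.1 x h1)
  have arr2 (x : ℕ) (h1 : x ∉ powCmd.wa) (h2 : x ∉ jobCmd.wa) : σ2.arr x = I.input.arr x :=
    (s2.2 x h2).trans (s1.2 x h1)
  refine Tr.seq (listCmd_spec (m := I.m) (h := h) (NC := 2 * I.n + 2) (Bm := p) hB hWd b2
    (var2 1 (by decide) (by decide)) ((s2.1 8 (by decide)).trans v8)
    ((s2.1 10 (by decide)).trans (by rw [v10, hp])) v11 v12 v13
    ((var2 14 (by decide) (by decide)).trans (I.input_vars_of_le (by norm_num)))
    (fun z => by rw [arr2 21 (by decide) (by decide), I.input_arr_of_le (by norm_num)])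
    hmB (by rw [hF]; omega) (by rw [hF]; exact hS1)) ?_
  rintro σ3 s3 ⟨b3, cnt, cur, hcnt, v16, v17, hl, hall⟩
  have hcnt' := hcnt
  rw [hF] at hcnt'
  have hpos := hl.pos
  have hSB : 2 * (p * p * p * (2 * cnt)) ≤ B := by
    refine le_trans ?_ hS
    rw [mul_comm 2]
    exact Nat.mul_le_mul_right _ (Nat.mul_le_mul_left _ (by omega))
  have var3 (x : ℕ) (h1 : x ∉ powCmd.wv) (h2 : x ∉ jobCmd.wv) (h3 : x ∉ listCmd.wv) :
      σ3.vars x = I.input.vars x := (s3.1 x h3).trans (var2 x h1 h2)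
  have arr3 (x : ℕ) (h1 : x ∉ powCmd.wa) (h2 : x ∉ jobCmd.wa) (h3 : x ∉ listCmd.wa) :
      σ3.arr x = I.input.arr x := (s3.2 x h3).trans (arr2 x h1 h2)
  have n3 : ∀ a < 20, 13 ≤ a → a ∉ listCmd.wa := by decide
  have jd3 := jd2.congr (σ' := σ3) fun a h1 h2 => s3.2 a (n3 a (by omega) h1)
  set tt := σ3.arr 21 with htt
  have G : ∀ j < I.n, Grid I.m h ((I.jobVal releaseE j - I.jobVal upE j) / I.jobVal headwayE j)
      ((I.jobVal latestE j - I.jobVal upE j) / I.jobVal headwayE j) tt cnt := by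
    intro j hj
    rw [← (cen j hj).1, ← (cen j hj).2]
    exact hl.grid hall c0 c1 hj
  -- the hit matrix
  refine Tr.seq ((hitCmd_spec (N := 2 * cnt) (n := I.n) (m := I.m) hB hWd b3
    (var3 0 (by decide) (by decide) (by decide)) (var3 1 (by decide) (by decide) (by decide)) v16
    (by omega) (by omega) fun j hj => by
      rw [(jd3 j hj).2.1]; exact (hI.scaled ⟨j, hj⟩).D_pos hI).mono (tH cnt hcnt)
        fun _ _ h => h) ?_
  rintro σ4 s4 ⟨b4, hits⟩
  have hPJ : ∀ j < I.n, ∀ x, StHit σ3 I.m j x ↔ I.JobHit tt j x :=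
    fun j hj x => (JobsDone.stHit jd3 hj x).1
  obtain ⟨hrows, h24⟩ := hits.rows hI hP hPJ hκ0 hκ G hh'
  have n4 : ∀ a < 20, 13 ≤ a → a ∉ hitCmd.wa := by decide
  have jd4 := jd3.congr (σ' := σ4) fun a h1 h2 => s4.2 a (n4 a (by omega) h1)
  have v16' : σ4.vars 16 = (2 * cnt : ℕ) := (s4.1 16 (by decide)).trans v16
  have v17' : σ4.vars 17 = (p * p * p * (2 * cnt) : ℕ) := (s4.1 17 (by decide)).trans v17
  have v04 : σ4.vars 0 = I.n :=
    (s4.1 0 (by decide)).trans (var3 0 (by decide) (by decide) (by decide))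
  -- dynamic programming
  refine Tr.seq ((dpCmd_spec (n := I.n) (N := 2 * cnt) (W := 4 * h + 4)
    (S := p * p * p * (2 * cnt)) (A := I.JobHit tt) hB hWd b4 hrows v04
    ((s4.1 9 (by decide)).trans ((s3.1 9 (by decide)).trans ((s2.1 9 (by decide)).trans v9)))
    ((s4.1 10 (by decide)).trans ((s3.1 10 (by decide)).trans ((s2.1 10 (by decide)).trans v10)))
    v16' v17' (by rw [hp])
    (fun z => by
      rw [s4.2 12 (by decide), s3.2 12 (by decide), s2.2 12 (by decide)]; exact a12 z)
    h24 (fun j hj x hx => ?_)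
    (fun z => by rw [s4.2 25 (by decide), arr3 25 (by decide) (by decide) (by decide),
      I.input_arr_of_le (by norm_num)]) (by omega) hSB (by omega) (by omega) (by omega)).mono
    (by have := tD cnt hcnt fun j => (σ4.arr 24 j).toNat
        rw [hp] at this
        exact this) fun _ _ h => h) ?_
  · rw [← hPJ j hj x, (hits j x hx (Or.inl hj)).1]
    split_ifs with hc <;> simp [hc]
  rintro σ5 s5 ⟨b5, hsound, hcomp⟩
  -- backtracking
  refine Tr.seq ((traceCmd_spec (n := I.n) (N := 2 * cnt) (W := 4 * h + 4)
    (S := p * p * p * (2 * cnt)) hB hWd b5 hrows ((s5.1 16 (by decide)).trans v16')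
    ((s5.1 17 (by decide)).trans v17') (by rw [hp])
    ((s5.1 24 (by decide)).trans ((s4.1 24 (by decide)).trans
      ((var3 24 (by decide) (by decide) (by decide)).trans (I.input_vars_of_le (by norm_num)))))
    (by omega) (by omega) (by omega) hsound hcomp).mono
    (by have := tT cnt hcnt
        rw [hp] at this
        exact this) fun _ _ h => h) ?_
  rintro σ6 s6 ⟨b6, H, hHN, hHj, hmin, h27⟩
  have arr6 (x : ℕ) (h5 : x ∉ dpCmd.wa) (h6 : x ∉ traceCmd.wa) : σ6.arr x = σ4.arr x :=
    (s6.2 x h6).trans (s5.2 x h5)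
  have e22 : σ6.arr 22 = σ4.arr 22 := arr6 22 (by decide) (by decide)
  have e23 : σ6.arr 23 = σ4.arr 23 := arr6 23 (by decide) (by decide)
  have e24 : σ6.arr 24 = σ4.arr 24 := arr6 24 (by decide) (by decide)
  have hits6 : HitsDone (StHit σ3 I.m) (stWit σ3 I.m) (2 * cnt) I.n 0 σ6 := by
    unfold HitsDone
    rw [e22, e23, e24]
    exact hits
  have n6 : ∀ a < 20, 13 ≤ a → a ∉ dpCmd.wa ∧ a ∉ traceCmd.wa := by decide
  have jd6 := jd4.congr (σ' := σ6) fun a h1 h2 =>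
    arr6 a (n6 a (by omega) h1).1 (n6 a (by omega) h1).2
  -- output
  refine (outCmd_spec (N := 2 * cnt) (n := I.n) hB hWd b6
    ((s6.1 0 (by decide)).trans ((s5.1 0 (by decide)).trans v04))
    ((s6.1 16 (by decide)).trans ((s5.1 16 (by decide)).trans v16')) (by omega) (by omega)
    fun j hj => ?_).mono (tO cnt hcnt) ?_
  · obtain ⟨x, hxH, hx⟩ := hHj j hj
    have hxN : x < 2 * cnt := by simpa using hHN hxH
    refine ⟨x, hxN, (h27 x hxN).2 hxH, ?_⟩
    rw [(hits6 j x hxN (Or.inl hj)).1, if_pos ((hPJ j hj x).2 hx)]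
    exact one_ne_zero
  · rintro σ7 - ⟨-, hout⟩
    exact OutDone.solves hI hP hout hits6 hPJ
      (fun j hj x => (JobsDone.stHit jd3 hj x).2) jd6 hκ0 hκ G hh' hmin h27

/-- A constant that bounds the sizes of all tables of the program, relative to the number of
jobs. -/
def tableConst (K : ℕ) : ℕ :=
  2 ^ (4 * K + 8) * 2 ^ (4 * K + 8) * 2 ^ (4 * K + 8) * (4 * (4 * K + 7))

theorem le_tableConst (K : ℕ) : 4 * K + 8 ≤ tableConst K := by
  have h0 : 4 * K + 8 ≤ 2 ^ (4 * K + 8) := Nat.lt_two_pow_self.le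
  have h1 : 1 ≤ 2 ^ (4 * K + 8) := Nat.one_le_two_pow
  rw [tableConst, mul_assoc, mul_assoc]
  exact h0.trans (Nat.le_mul_of_pos_right _ (Nat.mul_pos h1 (Nat.mul_pos h1 (by omega))))

theorem table_le {K h n cnt : ℕ} (hh : h ≤ K + 1)
    (hcnt : cnt ≤ (2 * n + 2) * (2 * h + 1) + 1) :
    2 ^ (4 * h + 4) * 2 ^ (4 * h + 4) * 2 ^ (4 * h + 4) * (2 * cnt) * 2 ≤
      tableConst K * (n + 1) := by
  have hp : 2 ^ (4 * h + 4) ≤ 2 ^ (4 * K + 8) := Nat.pow_le_pow_right two_pos (by omega)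
  have h1 : (2 * n + 2) * (2 * h + 1) ≤ (2 * n + 2) * (2 * K + 3) :=
    Nat.mul_le_mul_left _ (by omega)
  have h2 : cnt ≤ (4 * K + 7) * (n + 1) := by
    have : (2 * n + 2) * (2 * K + 3) + (n + 1) = (4 * K + 7) * (n + 1) := by ring
    omega
  calc _ = 2 ^ (4 * h + 4) * 2 ^ (4 * h + 4) * 2 ^ (4 * h + 4) * (4 * cnt) := by ring
    _ ≤ 2 ^ (4 * K + 8) * 2 ^ (4 * K + 8) * 2 ^ (4 * K + 8) * (4 * ((4 * K + 7) * (n + 1))) :=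
      Nat.mul_le_mul (Nat.mul_le_mul (Nat.mul_le_mul hp hp) hp) (Nat.mul_le_mul_left _ h2)
    _ = _ := by rw [tableConst]; ring

end Maintenance

open Maintenance in
/-- The maintenance scheduling problem with singleton possessions and a bounded number of
intersections is solved by one program in time `O(n ^ 2)` (with a constant that depends only on the
bound `K` on the number of intersections), on a random access machine whose words have
`O(log M)` bits, where `M` bounds the numbers in the input. -/
theorem mainTheorem3 :
    ∃ P : Maintenance.Cmd, ∀ K : ℕ, ∃ C : ℕ, ∀ I : Maintenance.Inst,
      I.IsValid → I.SingletonPossessions → I.IntersectionsBounded K →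
      ∀ M : ℕ, I.InputBounded M →
        ∃ (t : ℕ) (σ : Maintenance.State),
          Maintenance.Exec ((M + 2) ^ C) P I.input t σ ∧
          t ≤ C * (I.n ^ 2 + 1) ∧
          I.Solves σ := by
  refine ⟨solver, fun K => ?_⟩
  set c := tableConst K with hc
  have hc8 : 4 * K + 8 ≤ c := le_tableConst K
  obtain ⟨c1, t1⟩ := exists_powTime_le c
  obtain ⟨c2, t2⟩ := exists_jobTime_le
  obtain ⟨c3, t3⟩ := exists_listTime_le c
  obtain ⟨c4, t4⟩ := exists_hitTime_le c
  obtain ⟨c5, t5⟩ := exists_dpTime_le c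
  obtain ⟨c6, t6⟩ := exists_traceTime_le c
  obtain ⟨c7, t7⟩ := exists_outTime_le c
  -- One constant serves both purposes: the first summand bounds the time, the second one the word
  -- length.
  refine ⟨2 * (c1 + (c2 + (c3 + (c4 + (c5 + (c6 + c7)))))) + (c + 501) * solverExp,
    fun I hI hP hK M hM => ?_⟩
  obtain ⟨h, hh, hhK⟩ := hI.exists_radius hK
  have hnM : I.n ≤ M := by
    have h0 : |((I.n : ℕ) : ℤ)| ≤ M := hM.1 0
    rw [Nat.abs_cast] at h0
    exact_mod_cast h0
  have hmM : I.m ≤ M := by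
    have h0 : |((I.m : ℕ) : ℤ)| ≤ M := hM.1 1
    rw [Nat.abs_cast] at h0
    exact_mod_cast h0
  have hb : I.input.Bdd (M + 2) := State.Bdd.mono (B := M) hM (by omega)
  -- The exponent covers the tables, of size at most `c * (n + 1) ≤ (M + 2) ^ (c + 1)`, and the
  -- scaled job data, whose expressions have weight at most `500`.
  set B := (M + 2) ^ (c + 501) with hBdef
  have pow_le {k : ℕ} (hk : k ≤ c + 501) : (M + 2) ^ k ≤ B := Nat.pow_le_pow_right (by omega) hk
  have hMB : M + 2 ≤ B := by simpa using pow_le (k := 1) (by omega)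
  have hcB : c * (I.n + 1) ≤ B := by
    calc c * (I.n + 1) ≤ (M + 2) ^ c * (M + 2) ^ 1 := by
          refine Nat.mul_le_mul (Nat.lt_two_pow_self.le.trans (Nat.pow_le_pow_left (by omega) _)) ?_
          rw [pow_one]
          omega
      _ = (M + 2) ^ (c + 1) := (pow_add _ _ _).symm
      _ ≤ B := pow_le (by omega)
  -- The time estimates are applied with `y = n + 1`, so that `n = 0` needs no separate treatment.
  have hy : 1 ≤ I.n + 1 := by omega
  have pos : 1 ≤ 2 ^ (4 * h + 4) * 2 ^ (4 * h + 4) * 2 ^ (4 * h + 4) :=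
    Nat.mul_pos (Nat.mul_pos Nat.one_le_two_pow Nat.one_le_two_pow) Nat.one_le_two_pow
  have hS {cnt : ℕ} (hcnt : cnt ≤ (2 * I.n + 2) * (2 * h + 1) + 1) :
      2 ^ (4 * h + 4) * 2 ^ (4 * h + 4) * 2 ^ (4 * h + 4) * (2 * cnt) ≤ c * (I.n + 1) :=
    (Nat.le_mul_of_pos_right _ two_pos).trans (table_le hhK hcnt)
  have hN {cnt : ℕ} (hcnt : cnt ≤ (2 * I.n + 2) * (2 * h + 1) + 1) : 2 * cnt ≤ c * (I.n + 1) :=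
    (Nat.le_mul_of_pos_left _ pos).trans (hS hcnt)
  have wt : ∀ e ∈ jobExprs, e.wt ≤ 500 := by decide
  have run := solver_spec (Wd := (M + 2) ^ (2 * (c1 + (c2 + (c3 + (c4 + (c5 + (c6 + c7)))))) +
      (c + 501) * solverExp)) (B := B) hI hP (by omega)
    (by rw [hBdef, ← pow_mul]; exact Nat.pow_le_pow_right (by omega) (by omega)) (hb.mono hMB)
    (fun e he j hj => (Expr.abs_val_le (by omega)
      (hb.setVar (abs_lt_of_nat (by omega))) e).trans
        (by exact_mod_cast pow_le ((wt e he).trans (by omega)))) hh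
    ((table_le hhK le_rfl).trans hcB) (by omega)
    (fun cnt hcnt => t4 (I.n + 1) _ _ hy (by omega) (hN hcnt))
    (fun cnt hcnt L => t5 (I.n + 1) _ _ _ _ L hy (by omega) (by omega) (hN hcnt) (hS hcnt))
    (fun cnt hcnt => t6 (I.n + 1) _ _ hy (hN hcnt) (hS hcnt))
    (fun cnt hcnt => t7 (I.n + 1) _ _ hy (by omega) (hN hcnt))
  obtain ⟨t, σ, hex, ht, hsol⟩ := run
  refine ⟨t, σ, hex, ht.trans ?_, hsol⟩
  have total := add_le_mul_pow (t1 (I.n + 1) h hy (by omega)) (add_le_mul_pow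
    (t2 (I.n + 1) I.n hy (by omega)) (add_le_mul_pow
      (t3 (I.n + 1) (2 * I.n + 2) h hy (by omega) (by omega))
      (le_refl (c4 * (I.n + 1) ^ 2 + (c5 * (I.n + 1) ^ 2 + (c6 * (I.n + 1) ^ 2 +
        c7 * (I.n + 1) ^ 2))) |>.trans_eq (by ring :
          _ = (c4 + (c5 + (c6 + c7))) * (I.n + 1) ^ 2))))
  refine total.trans ?_
  have sq : (I.n + 1) ^ 2 ≤ 2 * (I.n ^ 2 + 1) := by
    have := sq_nonneg ((I.n : ℤ) - 1)
    zify
    linarith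
  calc _ ≤ (c1 + (c2 + (c3 + (c4 + (c5 + (c6 + c7)))))) * (2 * (I.n ^ 2 + 1)) :=
        Nat.mul_le_mul_left _ sq
    _ = 2 * (c1 + (c2 + (c3 + (c4 + (c5 + (c6 + c7)))))) * (I.n ^ 2 + 1) := by ring
    _ ≤ _ := Nat.mul_le_mul_right _ (Nat.le_add_right _ _)
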